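/- Let $d\in\{2,3\}$ and let $\Omega\subset\mathbb R^d$ be a bounded open polytopal domain with Lipschitz boundary, $f,y_\Omega\in L^2(\Omega)$, $\alpha,\beta>0$ and $a<0<b$. Put $\mathbb U_{ad}=\{v\in L^2(\Omega): a\le v\le b \text{ a.e.}\}$, $\psi(u)=\|u\|_{L^1(\Omega)}$, and $\Pi_{[s,t]}(r)=\min\{t,\max\{s,r\}\}$. Let $(\bar y,\bar p,\bar u)\in H_0^1(\Omega)\times H_0^1(\Omega)\times\mathbb U_{ad}$, with $\bar\lambda\in\partial\psi(\bar u)$ (a function in $L^\infty(\Omega)=L^1(\Omega)^*$), solve the optimality system $$(\nabla\bar y,\nabla v)_{L^2(\Omega)}=(\bar u+f,v)_{L^2(\Omega)},\qquad (\nabla w,\nabla\bar p)_{L^2(\Omega)}=(\bar y-y_\Omega,w)_{L^2(\Omega)}\qquad\forall v,w\in H_0^1(\Omega),$$ $$(\bar p+\alpha\bar u+\beta\bar\lambda,\,u-\bar u)_{L^2(\Omega)}\ge0\qquad\forall u\in\mathbb U_{ad}.$$ Let $\mathscr T$ be a conforming partition of $\bar\Omega$ into closed simplices $K$, put $h_K=\operatorname{diam}(K)$,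 and suppose that $\mathscr T$ is shape regular with constant $\sigma$: each $K$ contains a ball of radius $r>0$ with $h_K\le\sigma r$. Let $\mathbb U_1(\mathscr T)$ be the space of functions in $C(\bar\Omega)$ that are affine on each $K\in\mathscr T$, $\mathbb V(\mathscr T)=\{v\in\mathbb U_1(\mathscr T): v|_{\partial\Omega}=0\}$ and $\mathbb U_{ad,1}(\mathscr T)=\mathbb U_1(\mathscr T)\cap\mathbb U_{ad}$. With $\mathcal V(\mathscr T)$ the set of vertices and $\phi_{\mathrm v}\in\mathbb U_1(\mathscr T)$ the nodal basis functions, put $$(u,v)_{\mathscr T}=\sum_{\mathrm v\in\mathcal V(\mathscr T)}u(\mathrm v)v(\mathrm v)\int_\Omega\phi_{\mathrm v}\,dx,\qquad \psi_{\mathscr T}(u)=\sum_{\mathrm v\in\mathcal V(\mathscr T)}|u(\mathrm v)|\int_\Omega\phi_{\mathrm v}\,dx\qquad(u,v\in\mathbb U_1(\mathscr T)).$$ Let $(\bar y_{\mathscr T},\bar p_{\mathscr T},\bar u_{\mathscr T})\in\mathbb V(\mathscr T)\times\mathbb V(\mathscr T)\times\mathbb U_{ad,1}(\mathscr T)$,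 with $\bar\lambda_{\mathscr T}\in\partial\psi_{\mathscr T}(\bar u_{\mathscr T})$ (an element of $\mathbb U_1(\mathscr T)$, functionals on $\mathbb U_1(\mathscr T)$ being represented through $(\cdot,\cdot)_{\mathscr T}$), solve $$(\nabla\bar y_{\mathscr T},\nabla v)_{L^2(\Omega)}=(\bar u_{\mathscr T}+f,v)_{L^2(\Omega)},\quad(\nabla w,\nabla\bar p_{\mathscr T})_{L^2(\Omega)}=(\bar y_{\mathscr T}-y_\Omega,w)_{L^2(\Omega)}\quad\forall v,w\in\mathbb V(\mathscr T),$$ $$(\bar p_{\mathscr T},u-\bar u_{\mathscr T})_{L^2(\Omega)}+(\alpha\bar u_{\mathscr T}+\beta\bar\lambda_{\mathscr T},u-\bar u_{\mathscr T})_{\mathscr T}\ge0\quad\forall u\in\mathbb U_{ad,1}(\mathscr T).$$ Call a common $(d-1)$-dimensional face of two distinct elements an internal side, and let $\Omega_K$ be the patch that consists of $K$ and of all elements that have an internal side in common with $K$. On an internal side $\gamma$ shared by $K^+$ and $K^-$, with unit normals $\nu^\pm$ to $\gamma$ pointing outward $K^\pm$, put $[\![\nabla z\cdot\nu]\!]=\nu^+\cdot\nabla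 z|_{K^+}+\nu^-\cdot\nabla z|_{K^-}$. For $K\in\mathscr T$ define $$E_{y,K}^2=h_K^4\|\bar u_{\mathscr T}+f\|_{L^2(K)}^2+h_K^3\|[\![\nabla\bar y_{\mathscr T}\cdot\nu]\!]\|_{L^2(\partial K\setminus\partial\Omega)}^2,$$ $$E_{p,K}^2=h_K^4\|\bar y_{\mathscr T}-y_\Omega\|_{L^2(K)}^2+h_K^3\|[\![\nabla\bar p_{\mathscr T}\cdot\nu]\!]\|_{L^2(\partial K\setminus\partial\Omega)}^2,$$ $$E_{u,K}=\|\tilde u-\bar u_{\mathscr T}\|_{L^2(K)},\qquad E_{\lambda,K}=\|\tilde\lambda-\bar\lambda_{\mathscr T}\|_{L^2(K)},$$ where $\tilde\lambda=\Pi_{[-1,1]}\big(-\tfrac1\beta\bar p_{\mathscr T}\big)$ and $\tilde u=\Pi_{[a,b]}\big(-\tfrac1\alpha(\bar p_{\mathscr T}+\beta\tilde\lambda)\big)$. For $\ell\in\{0,1\}$ let $\Pi_K^\ell$ be the $L^2(K)$-orthogonal projection onto the polynomials of degree at most $\ell$, and put $$\mathrm{osc}_{\mathscr T,1}(g;\Omega_K)=\Big(\sum_{K'\in\mathscr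 T,\,K'\subset\Omega_K}h_{K'}^4\|g-\Pi_{K'}^\ell g\|_{L^2(K')}^2\Big)^{1/2}.$$ Then there is a constant $C>0$ that depends only on $d$ and $\sigma$ such that, for every $K\in\mathscr T$ and both $\ell\in\{0,1\}$, $$E_{y,K}\le C\big(\|\bar y-\bar y_{\mathscr T}\|_{L^2(\Omega_K)}+h_K^2\|\bar u-\bar u_{\mathscr T}\|_{L^2(\Omega_K)}+\mathrm{osc}_{\mathscr T,1}(f;\Omega_K)\big),$$ $$E_{p,K}\le C\big(\|\bar p-\bar p_{\mathscr T}\|_{L^2(\Omega_K)}+h_K^2\|\bar y-\bar y_{\mathscr T}\|_{L^2(\Omega_K)}+\mathrm{osc}_{\mathscr T,1}(y_\Omega;\Omega_K)\big),$$ $$E_{u,K}\le\|\bar u-\bar u_{\mathscr T}\|_{L^2(K)}+2\alpha^{-1}\|\bar p-\bar p_{\mathscr T}\|_{L^2(K)},$$ $$E_{\lambda,K}\le\|\bar\lambda-\bar\lambda_{\mathscr T}\|_{L^2(K)}+\beta^{-1}\|\bar p-\bar p_{\mathscr T}\|_{L^2(K)}.$$ -/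

import Mathlib

open MeasureTheory Filter Topology
open scoped ENNReal NNReal RealInnerProductSpace ContDiff Gradient

namespace SparseControl

noncomputable section

/-! ### Domains, Lebesgue norms and Sobolev functions -/

/-- Euclidean space `ℝᵈ`. -/
abbrev E (d : ℕ) : Type := EuclideanSpace ℝ (Fin d)

/-- `Ω` has a Lipschitz boundary: near each boundary point, and in suitable orthonormal coordinates
with last axis `n`, the set `Ω` is the strict epigraph of a Lipschitz function `g` of the remaining
coordinates `z - ⟪n, z⟫ n`. -/
def HasLipschitzBoundary {d : ℕ} (Ω : Set (E d)) : Prop :=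
  ∀ x ∈ frontier Ω, ∃ (n : E d) (r : ℝ) (L : ℝ≥0) (g : E d → ℝ),
    ‖n‖ = 1 ∧ 0 < r ∧ LipschitzWith L g ∧
      ∀ z ∈ Metric.ball x r, (z ∈ Ω ↔ g (z - ⟪n, z⟫ • n) < ⟪n, z⟫)

/-- The norm of `L²(A)`, for `A ⊆ ℝᵈ` with Lebesgue measure. -/
def normL2 {d : ℕ} (A : Set (E d)) (w : E d → ℝ) : ℝ :=
  (eLpNorm w 2 (volume.restrict A)).toReal

/-- `w ∈ L²(Ω)`. -/
def IsL2 {d : ℕ} (Ω : Set (E d)) (w : E d → ℝ) : Prop :=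
  MemLp w 2 (volume.restrict Ω)

/-- `w ∈ H₀¹(Ω)` with weak gradient `G`: the pair `(w, G)` is the `L²`-limit of `(φₙ, ∇φₙ)` for test
functions `φₙ ∈ C_c^∞(Ω)`.  The gradient `G` is determined by `w` up to a null set of `Ω`. -/
def IsH10 {d : ℕ} (Ω : Set (E d)) (w : E d → ℝ) (G : E d → E d) : Prop :=
  MemLp w 2 (volume.restrict Ω) ∧ MemLp G 2 (volume.restrict Ω) ∧
    ∃ φ : ℕ → E d → ℝ,
      (∀ n, ContDiff ℝ ∞ (φ n) ∧ HasCompactSupport (φ n) ∧ tsupport (φ n) ⊆ Ω) ∧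
      Tendsto (fun n => eLpNorm (fun x => φ n x - w x) 2 (volume.restrict Ω)) atTop (𝓝 0) ∧
      Tendsto (fun n => eLpNorm (fun x => ∇ (φ n) x - G x) 2 (volume.restrict Ω)) atTop (𝓝 0)

/-- `w ∈ H₀¹(Ω)` and `(∇w, ∇v)_{L²(Ω)} = (g, v)_{L²(Ω)}` for all `v ∈ H₀¹(Ω)`. -/
def IsWeakSolution {d : ℕ} (Ω : Set (E d)) (g w : E d → ℝ) : Prop :=
  ∃ G : E d → E d, IsH10 Ω w G ∧
    ∀ (v : E d → ℝ) (V : E d → E d), IsH10 Ω v V →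
      ∫ x in Ω, ⟪G x, V x⟫ = ∫ x in Ω, g x * v x

/-! ### The continuous optimality system -/

/-- The projection of the real number `t` onto the interval `[a, b]`. -/
def proj (a b t : ℝ) : ℝ := min b (max a t)

/-- The admissible set `U_ad`. -/
def Uad {d : ℕ} (Ω : Set (E d)) (a b : ℝ) : Set (E d → ℝ) :=
  {w | IsL2 Ω w ∧ ∀ᵐ x ∂(volume.restrict Ω), a ≤ w x ∧ w x ≤ b}

/-- `lam ∈ ∂ψ(u)` where `ψ : L¹(Ω) → ℝ` is the `L¹(Ω)`-norm; continuous linear functionals on `L¹(Ω)`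
are represented by functions of `L^∞(Ω)`. -/
def IsSubgradient {d : ℕ} (Ω : Set (E d)) (u lam : E d → ℝ) : Prop :=
  MemLp lam ∞ (volume.restrict Ω) ∧
    ∀ w : E d → ℝ, MemLp w 1 (volume.restrict Ω) →
      ∫ x in Ω, lam x * (w x - u x) ≤ (∫ x in Ω, |w x|) - ∫ x in Ω, |u x|

/-- `(y, p, u)`, with subgradient `lam ∈ ∂ψ(u)`, solves the optimality system. -/
structure OptimalitySystem {d : ℕ} (Ω : Set (E d)) (f yΩ : E d → ℝ) (α β a b : ℝ)
    (y p u lam : E d → ℝ) : Prop where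
  state : IsWeakSolution Ω (fun x => u x + f x) y
  adjoint : IsWeakSolution Ω (fun x => y x - yΩ x) p
  admissible : u ∈ Uad Ω a b
  subgradient : IsSubgradient Ω u lam
  variational : ∀ w ∈ Uad Ω a b,
    0 ≤ ∫ x in Ω, (p x + α * u x + β * lam x) * (w x - u x)

/-! ### Meshes -/

/-- The closed simplex spanned by a finite set of vertices. -/
def hull {d : ℕ} (K : Finset (E d)) : Set (E d) := convexHull ℝ (K : Set (E d))

/-- A conforming partition of `closure Ω` into `d`-simplices.  A simplex is given by its set of
`d + 1` affinely independent vertices; two simplices meet in the simplex (possibly empty) spanned by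
their common vertices. -/
structure Mesh {d : ℕ} (Ω : Set (E d)) where
  cells : Finset (Finset (E d))
  card_cell : ∀ K ∈ cells, K.card = d + 1
  indep : ∀ K ∈ cells, AffineIndependent ℝ (fun v : K => (v : E d))
  cover : (⋃ K ∈ cells, hull K) = closure Ω
  conforming : ∀ K ∈ cells, ∀ K' ∈ cells,
    hull K ∩ hull K' = convexHull ℝ ((K : Set (E d)) ∩ (K' : Set (E d)))

/-- The size `h_K`. -/
def size {d : ℕ} (K : Finset (E d)) : ℝ := Metric.diam (hull K)

variable {d : ℕ} {Ω : Set (E d)}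

/-- Shape regularity with constant `σ`: each `K` contains a ball of radius at least `h_K / σ`. -/
def Mesh.IsShapeRegular (T : Mesh Ω) (σ : ℝ) : Prop :=
  ∀ K ∈ T.cells, ∃ (x : E d) (r : ℝ), 0 < r ∧ Metric.closedBall x r ⊆ hull K ∧ size K ≤ σ * r

open scoped Classical in
/-- The vertices of the mesh. -/
def Mesh.vertices (T : Mesh Ω) : Finset (E d) := T.cells.biUnion id

open scoped Classical in
/-- The internal sides: common `(d-1)`-dimensional faces (with `d` vertices) of two distinct
cells, each given by its set of vertices. -/
def Mesh.sides (T : Mesh Ω) : Finset (Finset (E d)) :=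
  ((T.cells ×ˢ T.cells).filter (fun q => q.1 ≠ q.2 ∧ (q.1 ∩ q.2).card = d)).image
    (fun q => q.1 ∩ q.2)

open scoped Classical in
/-- The internal sides of the cell `K`. -/
def Mesh.sidesOf (T : Mesh Ω) (K : Finset (E d)) : Finset (Finset (E d)) :=
  T.sides.filter (fun γ => γ ⊆ K)

open scoped Classical in
/-- The cells of the patch of `K`: `K` itself and the cells that have an internal side in common
with `K`. -/
def Mesh.patchCells (T : Mesh Ω) (K : Finset (E d)) : Finset (Finset (E d)) :=
  T.cells.filter (fun K' => K' = K ∨ (T.sidesOf K ∩ T.sidesOf K').Nonempty)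

/-- The patch `Ω_K`. -/
def Mesh.patch (T : Mesh Ω) (K : Finset (E d)) : Set (E d) :=
  ⋃ K' ∈ T.patchCells K, hull K'

/-- The vertices of a cell form an affine basis of `ℝᵈ`. -/
def Mesh.basis (T : Mesh Ω) (K : Finset (E d)) (hK : K ∈ T.cells) : AffineBasis K ℝ (E d) where
  toFun := fun v => (v : E d)
  ind' := T.indep K hK
  tot' := by
    rw [(T.indep K hK).affineSpan_eq_top_iff_card_eq_finrank_add_one]
    simp [T.card_cell K hK]

open scoped Classical in
/-- The hat function `φ_v` of the vertex `v`: on each cell that has `v` as a vertex it is the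
barycentric coordinate that belongs to `v`, and it is `0` elsewhere. -/
def Mesh.hat (T : Mesh Ω) (v x : E d) : ℝ :=
  if h : ∃ K, ∃ (_ : K ∈ T.cells) (_ : v ∈ K), x ∈ hull K then
    (T.basis h.choose h.choose_spec.choose).coord ⟨v, h.choose_spec.choose_spec.choose⟩ x
  else 0

/-! ### Polynomials, projections and oscillation -/

/-- `ℙ_ℓ` for `ℓ ∈ {0, 1}`: constant functions for `ℓ = 0`, affine functions for `ℓ = 1`. -/
def Poly (d : ℕ) (ℓ : Fin 2) : Set (E d → ℝ) :=
  {q | ∃ (c : ℝ) (m : E d), (ℓ = 0 → m = 0) ∧ ∀ x, q x = c + ⟪m, x⟫}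

/-- `q` is the `L²(K)`-orthogonal projection of `g` onto `ℙ_ℓ(K)`. -/
def IsL2Projection (ℓ : Fin 2) (K : Finset (E d)) (g q : E d → ℝ) : Prop :=
  q ∈ Poly d ℓ ∧ ∀ r ∈ Poly d ℓ, ∫ x in hull K, (g x - q x) * r x = 0

/-- The `L²(K)`-orthogonal projection `Π_K^ℓ(g)`. -/
def l2Proj (ℓ : Fin 2) (K : Finset (E d)) (g : E d → ℝ) : E d → ℝ :=
  Classical.epsilon (IsL2Projection ℓ K g)

/-- The oscillation `osc_{𝒯,κ}(g; M)` of `g` on a collection `M` of cells. -/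
def osc (κ : ℕ) (ℓ : Fin 2) (g : E d → ℝ) (M : Finset (Finset (E d))) : ℝ :=
  √(∑ K ∈ M, size K ^ (2 * (κ + 1)) * normL2 (hull K) (fun x => g x - l2Proj ℓ K g x) ^ 2)

/-! ### Finite element spaces and the discrete optimality system -/

/-- `U₁(𝒯)`: continuous functions on `closure Ω` that are affine on each cell.  Only the values on
`closure Ω` matter. -/
def Mesh.U1 (T : Mesh Ω) : Set (E d → ℝ) :=
  {w | ContinuousOn w (closure Ω) ∧ ∀ K ∈ T.cells, ∃ q ∈ Poly d 1, Set.EqOn w q (hull K)}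

/-- `V(𝒯)`: the functions of `U₁(𝒯)` that vanish on `∂Ω`. -/
def Mesh.V (T : Mesh Ω) : Set (E d → ℝ) :=
  {w | w ∈ T.U1 ∧ ∀ x ∈ frontier Ω, w x = 0}

/-- `U_{ad,1}(𝒯)`. -/
def Mesh.Uad1 (T : Mesh Ω) (a b : ℝ) : Set (E d → ℝ) := T.U1 ∩ Uad Ω a b

/-- The gradient of the restriction of `w` to the cell `K`. -/
def cellGrad (w : E d → ℝ) (K : Finset (E d)) (x : E d) : E d := gradientWithin w (hull K) x

/-- `(∇v, ∇w)_{L²(Ω)}` for piecewise affine `v` and `w`. -/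
def Mesh.gradInner (T : Mesh Ω) (v w : E d → ℝ) : ℝ :=
  ∑ K ∈ T.cells, ∫ x in hull K, ⟪cellGrad v K x, cellGrad w K x⟫

/-- The discrete inner product `(v, w)_𝒯`. -/
def Mesh.lumpedInner (T : Mesh Ω) (v w : E d → ℝ) : ℝ :=
  ∑ z ∈ T.vertices, v z * w z * ∫ x in Ω, T.hat z x

/-- The discrete nondifferentiable functional `ψ_𝒯`. -/
def Mesh.psi (T : Mesh Ω) (w : E d → ℝ) : ℝ :=
  ∑ z ∈ T.vertices, |w z| * ∫ x in Ω, T.hat z x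

/-- `lam ∈ ∂ψ_𝒯(u)`; functionals on `U₁(𝒯)` are represented by elements of `U₁(𝒯)` through the
discrete inner product. -/
def Mesh.IsSubgradient (T : Mesh Ω) (u lam : E d → ℝ) : Prop :=
  lam ∈ T.U1 ∧ ∀ w ∈ T.U1, T.lumpedInner lam (fun x => w x - u x) ≤ T.psi w - T.psi u

/-- `(y, p, u)`, with discrete subgradient `lam ∈ ∂ψ_𝒯(u)`, solves the discrete optimality system of
the piecewise linear scheme. -/
structure Mesh.DiscreteOptimalitySystem (T : Mesh Ω) (f yΩ : E d → ℝ) (α β a b : ℝ)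
    (y p u lam : E d → ℝ) : Prop where
  mem_y : y ∈ T.V
  mem_p : p ∈ T.V
  mem_u : u ∈ T.Uad1 a b
  state : ∀ v ∈ T.V, T.gradInner y v = ∫ x in Ω, (u x + f x) * v x
  adjoint : ∀ w ∈ T.V, T.gradInner w p = ∫ x in Ω, (y x - yΩ x) * w x
  subgradient : T.IsSubgradient u lam
  variational : ∀ w ∈ T.Uad1 a b,
    0 ≤ (∫ x in Ω, p x * (w x - u x)) +
      T.lumpedInner (fun x => α * u x + β * lam x) (fun x => w x - u x)

/-! ### Jumps and error indicators -/

/-- `ν` is the unit normal to the face `γ` of the simplex `K` that points outward `K`. -/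
def IsOuterNormal (K γ : Finset (E d)) (ν : E d) : Prop :=
  ‖ν‖ = 1 ∧ (∀ x ∈ γ, ∀ z ∈ γ, ⟪ν, z - x⟫ = 0) ∧ ∀ x ∈ γ, ∀ z ∈ K, z ∉ γ → ⟪ν, z - x⟫ < 0

/-- The outward unit normal of `K` on its face `γ`. -/
def outerNormal (K γ : Finset (E d)) : E d := Classical.epsilon (IsOuterNormal K γ)

open scoped Classical in
/-- The jump `⟦∇w · ν⟧_γ = ν⁺ · ∇w|_{K⁺} + ν⁻ · ∇w|_{K⁻}` on an internal side `γ`; the sum is over the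
two cells that have `γ` as a side. -/
def Mesh.jump (T : Mesh Ω) (w : E d → ℝ) (γ : Finset (E d)) (x : E d) : ℝ :=
  ∑ K ∈ T.cells.filter (fun K => γ ⊆ K), ⟪outerNormal K γ, cellGrad w K x⟫

/-- `‖⟦∇w · ν⟧‖²` in `L²(∂K \ ∂Ω)`, with respect to `(d-1)`-dimensional surface measure. -/
def Mesh.jumpNormSq (T : Mesh Ω) (w : E d → ℝ) (K : Finset (E d)) : ℝ :=
  ∑ γ ∈ T.sidesOf K, ∫ x in hull γ, T.jump w γ x ^ 2 ∂(μHE[d - 1])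

/-- The indicator `(h_K⁴ ‖g‖²_{L²(K)} + h_K³ ‖⟦∇w · ν⟧‖²_{L²(∂K \ ∂Ω)})^{1/2}`. -/
def Mesh.indicator (T : Mesh Ω) (g w : E d → ℝ) (K : Finset (E d)) : ℝ :=
  √(size K ^ 4 * normL2 (hull K) g ^ 2 + size K ^ 3 * T.jumpNormSq w K)

/-- The indicator `E_{y,K}`. -/
def Mesh.Ey (T : Mesh Ω) (f yT uT : E d → ℝ) (K : Finset (E d)) : ℝ :=
  T.indicator (fun x => uT x + f x) yT K

/-- The indicator `E_{p,K}`. -/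
def Mesh.Ep (T : Mesh Ω) (yΩ yT pT : E d → ℝ) (K : Finset (E d)) : ℝ :=
  T.indicator (fun x => yT x - yΩ x) pT K

/-- The function `λ̃`. -/
def lamTilde (β : ℝ) (pT : E d → ℝ) (x : E d) : ℝ := proj (-1) 1 (-(1 / β) * pT x)

/-- The function `ũ`. -/
def uTilde (α β a b : ℝ) (pT : E d → ℝ) (x : E d) : ℝ :=
  proj a b (-(1 / α) * (pT x + β * lamTilde β pT x))

/-- The indicator `E_{u,K}`. -/
def Eu (α β a b : ℝ) (pT uT : E d → ℝ) (K : Finset (E d)) : ℝ :=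
  normL2 (hull K) (fun x => uTilde α β a b pT x - uT x)

/-- The indicator `E_{λ,K}`. -/
def Elam (β : ℝ) (pT lamT : E d → ℝ) (K : Finset (E d)) : ℝ :=
  normL2 (hull K) (fun x => lamTilde β pT x - lamT x)

/-! ### Well-definedness of the hat functions, the normals and the projections -/

/-- The barycentric coordinates of two cells agree on their intersection. -/
theorem Mesh.coord_eq_coord (T : Mesh Ω) {K K' : Finset (E d)} (hK : K ∈ T.cells)
    (hK' : K' ∈ T.cells) {v x : E d} (hv : v ∈ K) (hv' : v ∈ K') (hx : x ∈ hull K)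
    (hx' : x ∈ hull K') :
    (T.basis K hK).coord ⟨v, hv⟩ x = (T.basis K' hK').coord ⟨v, hv'⟩ x := by
  classical
  set A := (T.basis K hK).coord ⟨v, hv⟩ with hA
  set B := (T.basis K' hK').coord ⟨v, hv'⟩ with hB
  have hmem : x ∈ convexHull ℝ ((K : Set (E d)) ∩ (K' : Set (E d))) := by
    rw [← T.conforming K hK K' hK']; exact ⟨hx, hx'⟩
  have hconv : Convex ℝ ((A - B) ⁻¹' ({0} : Set ℝ)) := (convex_singleton 0).affine_preimage _
  have hsub : (K : Set (E d)) ∩ (K' : Set (E d)) ⊆ (A - B) ⁻¹' ({0} : Set ℝ) := by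
    rintro w ⟨hw, hw'⟩
    have h1 : A w = if (⟨v, hv⟩ : K) = ⟨w, hw⟩ then 1 else 0 :=
      (T.basis K hK).coord_apply ⟨v, hv⟩ ⟨w, hw⟩
    have h2 : B w = if (⟨v, hv'⟩ : K') = ⟨w, hw'⟩ then 1 else 0 :=
      (T.basis K' hK').coord_apply ⟨v, hv'⟩ ⟨w, hw'⟩
    simp only [Subtype.mk.injEq] at h1 h2
    simp [h1, h2]
  have := convexHull_min hsub hconv hmem
  simpa [sub_eq_zero] using this

/-- On a cell that contains the vertex `v`, the hat function is the barycentric coordinate. -/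
theorem Mesh.hat_eq_coord (T : Mesh Ω) {K : Finset (E d)} (hK : K ∈ T.cells) {v x : E d}
    (hv : v ∈ K) (hx : x ∈ hull K) : T.hat v x = (T.basis K hK).coord ⟨v, hv⟩ x := by
  have h : ∃ K, ∃ (_ : K ∈ T.cells) (_ : v ∈ K), x ∈ hull K := ⟨K, hK, hv, hx⟩
  rw [Mesh.hat, dif_pos h]
  exact T.coord_eq_coord _ hK _ hv h.choose_spec.choose_spec.choose_spec hx

/-- The hat function of `v` vanishes on the cells that do not contain `v`. -/
theorem Mesh.hat_eq_zero (T : Mesh Ω) {K : Finset (E d)} (hK : K ∈ T.cells) {v x : E d}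
    (hv : v ∉ K) (hx : x ∈ hull K) : T.hat v x = 0 := by
  classical
  by_cases h : ∃ K, ∃ (_ : K ∈ T.cells) (_ : v ∈ K), x ∈ hull K
  · obtain ⟨K', hK', hv', hx'⟩ := h
    rw [T.hat_eq_coord hK' hv' hx']
    set A := (T.basis K' hK').coord ⟨v, hv'⟩ with hA
    have hmem : x ∈ convexHull ℝ ((K : Set (E d)) ∩ (K' : Set (E d))) := by
      rw [← T.conforming K hK K' hK']; exact ⟨hx, hx'⟩
    have hconv : Convex ℝ (A ⁻¹' ({0} : Set ℝ)) := (convex_singleton 0).affine_preimage _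
    have hsub : (K : Set (E d)) ∩ (K' : Set (E d)) ⊆ A ⁻¹' ({0} : Set ℝ) := by
      rintro w ⟨hw, hw'⟩
      have h2 : A w = if (⟨v, hv'⟩ : K') = ⟨w, hw'⟩ then 1 else 0 :=
        (T.basis K' hK').coord_apply ⟨v, hv'⟩ ⟨w, hw'⟩
      have : v ≠ w := by rintro rfl; exact hv hw
      simp [h2, this]
    exact convexHull_min hsub hconv hmem
  · rw [Mesh.hat, dif_neg h]

/-- The outward unit normal exists. -/
theorem outerNormal_spec (T : Mesh Ω) {K γ : Finset (E d)} (hK : K ∈ T.cells) (hγ : γ ⊆ K)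
    (hc : γ.card = d) (hd : 0 < d) : IsOuterNormal K γ (outerNormal K γ) := by
  classical
  refine Classical.epsilon_spec (p := IsOuterNormal K γ) ?_
  have hcard : (K \ γ).card = 1 := by
    rw [Finset.card_sdiff_of_subset hγ, T.card_cell K hK, hc]; omega
  obtain ⟨v, hv⟩ := Finset.card_eq_one.1 hcard
  have hvm : v ∈ K \ γ := by rw [hv]; simp
  have hvK : v ∈ K := (Finset.mem_sdiff.1 hvm).1
  have hvγ : v ∉ γ := (Finset.mem_sdiff.1 hvm).2
  set b := T.basis K hK with hb
  set A := b.coord ⟨v, hvK⟩ with hA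
  have hA1 : A v = 1 := b.coord_apply_eq ⟨v, hvK⟩
  have hA0 : ∀ x ∈ γ, A x = 0 := by
    intro x hx
    exact b.coord_apply_ne (i := ⟨v, hvK⟩) (j := ⟨x, hγ hx⟩)
      (by intro h; apply hvγ; have := congrArg Subtype.val h; simp at this; rwa [this])
  set g : E d := (InnerProductSpace.toDual ℝ (E d)).symm (LinearMap.toContinuousLinearMap A.linear)
    with hg
  have hgi : ∀ x z : E d, ⟪g, z - x⟫ = A z - A x := by
    intro x z
    rw [hg, InnerProductSpace.toDual_symm_apply]
    simpa using A.linearMap_vsub z x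
  obtain ⟨x0, hx0⟩ : γ.Nonempty := by rw [← Finset.card_pos]; omega
  have hgn : 0 < ‖g‖ := by
    rw [norm_pos_iff]; intro h0
    have := hgi x0 v
    rw [h0, hA1, hA0 x0 hx0] at this
    simp at this
  refine ⟨-(‖g‖⁻¹ • g), ?_, ?_, ?_⟩
  · rw [norm_neg, norm_smul, norm_inv, norm_norm, inv_mul_cancel₀ hgn.ne']
  · intro x hx z hz
    rw [inner_neg_left, real_inner_smul_left, hgi, hA0 x hx, hA0 z hz]; simp
  · intro x hx z hz hzγ
    have : z ∈ K \ γ := Finset.mem_sdiff.2 ⟨hz, hzγ⟩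
    rw [hv, Finset.mem_singleton] at this
    subst this
    rw [inner_neg_left, real_inner_smul_left, hgi, hA1, hA0 x hx]
    simpa using hgn

/-- The `L²(K)`-projection exists. -/
theorem l2Proj_spec (ℓ : Fin 2) (K : Finset (E d)) (g : E d → ℝ) (hg : IsL2 (hull K) g) :
    IsL2Projection ℓ K g (l2Proj ℓ K g) := by
  refine Classical.epsilon_spec (p := IsL2Projection ℓ K g) ?_
  set μ := (volume : Measure (E d)).restrict (hull K) with hμ
  have hcomp : IsCompact (hull K) := K.finite_toSet.isCompact_convexHull ℝ
  have hfin : IsFiniteMeasure μ :=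
    ⟨by rw [hμ, Measure.restrict_apply_univ]; exact hcomp.measure_lt_top⟩
  let aff : ℝ × E d → E d → ℝ := fun p x => p.1 + ⟪p.2, x⟫
  have hmem : ∀ p, MemLp (aff p) 2 μ := by
    intro p
    have hc : Continuous (aff p) := by fun_prop
    obtain ⟨C, hC⟩ := hcomp.exists_bound_of_continuousOn hc.continuousOn
    refine MemLp.of_bound hc.aestronglyMeasurable C ?_
    exact ae_restrict_of_forall_mem hcomp.measurableSet hC
  let Φ : ℝ × E d →ₗ[ℝ] Lp ℝ 2 μ :=
    { toFun := fun p => (hmem p).toLp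
      map_add' := by
        intro p q
        rw [← MemLp.toLp_add]
        refine MemLp.toLp_congr _ _ (Eventually.of_forall fun x => ?_)
        simp only [aff, Prod.fst_add, Prod.snd_add, inner_add_left, Pi.add_apply]; ring
      map_smul' := by
        intro c p
        rw [RingHom.id_apply, ← MemLp.toLp_const_smul]
        refine MemLp.toLp_congr _ _ (Eventually.of_forall fun x => ?_)
        simp only [aff, Prod.smul_fst, Prod.smul_snd, real_inner_smul_left, Pi.smul_apply,
          smul_eq_mul]; ring }
  let S : Submodule ℝ (ℝ × E d) :=
    { carrier := {p | ℓ = 0 → p.2 = 0}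
      zero_mem' := fun _ => rfl
      add_mem' := fun {p q} hp hq h => by simp [hp h, hq h]
      smul_mem' := fun c p hp h => by simp [hp h] }
  let W := S.map Φ
  obtain ⟨p, hp, hpW⟩ : W.starProjection hg.toLp ∈ W := W.starProjection_apply_mem _
  refine ⟨aff p, ⟨p.1, p.2, hp, fun x => rfl⟩, ?_⟩
  rintro r ⟨c, m, hm, hr⟩
  have hrr : r = aff (c, m) := funext hr
  have h0 := W.starProjection_inner_eq_zero hg.toLp (Φ (c, m)) ⟨(c, m), hm, rfl⟩
  rw [← hpW] at h0
  rw [L2.inner_def] at h0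
  rw [← h0]
  refine integral_congr_ae ?_
  filter_upwards [Lp.coeFn_sub hg.toLp (Φ p), hg.coeFn_toLp, (hmem p).coeFn_toLp,
    (hmem (c, m)).coeFn_toLp] with x h1 h2 h3 h4
  have h3' : (Φ p : E d → ℝ) x = aff p x := h3
  have h4' : (Φ (c, m) : E d → ℝ) x = aff (c, m) x := h4
  rw [h1, h4', Pi.sub_apply, h2, h3', hrr]
  simp [mul_comm]

end

end SparseControl

namespace SparseControl

noncomputable section

variable {d : ℕ} {Ω : Set (E d)}

/-! The bounds for the control and the subgradient are pointwise. Localizing the optimality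
conditions to arbitrary measurable sets shows that, almost everywhere, `lam` is the projection of
`-p/β` onto `[-1, 1]` and `u` is the projection of `-(p + β lam)/α` onto `[a, b]`
(`OptimalitySystem.ae_eq_proj`). The functions λ̃ and ũ are the same Lipschitz expressions in `pT`,
so the triangle inequality finishes the argument.

The bounds for the state and the adjoint state are two instances of `exists_indicator_bound`, which
compares a weak solution of `-Δw = g` with a pair `(gT, wT)`, where `wT` is piecewise affine. Only
the `L²`-norm of `w - wT` may appear, so both derivatives are moved to a test function φ supported
in a ball of Ω: `∫ gT φ + ∫ wT Δφ = -∫ (g - gT) φ - ∫ (w - wT) Δφ`. For a smooth bump scaled to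
radius `r`, the right side is at most a constant times `r^(d/2) (r⁻² ‖w - wT‖ + ‖g - gT‖)`
(`exists_residual_bound`).

Two choices of the ball isolate the two parts of the indicator. Inside a cell `wT` is affine, so `∫
wT Δφ = 0`; taking φ as a bump times an affine approximation `q` of `gT`, equivalence of norms on
affine functions controls `q`, hence `gT` up to `gT - q` (`exists_element_bound`). Around the
barycentre `b` of an internal side, `wT` is an affine function minus `J max(⟪ν, x - b⟫, 0)`
(`Mesh.exists_kink`). Its distributional Laplacian is `-J` times the surface measure of the
hyperplane, so `∫ wT Δφ` detects the jump `J` (`exists_kink_bound`), and the remaining term in `gT`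
is covered by the element bound on the two adjacent cells.

Compactness of unit spheres makes the constants on the unit ball depend on `d` only, and shape
regularity compares all radii with cell sizes. The Lipschitz boundary gives `interior (closure Ω) ⊆
Ω`, which places the balls inside Ω. -/

/-! ### The Laplacian of test functions -/

/-- The standard orthonormal basis of `ℝᵈ`. -/
abbrev stdBasis (d : ℕ) : OrthonormalBasis (Fin d) ℝ (E d) := EuclideanSpace.basisFun (Fin d) ℝ

/-- The Laplacian. -/
def lap (φ : E d → ℝ) (x : E d) : ℝ :=
  ∑ i, fderiv ℝ (fun z => fderiv ℝ φ z (stdBasis d i)) x (stdBasis d i)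

theorem sum_inner_mul_clm (m : E d) (L : E d →L[ℝ] ℝ) :
    ∑ i, ⟪m, stdBasis d i⟫ * L (stdBasis d i) = L m := by
  conv_rhs => rw [← (stdBasis d).sum_repr' m]
  simp only [map_sum, map_smul, smul_eq_mul, real_inner_comm]

theorem contDiff_fderiv_dir {φ : E d → ℝ} (hφ : ContDiff ℝ ∞ φ) (v : E d) :
    ContDiff ℝ ∞ (fun x => fderiv ℝ φ x v) :=
  (hφ.fderiv_right (m := ∞) (by simp)).clm_apply contDiff_const

theorem contDiff_lap {φ : E d → ℝ} (hφ : ContDiff ℝ ∞ φ) : ContDiff ℝ ∞ (lap φ) :=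
  ContDiff.sum fun _ _ => contDiff_fderiv_dir (contDiff_fderiv_dir hφ _) _

theorem lap_eq_zero_of_notMem_tsupport {φ : E d → ℝ} {x : E d} (hx : x ∉ tsupport φ) :
    lap φ x = 0 := by
  refine Finset.sum_eq_zero fun i _ => ?_
  by_contra h
  exact hx (tsupport_fderiv_apply_subset ℝ (f := φ) (stdBasis d i)
    (tsupport_fderiv_apply_subset ℝ (f := fun z => fderiv ℝ φ z (stdBasis d i)) (stdBasis d i)
      (subset_tsupport _ h)))

theorem hasCompactSupport_lap {φ : E d → ℝ} (hc : HasCompactSupport φ) :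
    HasCompactSupport (lap φ) :=
  HasCompactSupport.of_support_subset_isCompact hc fun x hx => by
    by_contra h
    exact hx (lap_eq_zero_of_notMem_tsupport h)

/-- Integration by parts against the Laplacian of a test function. -/
theorem integral_mul_lap {F φ : E d → ℝ} {C : ℝ≥0} (hF : LipschitzWith C F)
    (hφ : ContDiff ℝ ∞ φ) (hc : HasCompactSupport φ) :
    ∫ x, F x * lap φ x =
      -∑ i, ∫ x, lineDeriv ℝ F x (stdBasis d i) * fderiv ℝ φ x (stdBasis d i) := by
  have hint : ∀ i, Integrable
      (fun x => F x * fderiv ℝ (fun z => fderiv ℝ φ z (stdBasis d i)) x (stdBasis d i)) := by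
    intro i
    refine Continuous.integrable_of_hasCompactSupport
      (hF.continuous.mul (contDiff_fderiv_dir (contDiff_fderiv_dir hφ _) _).continuous) ?_
    exact ((hc.fderiv_apply ℝ _).fderiv_apply ℝ _).mul_left
  simp only [lap, Finset.mul_sum]
  rw [integral_finsetSum _ fun i _ => hint i, ← Finset.sum_neg_distrib]
  refine Finset.sum_congr rfl fun i _ => ?_
  obtain ⟨D, hD⟩ := ContDiff.lipschitzWith_of_hasCompactSupport
    (hc.fderiv_apply ℝ (stdBasis d i)) (contDiff_fderiv_dir hφ (stdBasis d i)) (by simp)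
  rw [hF.integral_lineDeriv_mul_eq hD (hc.fderiv_apply ℝ _), ← integral_neg]
  refine integral_congr_ae (Eventually.of_forall fun x => ?_)
  have := ((contDiff_fderiv_dir hφ (stdBasis d i)).differentiable (by simp)) x
  simp only [this.lineDeriv_eq_fderiv, map_neg]
  ring

theorem integral_test_mul_lap {ψ φ : E d → ℝ} (hψ : ContDiff ℝ ∞ ψ) (hcψ : HasCompactSupport ψ)
    (hφ : ContDiff ℝ ∞ φ) (hc : HasCompactSupport φ) :
    ∫ x, ψ x * lap φ x = -∫ x, ⟪∇ ψ x, ∇ φ x⟫ := by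
  obtain ⟨D, hD⟩ := ContDiff.lipschitzWith_of_hasCompactSupport hcψ hψ (by simp)
  rw [integral_mul_lap hD hφ hc, ← integral_finsetSum]
  · congr 1
    refine integral_congr_ae (Eventually.of_forall fun x => ?_)
    have := (hψ.differentiable (by simp)) x
    simp only [this.lineDeriv_eq_fderiv]
    rw [← (stdBasis d).sum_inner_mul_inner]
    refine Finset.sum_congr rfl fun i _ => ?_
    rw [inner_gradient_left, real_inner_comm, inner_gradient_left]
  · intro i _
    have h1 : (fun x => lineDeriv ℝ ψ x (stdBasis d i) * fderiv ℝ φ x (stdBasis d i)) =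
        fun x => fderiv ℝ ψ x (stdBasis d i) * fderiv ℝ φ x (stdBasis d i) := by
      ext x
      rw [((hψ.differentiable (by simp)) x).lineDeriv_eq_fderiv]
    rw [h1]
    exact Continuous.integrable_of_hasCompactSupport
      ((contDiff_fderiv_dir hψ _).continuous.mul (contDiff_fderiv_dir hφ _).continuous)
      (hc.fderiv_apply ℝ _).mul_left

theorem lineDeriv_const_eq_zero (c : ℝ) (x v : E d) : lineDeriv ℝ (fun _ : E d => c) x v = 0 := by
  rw [(differentiableAt_const c).lineDeriv_eq_fderiv]
  simp

theorem integral_fderiv_eq_zero {φ : E d → ℝ} (hφ : ContDiff ℝ ∞ φ) (hc : HasCompactSupport φ)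
    (v : E d) : ∫ x, fderiv ℝ φ x v = 0 := by
  obtain ⟨D, hD⟩ := ContDiff.lipschitzWith_of_hasCompactSupport hc hφ (by simp)
  -- Integration by parts reverses the direction of the derivative, so starting from `-v` produces
  -- the derivative along `v`.
  have h := (LipschitzWith.const (α := E d) (1 : ℝ)).integral_lineDeriv_mul_eq
    (μ := volume) hD hc (-v)
  have h1 : ∀ x, lineDeriv ℝ φ x (- -v) = fderiv ℝ φ x v := fun x => by
    rw [((hφ.differentiable (by simp)) x).lineDeriv_eq_fderiv, neg_neg]
  simp only [lineDeriv_const_eq_zero, zero_mul, integral_zero, h1, mul_one] at h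
  exact h.symm

/-- One integration by parts is enough: the slope is constant, and the partial derivatives of φ
integrate to zero. This removes a discrete function on a ball inside one cell. -/
theorem integral_affine_mul_lap {φ : E d → ℝ} (hφ : ContDiff ℝ ∞ φ) (hc : HasCompactSupport φ)
    (c : ℝ) (m : E d) : ∫ x, (c + ⟪m, x⟫) * lap φ x = 0 := by
  have hL : LipschitzWith ‖m‖₊ (fun x : E d => c + ⟪m, x⟫) :=
    LipschitzWith.of_dist_le_mul fun x y => by
      rw [Real.dist_eq, dist_eq_norm, add_sub_add_left_eq_sub, ← inner_sub_right]
      exact abs_real_inner_le_norm _ _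
  rw [integral_mul_lap hL hφ hc, neg_eq_zero]
  refine Finset.sum_eq_zero fun i _ => ?_
  have h1 : ∀ x, lineDeriv ℝ (fun x : E d => c + ⟪m, x⟫) x (stdBasis d i) = ⟪m, stdBasis d i⟫ := by
    intro x
    have h : HasFDerivAt (fun x : E d => c + ⟪m, x⟫) (innerSL ℝ m) x :=
      ((innerSL ℝ m).hasFDerivAt).const_add c
    rw [h.differentiableAt.lineDeriv_eq_fderiv, h.fderiv, innerSL_apply_apply]
  simp only [h1, integral_const_mul, integral_fderiv_eq_zero hφ hc, mul_zero]

theorem lipschitzWith_posPart_inner (e : E d) :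
    LipschitzWith ‖e‖₊ (fun x : E d => max ⟪e, x⟫ 0) := by
  have hL : LipschitzWith ‖e‖₊ (fun x : E d => ⟪e, x⟫) :=
    LipschitzWith.of_dist_le_mul fun x y => by
      rw [Real.dist_eq, dist_eq_norm, ← inner_sub_right]
      exact abs_real_inner_le_norm _ _
  exact hL.max_const 0

theorem volume_inner_eq_zero {e : E d} (he : e ≠ 0) : volume {x : E d | ⟪e, x⟫ = 0} = 0 := by
  have h := Measure.addHaar_submodule (volume : Measure (E d)) (LinearMap.ker (innerSL ℝ e).toLinearMap)
    (by
      intro h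
      have : e ∈ LinearMap.ker (innerSL ℝ e).toLinearMap := by rw [h]; trivial
      simp [he] at this)
  convert h using 2
  ext x
  simp

/-- Off a null hyperplane the positive part has gradient `e` on one side and `0` on the other, and
being Lipschitz it admits one integration by parts. Stopping there avoids surface measure: the right
side stands for `‖e‖` times the integral of φ over the hyperplane. -/
theorem integral_posPart_mul_lap {φ : E d → ℝ} (hφ : ContDiff ℝ ∞ φ) (hc : HasCompactSupport φ)
    {e : E d} (he : e ≠ 0) :
    ∫ x, max ⟪e, x⟫ 0 * lap φ x =
      -∫ x, (if 0 < ⟪e, x⟫ then fderiv ℝ φ x e else 0) := by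
  have hld : ∀ᵐ x : E d, ∀ v, lineDeriv ℝ (fun x : E d => max ⟪e, x⟫ 0) x v =
      if 0 < ⟪e, x⟫ then ⟪e, v⟫ else 0 := by
    have h0 : ∀ᵐ x : E d, ⟪e, x⟫ ≠ 0 := by
      rw [ae_iff]; simpa using volume_inner_eq_zero he
    filter_upwards [h0] with x hx v
    have hcont : Continuous fun x : E d => (⟪e, x⟫ : ℝ) := by fun_prop
    rcases lt_or_gt_of_ne hx with hx | hx
    · have h : (fun x : E d => max ⟪e, x⟫ 0) =ᶠ[𝓝 x] fun _ => (0 : ℝ) := by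
        filter_upwards [hcont.continuousAt.eventually_lt_const hx] with z hz
        exact max_eq_right hz.le
      rw [if_neg hx.not_gt, h.lineDeriv_eq, lineDeriv_const_eq_zero]
    · have h : (fun x : E d => max ⟪e, x⟫ 0) =ᶠ[𝓝 x] fun z => (⟪e, z⟫ : ℝ) := by
        filter_upwards [hcont.continuousAt.eventually_const_lt hx] with z hz
        exact max_eq_left hz.le
      have h2 : HasFDerivAt (fun x : E d => (⟪e, x⟫ : ℝ)) (innerSL ℝ e) x :=
        (innerSL ℝ e).hasFDerivAt
      rw [if_pos hx, h.lineDeriv_eq, h2.differentiableAt.lineDeriv_eq_fderiv, h2.fderiv,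
        innerSL_apply_apply]
  have hmeas : MeasurableSet {x : E d | 0 < ⟪e, x⟫} :=
    (isOpen_lt continuous_const (by fun_prop)).measurableSet
  rw [integral_mul_lap (lipschitzWith_posPart_inner e) hφ hc]
  have h1 : ∀ i, ∫ x, lineDeriv ℝ (fun x : E d => max ⟪e, x⟫ 0) x (stdBasis d i) *
        fderiv ℝ φ x (stdBasis d i) =
      ∫ x in {x : E d | 0 < ⟪e, x⟫}, ⟪e, stdBasis d i⟫ * fderiv ℝ φ x (stdBasis d i) := by
    intro i
    rw [← integral_indicator hmeas]
    refine integral_congr_ae ?_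
    filter_upwards [hld] with x hx
    rw [hx, Set.indicator_apply]
    simp only [Set.mem_ofPred_eq]
    split_ifs <;> simp
  simp only [h1]
  rw [← integral_finsetSum]
  · simp only [sum_inner_mul_clm]
    rw [← integral_indicator hmeas]
    rfl
  · intro i _
    exact ((Continuous.integrable_of_hasCompactSupport (contDiff_fderiv_dir hφ _).continuous
      (hc.fderiv_apply ℝ _)).const_mul _).integrableOn

/-! ### Scaled functions -/

/-- The function `Φ` transported from the unit ball to the ball with centre `x₀` and radius `r`. -/
def scaled (Φ : E d → ℝ) (x₀ : E d) (r : ℝ) (x : E d) : ℝ := Φ (r⁻¹ • (x - x₀))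

theorem contDiff_scaled {Φ : E d → ℝ} (h : ContDiff ℝ ∞ Φ) (x₀ : E d) (r : ℝ) :
    ContDiff ℝ ∞ (scaled Φ x₀ r) :=
  h.comp (contDiff_const_smul r⁻¹ |>.comp (contDiff_id.sub contDiff_const))

theorem fderiv_scaled {Φ : E d → ℝ} (h : Differentiable ℝ Φ) (x₀ : E d) (r : ℝ) (x v : E d) :
    fderiv ℝ (scaled Φ x₀ r) x v = r⁻¹ * scaled (fun z => fderiv ℝ Φ z v) x₀ r x := by
  have h1 : HasFDerivAt (fun x : E d => r⁻¹ • (x - x₀)) (r⁻¹ • ContinuousLinearMap.id ℝ (E d)) x :=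
    ((hasFDerivAt_id x).sub_const x₀).const_smul r⁻¹
  have h2 := (h (r⁻¹ • (x - x₀))).hasFDerivAt.comp x h1
  have h3 : fderiv ℝ (scaled Φ x₀ r) x = _ := h2.fderiv
  rw [h3]
  simp [scaled]

theorem lap_scaled {Φ : E d → ℝ} (h : ContDiff ℝ ∞ Φ) (x₀ : E d) (r : ℝ) (x : E d) :
    lap (scaled Φ x₀ r) x = (r ^ 2)⁻¹ * scaled (lap Φ) x₀ r x := by
  have hs : scaled (lap Φ) x₀ r x = ∑ i, scaled (fun y =>
      fderiv ℝ (fun z => fderiv ℝ Φ z (stdBasis d i)) y (stdBasis d i)) x₀ r x := rfl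
  rw [hs, Finset.mul_sum, lap]
  simp only [fderiv_scaled (h.differentiable (by simp))]
  refine Finset.sum_congr rfl fun i _ => ?_
  have hd' : Differentiable ℝ (fun z => fderiv ℝ Φ z (stdBasis d i)) :=
    (contDiff_fderiv_dir h _).differentiable (by simp)
  have hd : DifferentiableAt ℝ (scaled (fun z => fderiv ℝ Φ z (stdBasis d i)) x₀ r) x :=
    ((contDiff_scaled (contDiff_fderiv_dir h _) x₀ r).differentiable (by simp)) x
  rw [fderiv_const_mul hd]
  simp only [_root_.smul_apply, smul_eq_mul]
  rw [fderiv_scaled hd']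
  ring

theorem integral_scaled (F : E d → ℝ) (x₀ : E d) {r : ℝ} (hr : 0 < r) :
    ∫ x, scaled F x₀ r x = r ^ d * ∫ x, F x := by
  simp only [scaled]
  rw [integral_sub_right_eq_self (fun x => F (r⁻¹ • x)) x₀, Measure.integral_comp_smul]
  simp [abs_of_pos hr]

theorem tsupport_scaled_subset {Φ : E d → ℝ} (h : tsupport Φ ⊆ Metric.closedBall 0 1) (x₀ : E d)
    {r : ℝ} (hr : 0 < r) : tsupport (scaled Φ x₀ r) ⊆ Metric.closedBall x₀ r := by
  refine closure_minimal (fun x hx => ?_) Metric.isClosed_closedBall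
  have := h (subset_tsupport _ hx)
  rw [mem_closedBall_zero_iff, norm_smul, norm_inv, Real.norm_of_nonneg hr.le, inv_mul_le_one₀ hr]
    at this
  rwa [mem_closedBall_iff_norm]

/-! ### A radial bump function -/

/-- A smooth radially decreasing function that is positive exactly on the open unit ball. -/
def bump (z : E d) : ℝ := expNegInvGlue (1 - ‖z‖ ^ 2)

theorem contDiff_bump : ContDiff ℝ ∞ (bump (d := d)) :=
  expNegInvGlue.contDiff.comp (contDiff_const.sub (contDiff_norm_sq ℝ))

theorem bump_nonneg (z : E d) : 0 ≤ bump z := expNegInvGlue.nonneg _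

theorem bump_pos {z : E d} (hz : ‖z‖ < 1) : 0 < bump z :=
  expNegInvGlue.pos_of_pos (by nlinarith [norm_nonneg z])

theorem bump_eq_zero {z : E d} (hz : 1 ≤ ‖z‖) : bump z = 0 :=
  expNegInvGlue.zero_of_nonpos (by nlinarith)

theorem tsupport_bump_subset : tsupport (bump (d := d)) ⊆ Metric.closedBall 0 1 := by
  refine closure_minimal (fun x hx => ?_) Metric.isClosed_closedBall
  rw [mem_closedBall_zero_iff]
  by_contra h
  exact hx (bump_eq_zero (not_le.1 h).le)

theorem hasCompactSupport_bump : HasCompactSupport (bump (d := d)) :=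
  (isCompact_closedBall 0 1).of_isClosed_subset (isClosed_tsupport _) tsupport_bump_subset

theorem fderiv_bump (z v : E d) :
    fderiv ℝ bump z v = -(2 * deriv expNegInvGlue (1 - ‖z‖ ^ 2) * ⟪z, v⟫) := by
  have h1 : HasFDerivAt (fun z : E d => 1 - ‖z‖ ^ 2) (-(2 • innerSL ℝ z)) z :=
    ((hasStrictFDerivAt_norm_sq z).hasFDerivAt).const_sub 1
  have h2 : HasDerivAt expNegInvGlue (deriv expNegInvGlue (1 - ‖z‖ ^ 2)) (1 - ‖z‖ ^ 2) :=
    ((expNegInvGlue.contDiff (n := 1)).differentiable (by simp) _).hasDerivAt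
  have h3 : fderiv ℝ bump z = _ := (h2.comp_hasFDerivAt z h1).fderiv
  rw [h3]
  simp only [_root_.smul_apply, _root_.neg_apply, innerSL_apply_apply, smul_eq_mul, nsmul_eq_mul]
  push_cast
  ring

/-- The profile rises from zero at `0` to a positive value at `1`, so the mean value theorem
applies. One such point keeps the integrand of the next lemma from vanishing identically. -/
theorem exists_deriv_expNegInvGlue_pos : ∃ c ∈ Set.Ioo (0 : ℝ) 1, 0 < deriv expNegInvGlue c := by
  have hd : Differentiable ℝ expNegInvGlue :=
    (expNegInvGlue.contDiff (n := 1)).differentiable (by simp)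
  obtain ⟨c, hc, h⟩ := exists_deriv_eq_slope expNegInvGlue (zero_lt_one (α := ℝ))
    hd.continuous.continuousOn hd.differentiableOn
  refine ⟨c, hc, ?_⟩
  rw [h, expNegInvGlue.zero]
  simpa using expNegInvGlue.pos_of_pos one_pos

/-- The integral of the bump function over a hyperplane, in weak form. -/
theorem integral_posPart_mul_lap_bump_pos {e : E d} (he : ‖e‖ = 1) :
    0 < ∫ x, max ⟪e, x⟫ 0 * lap bump x := by
  have he0 : e ≠ 0 := by rintro rfl; simp at he
  rw [integral_posPart_mul_lap contDiff_bump hasCompactSupport_bump he0, ← integral_neg]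
  -- The bump decreases radially, so its derivative along `e` is nonpositive on the half space; the
  -- integrand is in fact continuous and nonnegative.
  have h1 : ∀ x : E d, -(if 0 < ⟪e, x⟫ then fderiv ℝ bump x e else 0) =
      2 * deriv expNegInvGlue (1 - ‖x‖ ^ 2) * max ⟪e, x⟫ 0 := by
    intro x
    rw [fderiv_bump, real_inner_comm]
    split_ifs with h
    · rw [max_eq_left h.le]; ring
    · rw [max_eq_right (not_lt.1 h)]; ring
  simp only [h1]
  have hcd : Continuous (deriv expNegInvGlue) :=
    (expNegInvGlue.contDiff (n := 1)).continuous_deriv le_rfl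
  obtain ⟨c, hc, hpos⟩ := exists_deriv_expNegInvGlue_pos
  -- At this point `1 - ‖x‖²` equals `c`, where the profile has positive derivative.
  have hnorm : ‖√(1 - c) • e‖ ^ 2 = 1 - c := by
    rw [norm_smul, he, mul_one, Real.norm_eq_abs, sq_abs, Real.sq_sqrt (by linarith [hc.2])]
  refine Continuous.integral_pos_of_hasCompactSupport_nonneg_nonzero (x := √(1 - c) • e) ?_ ?_ ?_ ?_
  · fun_prop
  · refine HasCompactSupport.of_support_subset_isCompact (isCompact_closedBall (0 : E d) 1)
      fun x hx => ?_
    rw [mem_closedBall_zero_iff]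
    by_contra h
    apply hx
    have h0 : expNegInvGlue =ᶠ[𝓝 (1 - ‖x‖ ^ 2)] fun _ => 0 := by
      filter_upwards [gt_mem_nhds (show 1 - ‖x‖ ^ 2 < 0 by nlinarith)] with t ht
      exact expNegInvGlue.zero_of_nonpos ht.le
    simp [h0.deriv_eq]
  · intro x
    have := expNegInvGlue.monotone.deriv_nonneg (x := 1 - ‖x‖ ^ 2)
    exact mul_nonneg (mul_nonneg zero_le_two this) (le_max_right _ _)
  · rw [hnorm, real_inner_smul_right, real_inner_self_eq_norm_sq, he, sub_sub_cancel]
    have : 0 < √(1 - c) := Real.sqrt_pos.2 (by linarith [hc.2])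
    rw [max_eq_left (by simp)]
    simp [hpos.ne', this.ne']

/-- The integral is continuous in `e` and positive on the compact unit sphere, so its minimum there
serves as the constant. The empty sphere of `d = 0` is treated apart. -/
theorem exists_posPart_mul_lap_bump_lower_bound (d : ℕ) : ∃ κ : ℝ, 0 < κ ∧
    ∀ e : E d, ‖e‖ = 1 → κ ≤ ∫ x, max ⟪e, x⟫ 0 * lap bump x := by
  have hcont : Continuous fun e : E d => ∫ x, max ⟪e, x⟫ 0 * lap bump x := by
    have hf : Continuous (Function.uncurry fun (e x : E d) => max ⟪e, x⟫ 0 * lap bump x) := by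
      have := (contDiff_lap (contDiff_bump (d := d))).continuous
      simp only [Function.uncurry_def]
      fun_prop
    have := continuous_parametric_integral_of_continuous (μ := volume) hf
      (isCompact_closedBall (0 : E d) 1)
    convert this using 2 with e
    refine (setIntegral_eq_integral_of_forall_compl_eq_zero fun x hx => ?_).symm
    rw [lap_eq_zero_of_notMem_tsupport fun h => hx (tsupport_bump_subset h), mul_zero]
  rcases (Metric.sphere (0 : E d) 1).eq_empty_or_nonempty with h | h
  · refine ⟨1, one_pos, fun e he => ?_⟩
    have : e ∈ Metric.sphere (0 : E d) 1 := by simpa using he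
    simp [h] at this
  · obtain ⟨e₀, he₀, hmin⟩ := (isCompact_sphere (0 : E d) 1).exists_isMinOn h hcont.continuousOn
    exact ⟨_, integral_posPart_mul_lap_bump_pos (by simpa using he₀),
      fun e he => hmin (by simpa using he)⟩

/-! ### Bump functions weighted by affine functions -/

/-- The bump function multiplied by an affine function. -/
def bumpAff (c : ℝ) (m z : E d) : ℝ := bump z * (c + ⟪m, z⟫)

theorem contDiff_bumpAff (c : ℝ) (m : E d) : ContDiff ℝ ∞ (bumpAff c m) :=
  contDiff_bump.mul (contDiff_const.add ((innerSL ℝ m).contDiff))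

theorem tsupport_bumpAff_subset (c : ℝ) (m : E d) :
    tsupport (bumpAff c m) ⊆ Metric.closedBall 0 1 :=
  (tsupport_mul_subset_left (f := bump) (g := fun z => c + ⟪m, z⟫)).trans tsupport_bump_subset

theorem bumpAff_one_zero : bumpAff 1 (0 : E d) = bump := by
  ext z; simp [bumpAff]

theorem lap_bumpAff (c : ℝ) (m z : E d) :
    lap (bumpAff c m) z = (c + ⟪m, z⟫) * lap bump z + 2 * fderiv ℝ bump z m := by
  have hq : ∀ x : E d, HasFDerivAt (fun x : E d => c + ⟪m, x⟫) (innerSL ℝ m) x := fun x =>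
    ((innerSL ℝ m).hasFDerivAt).const_add c
  have hb : ∀ x : E d, HasFDerivAt bump (fderiv ℝ bump x) x := fun x =>
    ((contDiff_bump.differentiable (by simp)) x).hasFDerivAt
  have h1 : ∀ x v : E d, fderiv ℝ (bumpAff c m) x v =
      bump x * ⟪m, v⟫ + (c + ⟪m, x⟫) * fderiv ℝ bump x v := by
    intro x v
    have h : fderiv ℝ (bumpAff c m) x = _ := ((hb x).mul (hq x)).fderiv
    rw [h]
    simp
  have h2 : ∀ x v : E d, fderiv ℝ (fun x => fderiv ℝ (bumpAff c m) x v) x v =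
      2 * (⟪m, v⟫ * fderiv ℝ bump x v) +
        (c + ⟪m, x⟫) * fderiv ℝ (fun x => fderiv ℝ bump x v) x v := by
    intro x v
    have hbv : HasFDerivAt (fun x => fderiv ℝ bump x v) (fderiv ℝ (fun x => fderiv ℝ bump x v) x) x :=
      (((contDiff_fderiv_dir contDiff_bump v).differentiable (by simp)) x).hasFDerivAt
    have hfun : (fun x => fderiv ℝ (bumpAff c m) x v) =
      fun x => bump x * ⟪m, v⟫ + (c + ⟪m, x⟫) * fderiv ℝ bump x v := funext fun x => h1 x v
    rw [hfun]
    have h : fderiv ℝ (fun x => bump x * ⟪m, v⟫ + (c + ⟪m, x⟫) * fderiv ℝ bump x v) x = _ :=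
      (((hb x).mul_const (⟪m, v⟫ : ℝ)).add ((hq x).mul hbv)).fderiv
    rw [h]
    simp only [_root_.add_apply, _root_.smul_apply, smul_eq_mul, innerSL_apply_apply]
    ring
  simp only [lap, h2, Finset.sum_add_distrib, ← Finset.mul_sum]
  rw [sum_inner_mul_clm]
  ring

/-- The bump and its derivatives up to order two are bounded, and an affine function is at most `|c|
+ ‖m‖` on the unit ball. Uniformity in `c` and `m` matters because the weight will be the local
polynomial itself. -/
theorem exists_bumpAff_bound (d : ℕ) : ∃ M : ℝ, 0 < M ∧ ∀ (c : ℝ) (m z : E d),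
    |bumpAff c m z| ≤ M * (|c| + ‖m‖) ∧ |lap (bumpAff c m) z| ≤ M * (|c| + ‖m‖) := by
  obtain ⟨M₀, h₀⟩ := hasCompactSupport_bump.exists_bound_of_continuous
    (contDiff_bump (d := d)).continuous
  obtain ⟨M₁, h₁⟩ := (hasCompactSupport_bump.fderiv ℝ).exists_bound_of_continuous
    ((contDiff_bump (d := d)).continuous_fderiv (by simp))
  obtain ⟨M₂, h₂⟩ := (hasCompactSupport_lap hasCompactSupport_bump).exists_bound_of_continuous
    (contDiff_lap (contDiff_bump (d := d))).continuous
  have p₀ := (norm_nonneg _).trans (h₀ 0)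
  have p₁ := (norm_nonneg _).trans (h₁ 0)
  have p₂ := (norm_nonneg _).trans (h₂ 0)
  refine ⟨M₀ + 2 * M₁ + M₂ + 1, by linarith, fun c m z => ?_⟩
  have hN : 0 ≤ |c| + ‖m‖ := by positivity
  by_cases hz : z ∈ Metric.closedBall (0 : E d) 1
  · rw [mem_closedBall_zero_iff] at hz
    have hq : |c + ⟪m, z⟫| ≤ |c| + ‖m‖ := by
      refine (abs_add_le _ _).trans (add_le_add_right ?_ _)
      calc |⟪m, z⟫| ≤ ‖m‖ * ‖z‖ := abs_real_inner_le_norm _ _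
        _ ≤ ‖m‖ * 1 := by gcongr
        _ = ‖m‖ := mul_one _
    have hf : |fderiv ℝ bump z m| ≤ M₁ * (|c| + ‖m‖) :=
      calc |fderiv ℝ bump z m| ≤ ‖fderiv ℝ bump z‖ * ‖m‖ := (fderiv ℝ bump z).le_opNorm m
        _ ≤ M₁ * (|c| + ‖m‖) := by
          gcongr
          · exact h₁ z
          · linarith [abs_nonneg c]
    have ha : |bump z| * |c + ⟪m, z⟫| ≤ M₀ * (|c| + ‖m‖) :=
      mul_le_mul (h₀ z) hq (abs_nonneg _) p₀
    have hl : |c + ⟪m, z⟫| * |lap bump z| ≤ (|c| + ‖m‖) * M₂ :=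
      mul_le_mul hq (h₂ z) (abs_nonneg _) hN
    constructor
    · rw [bumpAff, abs_mul]
      nlinarith
    · rw [lap_bumpAff]
      refine (abs_add_le _ _).trans ?_
      rw [abs_mul, abs_mul, abs_two]
      nlinarith
  · have hz' : z ∉ tsupport (bumpAff c m) := fun h => hz (tsupport_bumpAff_subset c m h)
    rw [lap_eq_zero_of_notMem_tsupport hz', image_eq_zero_of_notMem_tsupport hz', abs_zero]
    have : 0 ≤ (M₀ + 2 * M₁ + M₂ + 1) * (|c| + ‖m‖) := by positivity
    exact ⟨this, this⟩

/-- An affine function that vanishes on the open unit ball is zero: its value at `0` gives `c = 0`,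
and then its value at `m / (2‖m‖)` excludes `m ≠ 0`. -/
theorem integral_bump_mul_sq_pos {c : ℝ} {m : E d} (h : ¬ (c = 0 ∧ m = 0)) :
    0 < ∫ z, bump z * (c + ⟪m, z⟫) ^ 2 := by
  obtain ⟨z, hz, hz0⟩ : ∃ z : E d, ‖z‖ < 1 ∧ c + ⟪m, z⟫ ≠ 0 := by
    by_contra hcon
    push Not at hcon
    have hc : c = 0 := by simpa using hcon 0 (by simp)
    refine h ⟨hc, ?_⟩
    by_contra hm
    have hm' : 0 < ‖m‖ := norm_pos_iff.2 hm
    have := hcon ((2 * ‖m‖)⁻¹ • m) (by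
      rw [norm_smul, norm_inv, Real.norm_of_nonneg (by positivity), mul_inv, mul_assoc,
        inv_mul_cancel₀ hm'.ne']
      norm_num)
    rw [hc, zero_add, real_inner_smul_right, real_inner_self_eq_norm_sq] at this
    have h2 : 0 < (2 * ‖m‖)⁻¹ * ‖m‖ ^ 2 := by positivity
    linarith
  refine Continuous.integral_pos_of_hasCompactSupport_nonneg_nonzero (x := z) ?_ ?_ ?_ ?_
  · have := (contDiff_bump (d := d)).continuous
    fun_prop
  · exact hasCompactSupport_bump.mul_right
  · exact fun x => mul_nonneg (bump_nonneg x) (sq_nonneg _)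
  · exact mul_ne_zero (bump_pos hz).ne' (pow_ne_zero 2 hz0)

/-- Equivalence of norms on the finite-dimensional space of affine functions: the integral has a
positive minimum on the compact set `|c| + ‖m‖ = 1`, and both sides are homogeneous of degree two.
-/
theorem exists_bump_mul_sq_lower_bound (d : ℕ) : ∃ κ : ℝ, 0 < κ ∧
    ∀ (c : ℝ) (m : E d), κ * (|c| + ‖m‖) ^ 2 ≤ ∫ z, bump z * (c + ⟪m, z⟫) ^ 2 := by
  set S : Set (ℝ × E d) := {p | |p.1| + ‖p.2‖ = 1} with hS
  have hcS : IsCompact S := by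
    refine Metric.isCompact_of_isClosed_isBounded
      (isClosed_eq (by fun_prop) continuous_const) ?_
    refine (Metric.isBounded_closedBall (x := (0 : ℝ × E d)) (r := 1)).subset fun p hp => ?_
    rw [mem_closedBall_zero_iff, Prod.norm_def, max_le_iff, Real.norm_eq_abs]
    have hp' : |p.1| + ‖p.2‖ = 1 := hp
    constructor <;> linarith [abs_nonneg p.1, norm_nonneg p.2]
  have hcont : Continuous fun p : ℝ × E d => ∫ z, bump z * (p.1 + ⟪p.2, z⟫) ^ 2 := by
    have hf : Continuous (Function.uncurry fun (p : ℝ × E d) (z : E d) =>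
        bump z * (p.1 + ⟪p.2, z⟫) ^ 2) := by
      have := (contDiff_bump (d := d)).continuous
      simp only [Function.uncurry_def]
      fun_prop
    have := continuous_parametric_integral_of_continuous (μ := volume) hf
      (isCompact_closedBall (0 : E d) 1)
    convert this using 2 with e
    refine (setIntegral_eq_integral_of_forall_compl_eq_zero fun x hx => ?_).symm
    rw [image_eq_zero_of_notMem_tsupport fun h => hx (tsupport_bump_subset h), zero_mul]
  have hne : S.Nonempty := ⟨(1, 0), by simp [hS]⟩
  obtain ⟨p₀, hp₀, hmin⟩ := hcS.exists_isMinOn hne hcont.continuousOn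
  refine ⟨_, integral_bump_mul_sq_pos (c := p₀.1) (m := p₀.2) ?_, fun c m => ?_⟩
  · rintro ⟨h1, h2⟩
    have hp₀' : |p₀.1| + ‖p₀.2‖ = 1 := hp₀
    simp [h1, h2] at hp₀'
  · set N := |c| + ‖m‖ with hN
    rcases (show 0 ≤ N by positivity).eq_or_lt with h0 | h0
    · rw [← h0]
      simp only [ne_eq, OfNat.ofNat_ne_zero, not_false_eq_true, zero_pow, mul_zero]
      exact integral_nonneg fun z => mul_nonneg (bump_nonneg z) (sq_nonneg _)
    · have hmem : (N⁻¹ * c, N⁻¹ • m) ∈ S := by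
        change |N⁻¹ * c| + ‖N⁻¹ • m‖ = 1
        rw [abs_mul, norm_smul, Real.norm_eq_abs, ← mul_add, ← hN, abs_of_pos (by positivity),
          inv_mul_cancel₀ h0.ne']
      have hle := hmin hmem
      have hval : ∫ z, bump z * (N⁻¹ * c + ⟪N⁻¹ • m, z⟫) ^ 2 =
          (N ^ 2)⁻¹ * ∫ z, bump z * (c + ⟪m, z⟫) ^ 2 := by
        rw [← integral_const_mul]
        refine integral_congr_ae (Eventually.of_forall fun z => ?_)
        simp only [real_inner_smul_left, ← mul_add, mul_pow, inv_pow]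
        exact mul_left_comm _ _ _
      simp only [Set.mem_ofPred_eq] at hle
      rw [hval] at hle
      rwa [mul_comm, ← le_inv_mul_iff₀ (by positivity)]

/-! ### Testing a weak solution with the Laplacian of a test function -/

/-- By Hölder's inequality, strong convergence of one factor suffices. This carries identities from
the approximating test functions in `IsH10` to their limit. -/
theorem tendsto_integral_inner_of_tendsto_eLpNorm {X V : Type*} [MeasurableSpace X] {μ : Measure X}
    [NormedAddCommGroup V] [InnerProductSpace ℝ V] {u : ℕ → X → V} {u₀ v : X → V}
    (hu : ∀ n, MemLp (u n) 2 μ) (hu₀ : MemLp u₀ 2 μ) (hv : MemLp v 2 μ)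
    (h : Tendsto (fun n => eLpNorm (fun x => u n x - u₀ x) 2 μ) atTop (𝓝 0)) :
    Tendsto (fun n => ∫ x, ⟪u n x, v x⟫ ∂μ) atTop (𝓝 (∫ x, ⟪u₀ x, v x⟫ ∂μ)) := by
  have hint : ∀ w : X → V, MemLp w 2 μ → Integrable (fun x => (⟪w x, v x⟫ : ℝ)) μ := fun w hw =>
    memLp_one_iff_integrable.1 (MemLp.of_bilin (p := 2) (q := 2) (fun a b => (⟪a, b⟫ : ℝ)) 1 hw hv
      (hw.1.inner hv.1) (Eventually.of_forall fun x => by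
        simpa using nnnorm_inner_le_nnnorm (𝕜 := ℝ) (w x) (v x)))
  refine tendsto_integral_of_L1' _ (hint _ hu₀).aestronglyMeasurable
    (Eventually.of_forall fun n => hint _ (hu n)) ?_
  have hlim : Tendsto (fun n => (1 : ℝ≥0) * eLpNorm (fun x => u n x - u₀ x) 2 μ * eLpNorm v 2 μ)
      atTop (𝓝 0) := by
    have := ENNReal.Tendsto.mul_const (b := eLpNorm v 2 μ) h (Or.inr hv.2.ne)
    simpa using this
  refine tendsto_of_tendsto_of_tendsto_of_le_of_le tendsto_const_nhds hlim
    (fun _ => zero_le) fun n => ?_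
  have hle := eLpNorm_le_eLpNorm_mul_eLpNorm'_of_norm (p := 2) (q := 2) (r := 1)
    ((hu n).sub hu₀).1 hv.1 (fun a b => (⟪a, b⟫ : ℝ)) 1
    (Eventually.of_forall fun x => by
      simpa using norm_inner_le_norm (𝕜 := ℝ) ((u n - u₀) x) (v x))
  have hfun : ((fun x => (⟪u n x, v x⟫ : ℝ)) - fun x => (⟪u₀ x, v x⟫ : ℝ)) =
      fun x => (⟪(u n - u₀) x, v x⟫ : ℝ) := by
    ext x
    simp [inner_sub_left]
  rw [hfun]
  exact hle

theorem gradient_eq_zero_of_notMem_tsupport {φ : E d → ℝ} {x : E d} (hx : x ∉ tsupport φ) :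
    ∇ φ x = 0 := by
  have h : fderiv ℝ φ x = 0 := by
    by_contra h
    exact hx (support_fderiv_subset ℝ h)
  simp [gradient, h]

theorem continuous_gradient {φ : E d → ℝ} (hφ : ContDiff ℝ ∞ φ) : Continuous fun x => ∇ φ x :=
  (InnerProductSpace.toDual ℝ (E d)).symm.continuous.comp (hφ.continuous_fderiv (by simp))

theorem hasCompactSupport_gradient {φ : E d → ℝ} (hc : HasCompactSupport φ) :
    HasCompactSupport fun x => ∇ φ x :=
  HasCompactSupport.of_support_subset_isCompact hc fun x hx => by
    by_contra h
    exact hx (gradient_eq_zero_of_notMem_tsupport h)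

theorem isH10_test {φ : E d → ℝ} (hφ : ContDiff ℝ ∞ φ) (hc : HasCompactSupport φ)
    (hs : tsupport φ ⊆ Ω) : IsH10 Ω φ (fun x => ∇ φ x) := by
  refine ⟨(hφ.continuous.memLp_of_hasCompactSupport hc).restrict _,
    ((continuous_gradient hφ).memLp_of_hasCompactSupport (hasCompactSupport_gradient hc)).restrict _,
    fun _ => φ, fun _ => ⟨hφ, hc, hs⟩, ?_, ?_⟩ <;> simp

/-- A weak solution tested with the Laplacian of a test function. -/
theorem IsWeakSolution.integral_mul_lap_eq {g w φ : E d → ℝ} (hw : IsWeakSolution Ω g w)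
    (hφ : ContDiff ℝ ∞ φ) (hc : HasCompactSupport φ) (hs : tsupport φ ⊆ Ω) :
    ∫ x in Ω, w x * lap φ x = -∫ x in Ω, g x * φ x := by
  obtain ⟨G, ⟨hw2, hG2, ψ, hψ, hψw, hψG⟩, heq⟩ := hw
  rw [← heq φ _ (isH10_test hφ hc hs)]
  have hgφ : MemLp (fun x => ∇ φ x) 2 (volume.restrict Ω) :=
    ((continuous_gradient hφ).memLp_of_hasCompactSupport (hasCompactSupport_gradient hc)).restrict _
  have hlφ : MemLp (lap φ) 2 (volume.restrict Ω) :=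
    ((contDiff_lap hφ).continuous.memLp_of_hasCompactSupport (hasCompactSupport_lap hc)).restrict _
  have h1 := tendsto_integral_inner_of_tendsto_eLpNorm (fun n =>
    ((continuous_gradient (hψ n).1).memLp_of_hasCompactSupport
      (hasCompactSupport_gradient (hψ n).2.1)).restrict Ω) hG2 hgφ hψG
  have h2 := tendsto_integral_inner_of_tendsto_eLpNorm (fun n =>
    ((hψ n).1.continuous.memLp_of_hasCompactSupport (hψ n).2.1).restrict Ω) hw2 hlφ hψw
  -- Classical integration by parts is available for the smooth approximations `ψ n`; the claim
  -- follows from uniqueness of the limits of the two sides.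
  have h3 : ∀ n, ∫ x in Ω, ⟪ψ n x, lap φ x⟫ = -∫ x in Ω, ⟪∇ (ψ n) x, ∇ φ x⟫ := by
    intro n
    rw [setIntegral_eq_integral_of_forall_compl_eq_zero,
      setIntegral_eq_integral_of_forall_compl_eq_zero,
      ← integral_test_mul_lap (hψ n).1 (hψ n).2.1 hφ hc]
    · simp only [RCLike.inner_apply, conj_trivial, mul_comm]
    · intro x hx
      rw [gradient_eq_zero_of_notMem_tsupport (φ := φ) fun h => hx (hs h), inner_zero_right]
    · intro x hx
      rw [lap_eq_zero_of_notMem_tsupport fun h => hx (hs h), inner_zero_right]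
  simp only [h3] at h2
  have h4 := tendsto_nhds_unique h2 h1.neg
  simpa only [RCLike.inner_apply, conj_trivial, mul_comm] using h4

/-! ### Elementary estimates for the `L²`-norm -/

theorem normL2_nonneg (A : Set (E d)) (w : E d → ℝ) : 0 ≤ normL2 A w := ENNReal.toReal_nonneg

theorem normL2_mono_set {A B : Set (E d)} {w : E d → ℝ} (hAB : A ⊆ B) (hw : IsL2 B w) :
    normL2 A w ≤ normL2 B w :=
  ENNReal.toReal_mono hw.2.ne (eLpNorm_mono_measure _ (Measure.restrict_mono hAB le_rfl))

theorem IsL2.mono_set {A B : Set (E d)} {w : E d → ℝ} (hAB : A ⊆ B) (hw : IsL2 B w) : IsL2 A w :=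
  hw.mono_measure (Measure.restrict_mono hAB le_rfl)

theorem normL2_add_le {A : Set (E d)} {v w : E d → ℝ} (hv : IsL2 A v) (hw : IsL2 A w) :
    normL2 A (fun x => v x + w x) ≤ normL2 A v + normL2 A w := by
  have h := eLpNorm_add_le (μ := volume.restrict A) hv.1 hw.1 (p := 2) (by norm_num)
  rw [normL2, normL2, normL2, ← ENNReal.toReal_add hv.2.ne hw.2.ne]
  exact ENNReal.toReal_mono (ENNReal.add_ne_top.2 ⟨hv.2.ne, hw.2.ne⟩) h

theorem normL2_neg (A : Set (E d)) (w : E d → ℝ) : normL2 A (fun x => -w x) = normL2 A w := by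
  rw [normL2, normL2]
  exact congrArg _ (eLpNorm_neg w 2 _)

theorem normL2_congr_ae {A : Set (E d)} {v w : E d → ℝ}
    (h : v =ᵐ[volume.restrict A] w) : normL2 A v = normL2 A w := by
  rw [normL2, normL2, eLpNorm_congr_ae h]

theorem normL2_le_of_ae_abs_le {A : Set (E d)} {v w : E d → ℝ} (hw : IsL2 A w)
    (h : ∀ᵐ x ∂(volume.restrict A), |v x| ≤ w x) : normL2 A v ≤ normL2 A w :=
  ENNReal.toReal_mono hw.2.ne (eLpNorm_mono_ae (h.mono fun x hx => by
    simpa using hx.trans (le_abs_self _)))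

/-- The sets may overlap: the measure on the union is at most the sum of the two restrictions, and
the square root is subadditive. -/
theorem normL2_union_le {A B : Set (E d)} {w : E d → ℝ} (hA : IsL2 A w) (hB : IsL2 B w) :
    normL2 (A ∪ B) w ≤ normL2 A w + normL2 B w := by
  rw [normL2, normL2, normL2, ← ENNReal.toReal_add hA.2.ne hB.2.ne]
  refine ENNReal.toReal_mono (ENNReal.add_ne_top.2 ⟨hA.2.ne, hB.2.ne⟩) ?_
  refine (eLpNorm_mono_measure w (Measure.restrict_union_le A B)).trans ?_
  rw [eLpNorm_eq_lintegral_rpow_enorm_toReal (by norm_num) (by norm_num),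
    eLpNorm_eq_lintegral_rpow_enorm_toReal (by norm_num) (by norm_num),
    eLpNorm_eq_lintegral_rpow_enorm_toReal (by norm_num) (by norm_num), lintegral_add_measure]
  exact ENNReal.rpow_add_le_add_rpow _ _ (by norm_num) (by norm_num)

/-- The Cauchy–Schwarz inequality against a bounded function. -/
theorem abs_integral_mul_le {A : Set (E d)} {w φ : E d → ℝ} {M : ℝ} (hA : volume A ≠ ⊤)
    (hw : IsL2 A w) (hM : 0 ≤ M) (hφ : ∀ x, |φ x| ≤ M) :
    |∫ x in A, w x * φ x| ≤ M * √(volume A).toReal * normL2 A w := by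
  have hfin : IsFiniteMeasure (volume.restrict A) := ⟨by simpa using hA.lt_top⟩
  have h1 : ‖∫ x in A, w x * φ x‖ ≤ ∫ x in A, M * |w x| := by
    refine norm_integral_le_of_norm_le ((hw.integrable (by norm_num)).abs.const_mul M)
      (Eventually.of_forall fun x => ?_)
    rw [Real.norm_eq_abs, abs_mul, mul_comm]
    exact mul_le_mul_of_nonneg_right (hφ x) (abs_nonneg _)
  have h2 : ∫ x in A, |w x| ≤ √(volume A).toReal * normL2 A w := by
    have h := eLpNorm_le_eLpNorm_mul_rpow_measure_univ (p := 1) (q := 2) (by norm_num) hw.1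
    have h3 : ∫ x in A, |w x| = (eLpNorm w 1 (volume.restrict A)).toReal := by
      rw [eLpNorm_one_eq_lintegral_enorm]
      exact integral_norm_eq_lintegral_enorm hw.1
    rw [h3, mul_comm]
    have h4 := ENNReal.toReal_mono (ENNReal.mul_ne_top hw.2.ne
      (ENNReal.rpow_ne_top_of_nonneg (by norm_num) (by simpa using hA))) h
    rw [ENNReal.toReal_mul, ← ENNReal.toReal_rpow, Measure.restrict_apply_univ] at h4
    convert h4 using 1
    rw [Real.sqrt_eq_rpow, mul_comm]
    norm_num [normL2, mul_comm]
  rw [Real.norm_eq_abs, integral_const_mul] at h1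
  calc _ ≤ _ := h1
    _ ≤ M * (√(volume A).toReal * normL2 A w) := mul_le_mul_of_nonneg_left h2 hM
    _ = _ := by ring

/-- The volume of the unit ball. -/
def unitVol (d : ℕ) : ℝ := (volume (Metric.ball (0 : E d) 1)).toReal

theorem unitVol_nonneg : 0 ≤ unitVol d := ENNReal.toReal_nonneg

theorem volume_closedBall_toReal (x : E d) {r : ℝ} (hr : 0 ≤ r) :
    (volume (Metric.closedBall x r)).toReal = r ^ d * unitVol d := by
  rw [Measure.addHaar_closedBall _ _ hr, ENNReal.toReal_mul, unitVol,
    ENNReal.toReal_ofReal (by positivity)]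
  simp

theorem setIntegral_mul_eq_of_tsupport {A B : Set (E d)} {w φ : E d → ℝ} (hA : MeasurableSet A)
    (hBA : B ⊆ A) (h : ∀ x ∉ B, φ x = 0) : ∫ x in A, w x * φ x = ∫ x in B, w x * φ x :=
  setIntegral_eq_of_subset_of_forall_sdiff_eq_zero hA hBA fun x hx => by rw [h x hx.2, mul_zero]

/-- The residual of an approximation `(gT, wT)` of a weak solution `(g, w)`, tested with a scaled
bump function on a ball. -/
theorem exists_residual_bound (d : ℕ) : ∃ M : ℝ, 0 < M ∧ ∀ (Ω : Set (E d)), IsOpen Ω →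
    ∀ (g w gT wT : E d → ℝ) (x₀ : E d) (r : ℝ), 0 < r → Metric.closedBall x₀ r ⊆ Ω →
    IsWeakSolution Ω g w → IsL2 Ω g → IsL2 Ω w → IsL2 (Metric.closedBall x₀ r) gT →
    IsL2 (Metric.closedBall x₀ r) wT → ∀ (c : ℝ) (m : E d),
    |(∫ x in Metric.closedBall x₀ r, gT x * scaled (bumpAff c m) x₀ r x) +
      ∫ x in Metric.closedBall x₀ r, wT x * lap (scaled (bumpAff c m) x₀ r) x| ≤
    M * (|c| + ‖m‖) * √(r ^ d) * ((r ^ 2)⁻¹ * normL2 (Metric.closedBall x₀ r) (fun x => w x - wT x) +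
      normL2 (Metric.closedBall x₀ r) (fun x => g x - gT x)) := by
  obtain ⟨M, hM, hb⟩ := exists_bumpAff_bound d
  -- The summand `1` serves only to make the constant positive.
  refine ⟨M * √(unitVol d) + 1, by positivity, ?_⟩
  intro Ω hΩ g w gT wT x₀ r hr hBΩ hweak hg hw hgT hwT c m
  set B := Metric.closedBall x₀ r with hB
  set φ := scaled (bumpAff c m) x₀ r with hφ
  set N := |c| + ‖m‖ with hN
  have hN0 : 0 ≤ N := by positivity
  have hsm : ContDiff ℝ ∞ φ := contDiff_scaled (contDiff_bumpAff c m) _ _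
  have hts : tsupport φ ⊆ B := tsupport_scaled_subset (tsupport_bumpAff_subset c m) x₀ hr
  have hcs : HasCompactSupport φ :=
    (isCompact_closedBall x₀ r).of_isClosed_subset (isClosed_tsupport _) hts
  have hφ0 : ∀ x ∉ B, φ x = 0 := fun x hx =>
    image_eq_zero_of_notMem_tsupport fun h => hx (hts h)
  have hl0 : ∀ x ∉ B, lap φ x = 0 := fun x hx =>
    lap_eq_zero_of_notMem_tsupport fun h => hx (hts h)
  have hφb : ∀ x, |φ x| ≤ M * N := fun x => (hb c m _).1
  have hlb : ∀ x, |lap φ x| ≤ (r ^ 2)⁻¹ * (M * N) := by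
    intro x
    rw [hφ, lap_scaled (contDiff_bumpAff c m), abs_mul, abs_of_pos (by positivity)]
    exact mul_le_mul_of_nonneg_left (hb c m _).2 (by positivity)
  have hvol : volume B ≠ ⊤ := measure_closedBall_lt_top.ne
  have hvolB : √(volume B).toReal = √(r ^ d) * √(unitVol d) := by
    rw [volume_closedBall_toReal _ hr.le, Real.sqrt_mul (by positivity)]
  have hfin : IsFiniteMeasure (volume.restrict B) := ⟨by simpa using hvol.lt_top⟩
  have hgB : IsL2 B g := hg.mono_set hBΩ
  have hwB : IsL2 B w := hw.mono_set hBΩ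
  have hint : ∀ (v ψ : E d → ℝ), IsL2 B v → ContDiff ℝ ∞ ψ → HasCompactSupport ψ →
      Integrable (fun x => v x * ψ x) (volume.restrict B) := fun v ψ hv hψ hψc =>
    MemLp.integrable_mul (p := 2) (q := 2) hv
      ((hψ.continuous.memLp_of_hasCompactSupport hψc).restrict B)
  have heq := hweak.integral_mul_lap_eq hsm hcs (hts.trans hBΩ)
  rw [setIntegral_mul_eq_of_tsupport hΩ.measurableSet hBΩ hl0,
    setIntegral_mul_eq_of_tsupport hΩ.measurableSet hBΩ hφ0] at heq
  have hlsm := contDiff_lap hsm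
  have hlcs := hasCompactSupport_lap hcs
  have h1 : ∫ x in B, (g x - gT x) * φ x = (∫ x in B, g x * φ x) - ∫ x in B, gT x * φ x := by
    rw [← integral_sub (hint _ _ hgB hsm hcs) (hint _ _ hgT hsm hcs)]
    simp only [sub_mul]
  have h2 : ∫ x in B, (w x - wT x) * lap φ x =
      (∫ x in B, w x * lap φ x) - ∫ x in B, wT x * lap φ x := by
    rw [← integral_sub (hint _ _ hwB hlsm hlcs) (hint _ _ hwT hlsm hlcs)]
    simp only [sub_mul]
  have h3 := abs_integral_mul_le hvol (hgB.sub hgT) (by positivity) hφb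
  have h4 := abs_integral_mul_le hvol (hwB.sub hwT) (by positivity) hlb
  rw [hvolB] at h3 h4
  simp only [Pi.sub_apply] at h3 h4
  -- The weak equation for `(g, w)` turns the residual of the approximation into an expression in
  -- the errors, each of which is then bounded by Cauchy–Schwarz.
  have h5 : (∫ x in B, gT x * φ x) + ∫ x in B, wT x * lap φ x =
      -((∫ x in B, (g x - gT x) * φ x) + ∫ x in B, (w x - wT x) * lap φ x) := by
    rw [h1, h2, heq]; ring
  rw [h5, abs_neg]
  have h6 : normL2 B (g - gT) = normL2 B fun x => g x - gT x := rfl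
  have h7 : normL2 B (w - wT) = normL2 B fun x => w x - wT x := rfl
  rw [h6] at h3
  rw [h7] at h4
  refine (abs_add_le _ _).trans ((add_le_add h3 h4).trans ?_)
  have hX : 0 ≤ N * √(r ^ d) * ((r ^ 2)⁻¹ * normL2 B (fun x => w x - wT x) +
      normL2 B (fun x => g x - gT x)) := by
    have := normL2_nonneg B fun x => w x - wT x
    have := normL2_nonneg B fun x => g x - gT x
    positivity
  linarith

section Simplices

/-! ### Domains with Lipschitz boundary -/

/-- A boundary point lies on or below the graph. Moving it slightly along `-n` puts it strictly
below, where a whole neighbourhood misses Ω; so points arbitrarily near the boundary point are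
outside the closure, and slits are excluded. -/
theorem HasLipschitzBoundary.interior_closure_subset (hΩ : IsOpen Ω)
    (hL : HasLipschitzBoundary Ω) : interior (closure Ω) ⊆ Ω := by
  intro x hx
  by_contra hxΩ
  have hxf : x ∈ frontier Ω := ⟨interior_subset hx, by rwa [hΩ.interior_eq]⟩
  obtain ⟨n, r, L, g, hn, hr, hg, hiff⟩ := hL x hxf
  have hgx : ⟪n, x⟫ ≤ g (x - ⟪n, x⟫ • n) := by
    by_contra h
    exact hxΩ ((hiff x (Metric.mem_ball_self hr)).2 (not_le.1 h))
  obtain ⟨ε, hε, hball⟩ := Metric.isOpen_iff.1 isOpen_interior x hx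
  set δ := min ε r / 2 with hδ
  have hδ0 : 0 < δ := by positivity
  set z := x - δ • n with hz
  have hzn : ‖z - x‖ = δ := by
    rw [hz, sub_sub_cancel_left, norm_neg, norm_smul, hn, mul_one, Real.norm_of_nonneg hδ0.le]
  have hzε : z ∈ Metric.ball x ε := by
    rw [mem_ball_iff_norm, hzn]
    linarith [min_le_left ε r]
  have hzr : z ∈ Metric.ball x r := by
    rw [mem_ball_iff_norm, hzn]
    linarith [min_le_right ε r]
  have hnz : ⟪n, z⟫ = ⟪n, x⟫ - δ := by
    rw [hz, inner_sub_right, real_inner_smul_right, real_inner_self_eq_norm_sq, hn]; ring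
  have hzproj : z - ⟪n, z⟫ • n = x - ⟪n, x⟫ • n := by
    rw [hnz, hz, sub_smul]; abel
  have hlt : ⟪n, z⟫ < g (z - ⟪n, z⟫ • n) := by
    rw [hzproj, hnz]; linarith
  have hcont : Continuous fun y : E d => g (y - ⟪n, y⟫ • n) :=
    hg.continuous.comp (by fun_prop)
  have hU : IsOpen ({y : E d | ⟪n, y⟫ < g (y - ⟪n, y⟫ • n)} ∩ Metric.ball x r) :=
    (isOpen_lt (by fun_prop) hcont).inter Metric.isOpen_ball
  obtain ⟨y, ⟨hy1, hy2⟩, hyΩ⟩ := mem_closure_iff.1 (interior_subset (hball hzε)) _ hU ⟨hlt, hzr⟩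
  exact lt_asymm ((hiff y hy2).1 hyΩ) hy1

theorem IsL2.of_ae_subset {A : Set (E d)} {w : E d → ℝ} (hA : volume (A \ Ω) = 0)
    (hw : IsL2 Ω w) : IsL2 A w :=
  hw.mono_measure (Measure.restrict_mono_ae (ae_le_set.2 hA))

/-! ### Geometry of simplices -/

theorem isCompact_hull (K : Finset (E d)) : IsCompact (hull K) :=
  K.finite_toSet.isCompact_convexHull ℝ

theorem convex_hull (K : Finset (E d)) : Convex ℝ (hull K) := convex_convexHull _ _

theorem mem_hull {K : Finset (E d)} {v : E d} (hv : v ∈ K) : v ∈ hull K :=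
  subset_convexHull ℝ _ hv

theorem hull_mono {γ K : Finset (E d)} (h : γ ⊆ K) : hull γ ⊆ hull K :=
  convexHull_mono (by exact_mod_cast h)

theorem norm_sub_le_size {K : Finset (E d)} {x y : E d} (hx : x ∈ hull K) (hy : y ∈ hull K) :
    ‖x - y‖ ≤ size K := by
  rw [← dist_eq_norm]
  exact Metric.dist_le_diam_of_mem (isCompact_hull K).isBounded hx hy

variable (T : Mesh Ω)

theorem Mesh.mem_hull_iff {K : Finset (E d)} (hK : K ∈ T.cells) {x : E d} :
    x ∈ hull K ↔ ∀ v, 0 ≤ (T.basis K hK).coord v x := by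
  have h := (T.basis K hK).convexHull_eq_nonneg_coord
  have hr : Set.range (T.basis K hK) = (K : Set (E d)) := by
    ext x
    constructor
    · rintro ⟨v, rfl⟩; exact v.2
    · intro hx; exact ⟨⟨x, hx⟩, rfl⟩
  rw [hr] at h
  rw [hull, h]
  rfl

theorem Mesh.coord_nonneg {K : Finset (E d)} (hK : K ∈ T.cells) {x : E d} (hx : x ∈ hull K)
    (v : K) : 0 ≤ (T.basis K hK).coord v x :=
  (T.mem_hull_iff hK).1 hx v

theorem Mesh.coord_le_one {K : Finset (E d)} (hK : K ∈ T.cells) {x : E d} (hx : x ∈ hull K)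
    (v : K) : (T.basis K hK).coord v x ≤ 1 := by
  rw [← (T.basis K hK).sum_coord_apply_eq_one x]
  exact Finset.single_le_sum (f := fun v => (T.basis K hK).coord v x)
    (fun w _ => T.coord_nonneg hK hx w) (Finset.mem_univ v)

theorem affineMap_sub_eq (A : E d →ᵃ[ℝ] ℝ) (x y : E d) : A x - A y = A.linear (x - y) := by
  simpa using (A.linearMap_vsub x y).symm

/-- The barycentric coordinates of a simplex that contains a ball are Lipschitz continuous. -/
theorem Mesh.abs_coord_sub_le {K : Finset (E d)} (hK : K ∈ T.cells) {x₀ : E d} {r : ℝ} (hr : 0 < r)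
    (hB : Metric.closedBall x₀ r ⊆ hull K) (v : K) (x y : E d) :
    |(T.basis K hK).coord v x - (T.basis K hK).coord v y| ≤ ‖x - y‖ / r := by
  rcases eq_or_ne x y with rfl | hxy
  · simp
  set A := (T.basis K hK).coord v with hA
  have hn : 0 < ‖x - y‖ := norm_pos_iff.2 (sub_ne_zero.2 hxy)
  -- A step of length `r` from the centre, parallel to `x - y`, stays in the simplex, where a
  -- barycentric coordinate varies by at most `1`; linearity rescales this to `x - y`.
  set z := x₀ + (r / ‖x - y‖) • (x - y) with hz
  have hzB : z ∈ hull K := hB (by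
    rw [mem_closedBall_iff_norm, hz, add_sub_cancel_left, norm_smul,
      Real.norm_of_nonneg (by positivity), div_mul_cancel₀ _ hn.ne'])
  have hx₀ : x₀ ∈ hull K := hB (Metric.mem_closedBall_self hr.le)
  have h1 : A z - A x₀ = r / ‖x - y‖ * (A x - A y) := by
    rw [affineMap_sub_eq, affineMap_sub_eq, hz, add_sub_cancel_left, map_smul, smul_eq_mul]
  have h2 : |A z - A x₀| ≤ 1 := by
    rw [abs_le]
    constructor <;> linarith [T.coord_nonneg hK hzB v, T.coord_nonneg hK hx₀ v,
      T.coord_le_one hK hzB v, T.coord_le_one hK hx₀ v]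
  rw [h1, abs_mul, abs_of_pos (by positivity)] at h2
  rw [le_div_iff₀ hr]
  calc |A x - A y| * r = r / ‖x - y‖ * |A x - A y| * ‖x - y‖ := by field_simp
    _ ≤ 1 * ‖x - y‖ := by gcongr
    _ = ‖x - y‖ := one_mul _

/-- The barycentric coordinate of `v` drops from `1` at `v` to `0` at `w`, and its Lipschitz
constant is at most `1 / r`. -/
theorem Mesh.le_norm_sub {K : Finset (E d)} (hK : K ∈ T.cells) {x₀ : E d} {r : ℝ} (hr : 0 < r)
    (hB : Metric.closedBall x₀ r ⊆ hull K) {v w : E d} (hv : v ∈ K) (hw : w ∈ K) (hvw : v ≠ w) :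
    r ≤ ‖v - w‖ := by
  have h := T.abs_coord_sub_le hK hr hB ⟨v, hv⟩ v w
  have h1 : (T.basis K hK).coord ⟨v, hv⟩ v = 1 := (T.basis K hK).coord_apply_eq ⟨v, hv⟩
  have h2 : (T.basis K hK).coord ⟨v, hv⟩ w = 0 :=
    (T.basis K hK).coord_apply_ne (i := ⟨v, hv⟩) (j := ⟨w, hw⟩) (by simpa using hvw)
  rw [h1, h2, sub_zero, abs_one, le_div_iff₀ hr, one_mul] at h
  exact h

theorem Mesh.hull_subset_closure {K : Finset (E d)} (hK : K ∈ T.cells) : hull K ⊆ closure Ω := by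
  rw [← T.cover]
  exact Set.subset_biUnion_of_mem (u := fun K => hull K) hK

theorem Mesh.hull_subset_patch {K K' : Finset (E d)} (hK : K' ∈ T.patchCells K) :
    hull K' ⊆ T.patch K :=
  Set.subset_biUnion_of_mem (u := fun K => hull K) hK

theorem Mesh.mem_patchCells_self {K : Finset (E d)} (hK : K ∈ T.cells) : K ∈ T.patchCells K := by
  classical
  simp [patchCells, hK]

theorem Mesh.mem_cells_of_mem_patchCells {K K' : Finset (E d)} (hK : K' ∈ T.patchCells K) :
    K' ∈ T.cells := by
  classical
  exact (Finset.mem_filter.1 hK).1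

/-- The interior of a cell lies in Ω, and the frontier of a convex set is null. Norms over closed
cells thus make sense for functions given on Ω. -/
theorem Mesh.volume_hull_sdiff (hsub : interior (closure Ω) ⊆ Ω) {K : Finset (E d)}
    (hK : K ∈ T.cells) : volume (hull K \ Ω) = 0 := by
  refine measure_mono_null (fun x hx => ?_) ((convex_hull K).addHaar_frontier volume)
  exact ⟨subset_closure hx.1, fun h =>
    hx.2 (hsub (interior_mono (T.hull_subset_closure hK) h))⟩

theorem Mesh.volume_patch_sdiff (hsub : interior (closure Ω) ⊆ Ω) (K : Finset (E d)) :
    volume (T.patch K \ Ω) = 0 := by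
  rw [patch]
  simp only [Set.iUnion_sdiff]
  refine (measure_biUnion_null_iff (Finset.countable_toSet _)).2 fun K' hK' => ?_
  exact T.volume_hull_sdiff hsub (T.mem_cells_of_mem_patchCells hK')

theorem Mesh.interior_hull_nonempty {K : Finset (E d)} {x₀ : E d} {r : ℝ} (hr : 0 < r)
    (hB : Metric.closedBall x₀ r ⊆ hull K) : (interior (hull K)).Nonempty :=
  ⟨x₀, interior_mono hB (Metric.ball_subset_interior_closedBall (Metric.mem_ball_self hr))⟩

/-! ### Piecewise affine functions -/

/-- Derivatives within a convex set with nonempty interior are unique also at its boundary points,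
so the gradient has the expected value on the sides, where jumps are evaluated. -/
theorem cellGrad_eq {K : Finset (E d)} (hne : (interior (hull K)).Nonempty) {w : E d → ℝ} {c : ℝ}
    {m : E d} (hw : ∀ x ∈ hull K, w x = c + ⟪m, x⟫) {x : E d} (hx : x ∈ hull K) :
    cellGrad w K x = m := by
  have h1 : HasFDerivAt (fun x : E d => c + ⟪m, x⟫) (innerSL ℝ m) x :=
    ((innerSL ℝ m).hasFDerivAt).const_add c
  have h2 : HasFDerivWithinAt w (innerSL ℝ m) (hull K) x :=
    h1.hasFDerivWithinAt.congr hw (hw x hx)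
  rw [cellGrad, gradientWithin, h2.fderivWithin (uniqueDiffOn_convex (convex_hull K) hne x hx)]
  ext i
  exact congrArg (fun z : E d => z i) ((InnerProductSpace.toDual ℝ (E d)).symm_apply_apply m)

theorem Mesh.exists_affine {w : E d → ℝ} (hw : w ∈ T.U1) {K : Finset (E d)} (hK : K ∈ T.cells) :
    ∃ (c : ℝ) (m : E d), ∀ x ∈ hull K, w x = c + ⟪m, x⟫ := by
  obtain ⟨q, ⟨c, m, -, hq⟩, hwq⟩ := hw.2 K hK
  exact ⟨c, m, fun x hx => (hwq hx).trans (hq x)⟩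

theorem isL2_of_continuousOn_isCompact {A : Set (E d)} (hA : IsCompact A) {w : E d → ℝ}
    (hw : ContinuousOn w A) : IsL2 A w := by
  have hfin : IsFiniteMeasure (volume.restrict A) := ⟨by simpa using hA.measure_lt_top⟩
  obtain ⟨C, hC⟩ := hA.exists_bound_of_continuousOn hw
  exact MemLp.of_bound (hw.aestronglyMeasurable hA.measurableSet) C
    (ae_restrict_of_forall_mem hA.measurableSet hC)

theorem Mesh.isL2_closure (hb : Bornology.IsBounded Ω) {w : E d → ℝ} (hw : w ∈ T.U1) :
    IsL2 (closure Ω) w :=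
  isL2_of_continuousOn_isCompact hb.isCompact_closure hw.1

/-! ### Internal sides -/

section Face

variable {T} {K γ : Finset (E d)}

theorem Mesh.exists_apex (hK : K ∈ T.cells) (hγ : γ ⊆ K) (hc : γ.card = d) :
    ∃ v ∈ K, v ∉ γ ∧ ∀ z ∈ K, z ∉ γ → z = v := by
  classical
  have hcard : (K \ γ).card = 1 := by
    rw [Finset.card_sdiff_of_subset hγ, T.card_cell K hK, hc]; omega
  obtain ⟨v, hv⟩ := Finset.card_eq_one.1 hcard
  have hvm : v ∈ K \ γ := by rw [hv]; simp
  refine ⟨v, (Finset.mem_sdiff.1 hvm).1, (Finset.mem_sdiff.1 hvm).2, fun z hz hzγ => ?_⟩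
  have : z ∈ K \ γ := Finset.mem_sdiff.2 ⟨hz, hzγ⟩
  rwa [hv, Finset.mem_singleton] at this

/-- An affine function is determined by its values at the vertices of a cell. -/
theorem Mesh.affineMap_ext (hK : K ∈ T.cells) {A B : E d →ᵃ[ℝ] ℝ} (h : ∀ z ∈ K, A z = B z) :
    A = B :=
  AffineMap.ext_on (T.basis K hK).tot (by
    rintro _ ⟨v, rfl⟩
    exact h v v.2)

/-- The affine function `x ↦ ⟪m, x - x₀⟫`. -/
def innerAffine (m x₀ : E d) : E d →ᵃ[ℝ] ℝ where
  toFun x := ⟪m, x - x₀⟫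
  linear := (innerSL ℝ m).toLinearMap
  map_vadd' p v := by
    simp [add_sub_assoc, inner_add_right]

theorem innerAffine_apply (m x₀ x : E d) : innerAffine m x₀ x = ⟪m, x - x₀⟫ := rfl

/-- On a cell, the affine functions that vanish on a face are multiples of one another. -/
theorem Mesh.inner_eq_coord (hK : K ∈ T.cells) {m x₀ v : E d}
    (hm : ∀ x ∈ γ, ⟪m, x - x₀⟫ = 0) (hv : v ∈ K) (hvu : ∀ z ∈ K, z ∉ γ → z = v)
    (hvγ : v ∉ γ) (x : E d) :
    ⟪m, x - x₀⟫ = ⟪m, v - x₀⟫ * (T.basis K hK).coord ⟨v, hv⟩ x := by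
  have h : innerAffine m x₀ = (⟪m, v - x₀⟫ : ℝ) • (T.basis K hK).coord ⟨v, hv⟩ := by
    refine T.affineMap_ext hK fun z hz => ?_
    by_cases hzγ : z ∈ γ
    · have h2 : (T.basis K hK).coord ⟨v, hv⟩ z = 0 :=
        (T.basis K hK).coord_apply_ne (i := ⟨v, hv⟩) (j := ⟨z, hz⟩) (by
          intro h
          obtain rfl : v = z := congrArg Subtype.val h
          exact hvγ hzγ)
      simp [innerAffine_apply, hm z hzγ, h2]
    · obtain rfl := hvu z hz hzγ
      have h1 : (T.basis K hK).coord ⟨z, hv⟩ z = 1 := (T.basis K hK).coord_apply_eq ⟨z, hv⟩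
      simp [innerAffine_apply, h1]
  have := congrArg (fun A : E d →ᵃ[ℝ] ℝ => A x) h
  simpa [innerAffine_apply] using this

/-- A vector that is orthogonal to a face is a multiple of the unit normal. -/
theorem Mesh.eq_inner_smul_normal (hK : K ∈ T.cells) (hγ : γ ⊆ K) (hc : γ.card = d) (hd : 0 < d)
    {m : E d} (hm : ∀ x ∈ γ, ∀ z ∈ γ, ⟪m, z - x⟫ = 0) :
    m = ⟪outerNormal K γ, m⟫ • outerNormal K γ := by
  obtain ⟨hν1, hν2, hν3⟩ := outerNormal_spec T hK hγ hc hd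
  set ν := outerNormal K γ
  obtain ⟨v, hv, hvγ, hvu⟩ := Mesh.exists_apex hK hγ hc
  obtain ⟨x₀, hx₀⟩ : γ.Nonempty := by rw [← Finset.card_pos]; omega
  have hνv := hν3 x₀ hx₀ v hv hvγ
  set κ := ⟪m, v - x₀⟫ / ⟪ν, v - x₀⟫ with hκ
  have hmκ : m = κ • ν := by
    rw [← sub_eq_zero, ← inner_self_eq_zero (𝕜 := ℝ)]
    have h : ∀ x, ⟪m, x - x₀⟫ = κ * ⟪ν, x - x₀⟫ := by
      intro x
      rw [Mesh.inner_eq_coord hK (fun z hz => hm x₀ hx₀ z hz) hv hvu hvγ x,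
        Mesh.inner_eq_coord hK (fun z hz => hν2 x₀ hx₀ z hz) hv hvu hvγ x, hκ]
      have := hνv.ne
      field_simp
    -- Evaluating at the displacement `m - κ • ν` shows that this vector is orthogonal to itself.
    have h1 := h (x₀ + (m - κ • ν))
    rw [add_sub_cancel_left] at h1
    rw [inner_sub_left, real_inner_smul_left, h1, sub_self]
  have : ⟪ν, m⟫ = κ := by
    rw [hmκ, real_inner_smul_right, real_inner_self_eq_norm_sq, hν1]; ring
  rwa [this]

/-- The barycentre of a face. -/
def barycentre (γ : Finset (E d)) : E d := (d : ℝ)⁻¹ • ∑ z ∈ γ, z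

theorem affineMap_barycentre (A : E d →ᵃ[ℝ] ℝ) (hc : γ.card = d) (hd : 0 < d) :
    A (barycentre γ) = (d : ℝ)⁻¹ * ∑ z ∈ γ, A z := by
  have hA : ∀ x, A x = A.linear x + A 0 := fun x => by
    have := affineMap_sub_eq A x 0
    rw [sub_zero] at this
    linarith
  have hd' : (d : ℝ) ≠ 0 := by positivity
  rw [hA, barycentre, map_smul, map_sum, smul_eq_mul]
  rw [Finset.sum_congr rfl fun z _ => hA z, Finset.sum_add_distrib]
  rw [Finset.sum_const, hc, nsmul_eq_mul, mul_add, ← mul_assoc, inv_mul_cancel₀ hd', one_mul]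

theorem inner_barycentre_sub {m x : E d} (hc : γ.card = d) (hd : 0 < d)
    (hm : ∀ z ∈ γ, ⟪m, z - x⟫ = 0) : ⟪m, barycentre γ - x⟫ = 0 := by
  have := affineMap_barycentre (innerAffine m x) hc hd
  rw [innerAffine_apply] at this
  rw [this, Finset.sum_eq_zero fun z hz => ?_, mul_zero]
  exact hm z hz

/-- Around the barycentre of a face, the cell fills the half ball behind the face. -/
theorem Mesh.mem_hull_of_norm_sub_barycentre_le (hK : K ∈ T.cells) (hγ : γ ⊆ K) (hc : γ.card = d)
    (hd : 0 < d) {x₀ : E d} {r : ℝ} (hr : 0 < r) (hB : Metric.closedBall x₀ r ⊆ hull K) {x : E d}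
    (hx : ‖x - barycentre γ‖ ≤ r / d) (hxν : ⟪outerNormal K γ, x - barycentre γ⟫ ≤ 0) :
    x ∈ hull K := by
  obtain ⟨hν1, hν2, hν3⟩ := outerNormal_spec T hK hγ hc hd
  set ν := outerNormal K γ
  obtain ⟨v, hv, hvγ, hvu⟩ := Mesh.exists_apex hK hγ hc
  obtain ⟨p, hp⟩ : γ.Nonempty := by rw [← Finset.card_pos]; omega
  rw [T.mem_hull_iff hK]
  rintro ⟨w, hw⟩
  -- The coordinate of a vertex of the face is `1/d` at the barycentre and changes by at most `1/d`
  -- within distance `r/d`. The coordinate of the apex is a negative multiple of the height along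
  -- the outer normal.
  by_cases hwγ : w ∈ γ
  · have h1 : (T.basis K hK).coord ⟨w, hw⟩ (barycentre γ) = (d : ℝ)⁻¹ := by
      rw [affineMap_barycentre _ hc hd, Finset.sum_eq_single_of_mem w hwγ]
      · rw [show (T.basis K hK).coord ⟨w, hw⟩ w = 1 from
          (T.basis K hK).coord_apply_eq ⟨w, hw⟩, mul_one]
      · intro z hz hzw
        exact (T.basis K hK).coord_apply_ne (i := ⟨w, hw⟩) (j := ⟨z, hγ hz⟩)
          (by simpa using hzw.symm)
    have h2 := T.abs_coord_sub_le hK hr hB ⟨w, hw⟩ x (barycentre γ)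
    have h3 : ‖x - barycentre γ‖ / r ≤ (d : ℝ)⁻¹ := by
      rw [div_le_iff₀ hr]
      calc _ ≤ _ := hx
        _ = _ := by rw [div_eq_mul_inv, mul_comm]
    rw [h1] at h2
    linarith [(abs_le.1 (h2.trans h3)).1]
  · obtain rfl := hvu w hw hwγ
    have h1 := Mesh.inner_eq_coord hK (fun z hz => hν2 p hp z hz) hv hvu hvγ x
    have h2 : ⟪ν, x - p⟫ = ⟪ν, x - barycentre γ⟫ := by
      rw [← sub_add_sub_cancel x (barycentre γ) p, inner_add_right,
        inner_barycentre_sub hc hd (fun z hz => hν2 p hp z hz), add_zero]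
    have h3 := hν3 p hp w hv hvγ
    by_contra hneg
    have h4 := mul_pos_of_neg_of_neg h3 (not_le.1 hneg)
    linarith

theorem barycentre_mem_hull (hc : γ.card = d) (hd : 0 < d) : barycentre γ ∈ hull γ := by
  have hd' : (d : ℝ) ≠ 0 := by positivity
  rw [barycentre, Finset.smul_sum]
  refine (convex_hull γ).sum_mem (fun _ _ => by positivity) ?_ fun z hz => mem_hull hz
  rw [Finset.sum_const, hc, nsmul_eq_mul, mul_inv_cancel₀ hd']

/-- Two cells with a common side lie on different sides of it. -/
theorem Mesh.outerNormal_eq_neg {K' : Finset (E d)} (hK : K ∈ T.cells) (hK' : K' ∈ T.cells)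
    (hγ : γ ⊆ K) (hγ' : γ ⊆ K') (hc : γ.card = d) (hd : 0 < d) (hne : K ≠ K') {x₀ x₁ : E d}
    {r r' : ℝ} (hr : 0 < r) (hB : Metric.closedBall x₀ r ⊆ hull K) (hr' : 0 < r')
    (hB' : Metric.closedBall x₁ r' ⊆ hull K') : outerNormal K' γ = -outerNormal K γ := by
  classical
  obtain ⟨hν1, hν2, hν3⟩ := outerNormal_spec T hK hγ hc hd
  obtain ⟨hμ1, hμ2, hμ3⟩ := outerNormal_spec T hK' hγ' hc hd
  have hd' : (0 : ℝ) < d := by exact_mod_cast hd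
  obtain ⟨p, hp⟩ : γ.Nonempty := by rw [← Finset.card_pos]; omega
  have h1 := Mesh.eq_inner_smul_normal hK hγ hc hd hμ2
  set ν := outerNormal K γ with hν
  set μ := outerNormal K' γ with hμ
  set t : ℝ := ⟪ν, μ⟫
  have ht : |t| = 1 := by
    have := congrArg norm h1
    rwa [norm_smul, hμ1, hν1, mul_one, eq_comm] at this
  rcases (abs_eq zero_le_one).1 ht with h | h
  -- If the normals coincided, a point just behind the barycentre would belong to both cells, hence
  -- by conformity to the side; but the normal vanishes along the side.
  · exfalso
    rw [h, one_smul] at h1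
    set ε := min r r' / d with hε
    have hε0 : 0 < ε := by positivity
    set x := barycentre γ - ε • ν with hx
    have hxs : x - barycentre γ = -(ε • ν) := by rw [hx]; abel
    have hxn : ‖x - barycentre γ‖ = ε := by
      rw [hxs, norm_neg, norm_smul, hν1, mul_one, Real.norm_of_nonneg hε0.le]
    have hxν : ⟪ν, x - barycentre γ⟫ = -ε := by
      rw [hxs, inner_neg_right, real_inner_smul_right, real_inner_self_eq_norm_sq, hν1]; ring
    have hxK : x ∈ hull K := Mesh.mem_hull_of_norm_sub_barycentre_le hK hγ hc hd hr hB
      (by rw [hxn, hε]; gcongr; exact min_le_left _ _) (by rw [← hν, hxν]; linarith)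
    have hxK' : x ∈ hull K' := Mesh.mem_hull_of_norm_sub_barycentre_le hK' hγ' hc hd hr' hB'
      (by rw [hxn, hε]; gcongr; exact min_le_right _ _) (by rw [← hμ, h1, hxν]; linarith)
    -- Distinct sets of `d + 1` vertices share at most `d` of them.
    have hint : K ∩ K' = γ := by
      refine (Finset.eq_of_subset_of_card_le (Finset.subset_inter hγ hγ') ?_).symm
      rw [hc]
      by_contra hlt
      have hK1 : K ∩ K' = K := Finset.eq_of_subset_of_card_le Finset.inter_subset_left
        (by rw [T.card_cell K hK]; omega)
      have hK2 : K ∩ K' = K' := Finset.eq_of_subset_of_card_le Finset.inter_subset_right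
        (by rw [T.card_cell K' hK']; omega)
      exact hne (hK1.symm.trans hK2)
    have hmem : x ∈ hull γ := by
      have : x ∈ hull K ∩ hull K' := ⟨hxK, hxK'⟩
      rw [T.conforming K hK K' hK', ← Finset.coe_inter, hint] at this
      exact this
    have hsub : hull γ ⊆ innerAffine ν p ⁻¹' {0} := by
      refine convexHull_min (fun z hz => hν2 p hp z hz) ?_
      exact (convex_singleton (0 : ℝ)).affine_preimage _
    have hx0 : ⟪ν, x - p⟫ = 0 := hsub hmem
    have hb0 := inner_barycentre_sub hc hd (fun z hz => hν2 p hp z hz)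
    rw [← sub_add_sub_cancel x (barycentre γ) p, inner_add_right, hb0, hxν] at hx0
    linarith
  · rw [h1, h, neg_one_smul]

end Face

end Simplices

/-! ### The element residual -/

/-- Cauchy–Schwarz with the uniform bound for the weighted bump. It absorbs the data terms when a
residual is tested: the difference of data and polynomial in a cell, the data themselves at a side.
-/
theorem exists_abs_integral_mul_bumpAff_le (d : ℕ) : ∃ M : ℝ, 0 < M ∧
    ∀ (v : E d → ℝ) (x₀ : E d) (r : ℝ), 0 < r → IsL2 (Metric.closedBall x₀ r) v →
    ∀ (c : ℝ) (m : E d),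
    |∫ x in Metric.closedBall x₀ r, v x * scaled (bumpAff c m) x₀ r x| ≤
      M * (|c| + ‖m‖) * √(r ^ d) * normL2 (Metric.closedBall x₀ r) v := by
  obtain ⟨M, hM, hb⟩ := exists_bumpAff_bound d
  refine ⟨M * √(unitVol d) + 1, by positivity, fun v x₀ r hr hv c m => ?_⟩
  have h := abs_integral_mul_le measure_closedBall_lt_top.ne hv
    (M := M * (|c| + ‖m‖)) (by positivity) (φ := scaled (bumpAff c m) x₀ r) fun x => (hb c m _).1
  rw [volume_closedBall_toReal _ hr.le, Real.sqrt_mul (by positivity)] at h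
  refine h.trans ?_
  have := normL2_nonneg (Metric.closedBall x₀ r) v
  have : 0 ≤ (|c| + ‖m‖) * √(r ^ d) * normL2 (Metric.closedBall x₀ r) v := by positivity
  linarith

theorem normL2_le_of_forall_abs_le {A : Set (E d)} (hA : MeasurableSet A) (hvol : volume A ≠ ⊤)
    {v : E d → ℝ} {M : ℝ} (hM : 0 ≤ M) (h : ∀ x ∈ A, |v x| ≤ M) :
    normL2 A v ≤ M * √(volume A).toReal := by
  have h1 := eLpNorm_le_of_ae_bound (p := 2) (μ := volume.restrict A) (f := v) (C := M)
    (ae_restrict_of_forall_mem hA h)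
  rw [Measure.restrict_apply_univ] at h1
  have h2 := ENNReal.toReal_mono (ENNReal.mul_ne_top
    (ENNReal.rpow_ne_top_of_nonneg (by norm_num) hvol) ENNReal.ofReal_ne_top) h1
  rw [ENNReal.toReal_mul, ← ENNReal.toReal_rpow, ENNReal.toReal_ofReal hM, mul_comm] at h2
  rw [normL2, Real.sqrt_eq_rpow]
  simpa using h2

theorem IsL2.fun_sub {A : Set (E d)} {v w : E d → ℝ} (hv : IsL2 A v) (hw : IsL2 A w) :
    IsL2 A fun x => v x - w x :=
  MemLp.sub hv hw

theorem normL2_le_sub_add {A : Set (E d)} {v w : E d → ℝ} (hv : IsL2 A v) (hw : IsL2 A w) :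
    normL2 A v ≤ normL2 A (fun x => v x - w x) + normL2 A w := by
  simpa only [sub_add_cancel] using normL2_add_le (hv.fun_sub hw) hw

theorem integral_affine_mul_lap_scaled {x₀ : E d} {r : ℝ} (hr : 0 < r) (c c' : ℝ) (m m' : E d) :
    ∫ x in Metric.closedBall x₀ r, (c + ⟪m, x⟫) * lap (scaled (bumpAff c' m') x₀ r) x = 0 := by
  have hts := tsupport_scaled_subset (tsupport_bumpAff_subset c' m') x₀ hr
  rw [setIntegral_eq_integral_of_forall_compl_eq_zero fun x hx => by
    rw [lap_eq_zero_of_notMem_tsupport fun h => hx (hts h), mul_zero]]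
  exact integral_affine_mul_lap (contDiff_scaled (contDiff_bumpAff c' m') _ _)
    ((isCompact_closedBall x₀ r).of_isClosed_subset (isClosed_tsupport _) hts) c m

theorem radius_le_size (hd : 0 < d) {x₀ : E d} {r : ℝ} (hr : 0 < r) {K : Finset (E d)}
    (hB : Metric.closedBall x₀ r ⊆ hull K) : r ≤ size K := by
  set e : E d := stdBasis d ⟨0, hd⟩
  have he : ‖r • e‖ = r := by
    rw [norm_smul, (stdBasis d).norm_eq_one, mul_one, Real.norm_of_nonneg hr.le]
  have hmem : x₀ + r • e ∈ hull K := hB (by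
    rw [mem_closedBall_iff_norm, add_sub_cancel_left, he])
  have h := norm_sub_le_size hmem (hB (Metric.mem_closedBall_self hr.le))
  rwa [add_sub_cancel_left, he] at h

set_option maxHeartbeats 1000000 in
/-- The lower bound for the element residual. -/
theorem exists_element_bound (d : ℕ) {σ : ℝ} (hσ : 1 ≤ σ) : ∃ C : ℝ, 0 < C ∧
    ∀ (Ω : Set (E d)), IsOpen Ω → interior (closure Ω) ⊆ Ω → ∀ T : Mesh Ω,
    ∀ (g w gT wT : E d → ℝ), IsWeakSolution Ω g w → IsL2 Ω g → IsL2 Ω w → wT ∈ T.U1 →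
    ∀ K ∈ T.cells, IsL2 (hull K) gT →
    ∀ (x₀ : E d) (r : ℝ), 0 < r → Metric.closedBall x₀ r ⊆ hull K → size K ≤ σ * r →
    ∀ (c : ℝ) (m : E d),
    size K ^ 2 * normL2 (hull K) gT ≤ C * (normL2 (hull K) (fun x => w x - wT x) +
      size K ^ 2 * normL2 (hull K) (fun x => g x - gT x) +
      size K ^ 2 * normL2 (hull K) (fun x => gT x - (c + ⟪m, x⟫))) := by
  obtain ⟨M, hM, hres⟩ := exists_residual_bound d
  obtain ⟨M', hM', htest⟩ := exists_abs_integral_mul_bumpAff_le d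
  obtain ⟨κ, hκ, hlow⟩ := exists_bump_mul_sq_lower_bound d
  -- The first factor bounds the affine function on the cell by its scaled coefficients, the second
  -- compares the cell with the ball of radius `r / 2`, and the third comes from testing on that
  -- ball.
  set D := (1 + 2 * σ) * (√((2 * σ) ^ d) * √(unitVol d)) * ((M + M') / κ) with hD
  have hD0 : 0 ≤ D := by positivity
  refine ⟨D * (2 * σ) ^ 2 + D + 1, by positivity, ?_⟩
  intro Ω hΩ hsub T g w gT wT hweak hg hw hwT K hK hgT x₀ r hr hB hσr c m
  have hintK : interior (hull K) ⊆ Ω := fun x hx =>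
    hsub (interior_mono (T.hull_subset_closure hK) hx)
  -- Half the radius keeps the closed ball inside the interior of the cell, hence inside Ω.
  set s := r / 2 with hs
  have hs0 : 0 < s := by positivity
  set B := Metric.closedBall x₀ s with hBdef
  have hBr : B ⊆ Metric.ball x₀ r := Metric.closedBall_subset_ball (by linarith)
  have hBΩ : B ⊆ Ω := fun x hx =>
    hintK (interior_mono hB (Metric.ball_subset_interior_closedBall (hBr hx)))
  have hBK : B ⊆ hull K := fun x hx => hB (Metric.ball_subset_closedBall (hBr hx))
  have hnull := T.volume_hull_sdiff hsub hK
  obtain ⟨cw, mw, hwaff⟩ := T.exists_affine hwT hK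
  have hwTK : IsL2 (hull K) wT :=
    isL2_of_continuousOn_isCompact (isCompact_hull K) (hwT.1.mono (T.hull_subset_closure hK))
  have hwK : IsL2 (hull K) w := hw.of_ae_subset hnull
  have hgK : IsL2 (hull K) g := hg.of_ae_subset hnull
  have hqc : Continuous fun x : E d => c + ⟪m, x⟫ := by fun_prop
  have hqK : IsL2 (hull K) fun x => c + ⟪m, x⟫ :=
    isL2_of_continuousOn_isCompact (isCompact_hull K) hqc.continuousOn
  -- These are the coefficients of the affine function in the variable of the unit ball, so the test
  -- function is that function times a scaled bump.
  set c' := c + ⟪m, x₀⟫ with hc'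
  set m' := s • m with hm'
  have hq : ∀ x, c + ⟪m, x⟫ = c' + ⟪m', s⁻¹ • (x - x₀)⟫ := by
    intro x
    rw [hm', real_inner_smul_left, real_inner_smul_right, ← mul_assoc, mul_inv_cancel₀ hs0.ne',
      one_mul, inner_sub_right, hc']
    ring
  set N := |c'| + ‖m'‖ with hN
  have hN0 : 0 ≤ N := by positivity
  set P := √(s ^ d) with hP
  have hP0 : 0 < P := Real.sqrt_pos.2 (by positivity)
  have hP2 : P ^ 2 = s ^ d := Real.sq_sqrt (by positivity)
  set φ := scaled (bumpAff c' m') x₀ s with hφ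
  set W := normL2 (hull K) (fun x => w x - wT x) with hW
  set G := normL2 (hull K) (fun x => g x - gT x) with hG
  set Q := normL2 (hull K) (fun x => gT x - (c + ⟪m, x⟫)) with hQ
  have hW0 : 0 ≤ W := normL2_nonneg _ _
  have hG0 : 0 ≤ G := normL2_nonneg _ _
  have hQ0 : 0 ≤ Q := normL2_nonneg _ _
  have hres' := hres Ω hΩ g w gT wT x₀ s hs0 hBΩ hweak hg hw (hgT.mono_set hBK)
    (hwTK.mono_set hBK) c' m'
  have hzero : ∫ x in B, wT x * lap φ x = 0 := by
    rw [← integral_affine_mul_lap_scaled hs0 cw c' mw m']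
    refine setIntegral_congr_fun Metric.isClosed_closedBall.measurableSet fun x hx => ?_
    simp only [hwaff x (hBK hx)]
    rfl
  have hWB : normL2 B (fun x => w x - wT x) ≤ W := normL2_mono_set hBK (hwK.fun_sub hwTK)
  have hGB : normL2 B (fun x => g x - gT x) ≤ G := normL2_mono_set hBK (hgK.fun_sub hgT)
  have hQB : normL2 B (fun x => gT x - (c + ⟪m, x⟫)) ≤ Q := normL2_mono_set hBK (hgT.fun_sub hqK)
  have h1 : |∫ x in B, gT x * φ x| ≤ M * N * P * ((s ^ 2)⁻¹ * W + G) := by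
    have h := hres'
    rw [hzero, add_zero] at h
    refine h.trans ?_
    gcongr
  have h2 : |∫ x in B, (gT x - (c + ⟪m, x⟫)) * φ x| ≤ M' * N * P * Q := by
    refine (htest _ x₀ s hs0 ((hgT.fun_sub hqK).mono_set hBK) c' m').trans ?_
    gcongr
  have hsm : ContDiff ℝ ∞ φ := contDiff_scaled (contDiff_bumpAff c' m') _ _
  have hts : tsupport φ ⊆ B := tsupport_scaled_subset (tsupport_bumpAff_subset c' m') x₀ hs0
  have hcs : HasCompactSupport φ :=
    (isCompact_closedBall x₀ s).of_isClosed_subset (isClosed_tsupport _) hts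
  have hint : ∀ v : E d → ℝ, IsL2 (hull K) v →
      Integrable (fun x => v x * φ x) (volume.restrict B) := fun v hv =>
    MemLp.integrable_mul (p := 2) (q := 2) (hv.mono_set hBK)
      ((hsm.continuous.memLp_of_hasCompactSupport hcs).restrict B)
  have h3 : ∫ x in B, (gT x - (c + ⟪m, x⟫)) * φ x =
      (∫ x in B, gT x * φ x) - ∫ x in B, (c + ⟪m, x⟫) * φ x := by
    rw [← integral_sub (hint _ hgT) (hint _ hqK)]
    simp only [sub_mul]
  have h4 : ∫ x in B, (c + ⟪m, x⟫) * φ x = P ^ 2 * ∫ z, bump z * (c' + ⟪m', z⟫) ^ 2 := by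
    rw [hP2, ← integral_scaled _ x₀ hs0, setIntegral_eq_integral_of_forall_compl_eq_zero
      fun x hx => by rw [image_eq_zero_of_notMem_tsupport fun h => hx (hts h), mul_zero]]
    refine integral_congr_ae (Eventually.of_forall fun x => ?_)
    simp only [hq x, hφ, scaled, bumpAff]
    ring
  -- Writing the affine function as `gT` minus the difference, its weighted square integral splits
  -- into the tested residual and a data error.
  have h5 : P ^ 2 * (κ * N ^ 2) ≤ N * P * (M * ((s ^ 2)⁻¹ * W + G) + M' * Q) := by
    have h6 : P ^ 2 * (κ * N ^ 2) ≤ ∫ x in B, (c + ⟪m, x⟫) * φ x := by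
      rw [h4]
      exact mul_le_mul_of_nonneg_left (hlow c' m') (by positivity)
    have h7 := le_abs_self (∫ x in B, gT x * φ x)
    have h8 := neg_abs_le (∫ x in B, (gT x - (c + ⟪m, x⟫)) * φ x)
    linarith
  have h6 : P * N ≤ (M + M') / κ * ((s ^ 2)⁻¹ * W + G + Q) := by
    rcases hN0.eq_or_lt with h0 | h0
    · rw [← h0, mul_zero]; positivity
    · have h7 : N * P * (κ * (P * N)) ≤ N * P * ((M + M') * ((s ^ 2)⁻¹ * W + G + Q)) := by
        have hz : 0 ≤ (s ^ 2)⁻¹ * W := by positivity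
        calc N * P * (κ * (P * N)) = P ^ 2 * (κ * N ^ 2) := by ring
          _ ≤ _ := h5
          _ ≤ _ := by
            refine mul_le_mul_of_nonneg_left ?_ (by positivity)
            nlinarith
      have h8 := le_of_mul_le_mul_left h7 (by positivity)
      rw [div_mul_eq_mul_div, le_div_iff₀ hκ]
      linarith
  have hvolK : √(volume (hull K)).toReal ≤ √((2 * σ) ^ d) * √(unitVol d) * P := by
    rw [hP, ← Real.sqrt_mul (by positivity), ← Real.sqrt_mul (by have := @unitVol_nonneg d; positivity)]
    refine Real.sqrt_le_sqrt ?_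
    have hle : hull K ⊆ Metric.closedBall x₀ (2 * σ * s) := fun x hx => by
      rw [mem_closedBall_iff_norm]
      refine (norm_sub_le_size hx (hB (Metric.mem_closedBall_self hr.le))).trans ?_
      rw [hs]; linarith
    have := ENNReal.toReal_mono measure_closedBall_lt_top.ne (measure_mono (μ := volume) hle)
    rw [volume_closedBall_toReal _ (by positivity), mul_pow] at this
    linarith
  have hqN : normL2 (hull K) (fun x => c + ⟪m, x⟫) ≤
      (1 + 2 * σ) * (√((2 * σ) ^ d) * √(unitVol d)) * (P * N) := by
    have h7 := normL2_le_of_forall_abs_le (isCompact_hull K).measurableSet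
      (isCompact_hull K).measure_lt_top.ne (v := fun x => c + ⟪m, x⟫) (M := (1 + 2 * σ) * N)
      (by positivity) fun x hx => by
        rw [hq]
        have hn : ‖s⁻¹ • (x - x₀)‖ ≤ 2 * σ := by
          rw [norm_smul, norm_inv, Real.norm_of_nonneg hs0.le, inv_mul_le_iff₀ hs0]
          refine (norm_sub_le_size hx (hB (Metric.mem_closedBall_self hr.le))).trans ?_
          rw [hs]; linarith
        have hi : |⟪m', s⁻¹ • (x - x₀)⟫| ≤ ‖m'‖ * (2 * σ) :=
          (abs_real_inner_le_norm _ _).trans (by gcongr)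
        have := abs_add_le c' ⟪m', s⁻¹ • (x - x₀)⟫
        have := abs_nonneg c'
        have := norm_nonneg m'
        have : 0 ≤ 2 * σ * |c'| := by positivity
        rw [hN]
        linarith
    refine h7.trans ?_
    calc (1 + 2 * σ) * N * √(volume (hull K)).toReal
        ≤ (1 + 2 * σ) * N * (√((2 * σ) ^ d) * √(unitVol d) * P) := by gcongr
      _ = _ := by ring
  have hqD : normL2 (hull K) (fun x => c + ⟪m, x⟫) ≤ D * ((s ^ 2)⁻¹ * W + G + Q) :=
    hqN.trans (by
      rw [hD, mul_assoc _ ((M + M') / κ)]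
      gcongr)
  have htri : normL2 (hull K) gT ≤ Q + normL2 (hull K) (fun x => c + ⟪m, x⟫) :=
    normL2_le_sub_add hgT hqK
  have hsz : 0 ≤ size K := Metric.diam_nonneg
  have hscale : size K ^ 2 * (s ^ 2)⁻¹ ≤ (2 * σ) ^ 2 := by
    rw [← div_eq_mul_inv, ← div_pow]
    have : size K / s ≤ 2 * σ := by
      rw [div_le_iff₀ hs0, hs]; linarith
    gcongr
  calc size K ^ 2 * normL2 (hull K) gT
      ≤ size K ^ 2 * (Q + D * ((s ^ 2)⁻¹ * W + G + Q)) := by gcongr; linarith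
    _ = D * (size K ^ 2 * (s ^ 2)⁻¹) * W + D * (size K ^ 2 * G) + (D + 1) * (size K ^ 2 * Q) := by
        ring
    _ ≤ D * (2 * σ) ^ 2 * W + D * (size K ^ 2 * G) + (D + 1) * (size K ^ 2 * Q) := by gcongr
    _ ≤ _ := by
        have h9 : 0 ≤ size K ^ 2 * G := by positivity
        have h10 : 0 ≤ size K ^ 2 * Q := by positivity
        have h11 : 0 ≤ D * (2 * σ) ^ 2 := by positivity
        linarith [mul_nonneg hD0 hW0, mul_nonneg h11 h9, mul_nonneg h11 h10]

/-! ### The jump residual -/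

/-- Scaling count: volume gives `ρ ^ d`, the Laplacian `ρ⁻²`, and the positive part, homogeneous of
degree one, gives `ρ`. -/
theorem integral_posPart_mul_lap_scaled (ν x₀ : E d) {ρ : ℝ} (hρ : 0 < ρ) :
    ∫ x in Metric.closedBall x₀ ρ, max ⟪ν, x - x₀⟫ 0 * lap (scaled (bumpAff 1 0) x₀ ρ) x =
      ρ ^ d * ρ⁻¹ * ∫ z, max ⟪ν, z⟫ 0 * lap bump z := by
  have hts := tsupport_scaled_subset (tsupport_bumpAff_subset (d := d) 1 0) x₀ hρ
  rw [setIntegral_eq_integral_of_forall_compl_eq_zero fun x hx => by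
    rw [lap_eq_zero_of_notMem_tsupport fun h => hx (hts h), mul_zero], mul_assoc,
    ← integral_const_mul, ← integral_scaled _ x₀ hρ]
  refine integral_congr_ae (Eventually.of_forall fun x => ?_)
  have h1 : ⟪ν, x - x₀⟫ = ρ * ⟪ν, ρ⁻¹ • (x - x₀)⟫ := by
    rw [real_inner_smul_right, ← mul_assoc, mul_inv_cancel₀ hρ.ne', one_mul]
  have h2 : max ⟪ν, x - x₀⟫ 0 = ρ * max ⟪ν, ρ⁻¹ • (x - x₀)⟫ 0 := by
    rw [h1, mul_max_of_nonneg _ _ hρ.le, mul_zero]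
  simp only [bumpAff_one_zero, lap_scaled contDiff_bump, h2]
  simp only [scaled]
  field_simp

/-- The lower bound for the jump of the gradient of an affine function with a kink. -/
theorem exists_kink_bound (d : ℕ) : ∃ C : ℝ, 0 < C ∧
    ∀ (Ω : Set (E d)), IsOpen Ω → ∀ (g w gT wT : E d → ℝ) (x₀ : E d) (ρ : ℝ), 0 < ρ →
    Metric.closedBall x₀ ρ ⊆ Ω → IsWeakSolution Ω g w → IsL2 Ω g → IsL2 Ω w →
    IsL2 (Metric.closedBall x₀ ρ) gT → ∀ (c J : ℝ) (m ν : E d), ‖ν‖ = 1 →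
    (∀ x ∈ Metric.closedBall x₀ ρ, wT x = c + ⟪m, x⟫ - J * max ⟪ν, x - x₀⟫ 0) →
    |J| * (√(ρ ^ d) * ρ) ≤ C * (normL2 (Metric.closedBall x₀ ρ) (fun x => w x - wT x) +
      ρ ^ 2 * normL2 (Metric.closedBall x₀ ρ) (fun x => g x - gT x) +
      ρ ^ 2 * normL2 (Metric.closedBall x₀ ρ) gT) := by
  obtain ⟨M, hM, hres⟩ := exists_residual_bound d
  obtain ⟨M', hM', htest⟩ := exists_abs_integral_mul_bumpAff_le d
  obtain ⟨κ, hκ, hlow⟩ := exists_posPart_mul_lap_bump_lower_bound d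
  refine ⟨(M + M') / κ, by positivity, ?_⟩
  intro Ω hΩ g w gT wT x₀ ρ hρ hBΩ hweak hg hw hgT c J m ν hν hwT
  set B := Metric.closedBall x₀ ρ with hB
  have hBc : IsCompact B := isCompact_closedBall x₀ ρ
  have hkc : Continuous fun x : E d => c + ⟪m, x⟫ - J * max ⟪ν, x - x₀⟫ 0 := by fun_prop
  have hwTB : IsL2 B wT := isL2_of_continuousOn_isCompact hBc (hkc.continuousOn.congr hwT)
  set φ := scaled (bumpAff 1 (0 : E d)) x₀ ρ with hφ
  set P := √(ρ ^ d) with hP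
  have hP0 : 0 < P := Real.sqrt_pos.2 (by positivity)
  have hP2 : P ^ 2 = ρ ^ d := Real.sq_sqrt (by positivity)
  set W := normL2 B (fun x => w x - wT x) with hW
  set G := normL2 B (fun x => g x - gT x) with hG
  set F := normL2 B gT with hF
  have hW0 : 0 ≤ W := normL2_nonneg _ _
  have hG0 : 0 ≤ G := normL2_nonneg _ _
  have hF0 : 0 ≤ F := normL2_nonneg _ _
  have h1 := hres Ω hΩ g w gT wT x₀ ρ hρ hBΩ hweak hg hw hgT hwTB 1 0
  have h2 := htest gT x₀ ρ hρ hgT 1 0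
  simp only [abs_one, norm_zero, add_zero, mul_one] at h1 h2
  have hsm : ContDiff ℝ ∞ φ := contDiff_scaled (contDiff_bumpAff 1 0) _ _
  have hlc := (contDiff_lap hsm).continuous
  have hint : ∀ v : E d → ℝ, Continuous v →
      Integrable (fun x => v x * lap φ x) (volume.restrict B) := fun v hv =>
    ((hv.mul hlc).continuousOn.integrableOn_compact hBc)
  -- The affine part is annihilated, so only the kink survives, with the coefficient `J`.
  have h3 : ∫ x in B, wT x * lap φ x =
      -(J * (P ^ 2 * ρ⁻¹ * ∫ z, max ⟪ν, z⟫ 0 * lap bump z)) := by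
    have h4 : ∫ x in B, (c + ⟪m, x⟫) * lap φ x = 0 := integral_affine_mul_lap_scaled hρ c 1 m 0
    have h5 : ∫ x in B, wT x * lap φ x = (∫ x in B, (c + ⟪m, x⟫) * lap φ x) -
        ∫ x in B, J * (max ⟪ν, x - x₀⟫ 0 * lap φ x) := by
      rw [← integral_sub (hint _ (by fun_prop))
        ((hint (fun x => max ⟪ν, x - x₀⟫ 0) (by fun_prop)).const_mul J)]
      refine setIntegral_congr_fun hBc.measurableSet fun x hx => ?_
      simp only [hwT x hx]
      ring
    rw [h5, h4, zero_sub, integral_const_mul, hP2, ← integral_posPart_mul_lap_scaled ν x₀ hρ]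
  have h4 : |J| * (P ^ 2 * ρ⁻¹ * κ) ≤ M * P * ((ρ ^ 2)⁻¹ * W + G) + M' * P * F := by
    have h5 : |J| * (P ^ 2 * ρ⁻¹ * κ) ≤ |∫ x in B, wT x * lap φ x| := by
      have h6 := hlow ν hν
      rw [h3, abs_neg, abs_mul]
      refine mul_le_mul_of_nonneg_left ?_ (abs_nonneg J)
      refine le_trans ?_ (le_abs_self _)
      gcongr
    have h6 := abs_sub_abs_le_abs_sub (∫ x in B, wT x * lap φ x) (-∫ x in B, gT x * φ x)
    rw [abs_neg, sub_neg_eq_add, add_comm (∫ x in B, wT x * lap φ x)] at h6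
    linarith
  have h5 : P * (ρ ^ 2)⁻¹ * (κ * (|J| * (P * ρ))) ≤
      P * (ρ ^ 2)⁻¹ * ((M + M') * (W + ρ ^ 2 * G + ρ ^ 2 * F)) := by
    calc P * (ρ ^ 2)⁻¹ * (κ * (|J| * (P * ρ))) = |J| * (P ^ 2 * ρ⁻¹ * κ) := by field_simp
      _ ≤ _ := h4
      _ = P * (ρ ^ 2)⁻¹ * (M * (W + ρ ^ 2 * G) + M' * (ρ ^ 2 * F)) := by field_simp
      _ ≤ _ := by
        refine mul_le_mul_of_nonneg_left ?_ (by positivity)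
        have e1 : 0 ≤ ρ ^ 2 * F := by positivity
        have e2 : 0 ≤ ρ ^ 2 * G := by positivity
        linarith [mul_nonneg hM.le e1, mul_nonneg hM'.le e2, mul_nonneg hM'.le hW0]
  have h6 := le_of_mul_le_mul_left h5 (by positivity)
  rw [div_mul_eq_mul_div, le_div_iff₀ hκ]
  linarith

section Sides

variable {T : Mesh Ω} {K γ : Finset (E d)}

theorem Mesh.exists_neighbour (hγ : γ ∈ T.sidesOf K) :
    γ ⊆ K ∧ γ.card = d ∧ ∃ K' ∈ T.cells, K' ≠ K ∧ γ ⊆ K' := by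
  classical
  obtain ⟨hs, hγK⟩ := Finset.mem_filter.1 hγ
  obtain ⟨⟨K₁, K₂⟩, hq, rfl⟩ := Finset.mem_image.1 hs
  obtain ⟨hmem, hne, hcard⟩ := Finset.mem_filter.1 hq
  obtain ⟨hK₁, hK₂⟩ := Finset.mem_product.1 hmem
  refine ⟨hγK, hcard, ?_⟩
  by_cases h : K₁ = K
  · exact ⟨K₂, hK₂, fun h' => hne (h.trans h'.symm), Finset.inter_subset_right⟩
  · exact ⟨K₁, hK₁, h, Finset.inter_subset_left⟩

theorem Mesh.mem_patchCells_of_side {K' : Finset (E d)} (hγ : γ ∈ T.sidesOf K)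
    (hK' : K' ∈ T.cells) (hγ' : γ ⊆ K') : K' ∈ T.patchCells K := by
  classical
  refine Finset.mem_filter.2 ⟨hK', Or.inr ⟨γ, Finset.mem_inter.2 ⟨hγ, ?_⟩⟩⟩
  exact Finset.mem_filter.2 ⟨(Finset.mem_filter.1 hγ).1, hγ'⟩

theorem Mesh.card_sidesOf_le (hK : K ∈ T.cells) : (T.sidesOf K).card ≤ d + 1 := by
  classical
  have hsub : T.sidesOf K ⊆ K.powersetCard d := fun γ hγ => by
    obtain ⟨h1, h2, -⟩ := Mesh.exists_neighbour hγ
    exact Finset.mem_powersetCard.2 ⟨h1, h2⟩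
  refine (Finset.card_le_card hsub).trans ?_
  rw [Finset.card_powersetCard, T.card_cell K hK, Nat.choose_succ_self_right]

/-- Exactly two cells contain a given internal side. -/
theorem Mesh.filter_side_eq {σ : ℝ} (hT : T.IsShapeRegular σ) (hd : 0 < d) {K' : Finset (E d)}
    (hK : K ∈ T.cells) (hK' : K' ∈ T.cells) (hne : K' ≠ K) (hγ : γ ⊆ K) (hγ' : γ ⊆ K')
    (hc : γ.card = d) [DecidablePred fun K => γ ⊆ K] [DecidableEq (Finset (E d))] :
    T.cells.filter (fun K => γ ⊆ K) = {K, K'} := by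
  ext L
  simp only [Finset.mem_filter, Finset.mem_insert, Finset.mem_singleton]
  constructor
  · rintro ⟨hL, hγL⟩
    by_contra hcon
    push Not at hcon
    obtain ⟨x₀, r, hr, hB, -⟩ := hT K hK
    obtain ⟨x₁, r', hr', hB', -⟩ := hT K' hK'
    obtain ⟨x₂, r'', hr'', hB'', -⟩ := hT L hL
    -- Three cells on one side would have pairwise opposite unit normals, forcing a unit vector to
    -- equal its negative.
    have h1 := Mesh.outerNormal_eq_neg hK hK' hγ hγ' hc hd hne.symm hr hB hr' hB'
    have h2 := Mesh.outerNormal_eq_neg hL hK hγL hγ hc hd hcon.1 hr'' hB'' hr hB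
    have h3 := Mesh.outerNormal_eq_neg hL hK' hγL hγ' hc hd hcon.2 hr'' hB'' hr' hB'
    have h4 : outerNormal K γ = -outerNormal K γ := by
      rw [← h1, h3, h2]
    have h5 := congrArg (fun z => ⟪outerNormal K γ, z⟫) h4
    simp only [inner_neg_right, real_inner_self_eq_norm_sq,
      (outerNormal_spec T hK hγ hc hd).1] at h5
    norm_num at h5
  · rintro (rfl | rfl)
    · exact ⟨hK, hγ⟩
    · exact ⟨hK', hγ'⟩

/-- The shape of a piecewise affine function around the barycentre of an internal side. -/
theorem Mesh.exists_kink {σ : ℝ} (hT : T.IsShapeRegular σ) (hd : 0 < d) {K' : Finset (E d)}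
    (hK : K ∈ T.cells) (hK' : K' ∈ T.cells) (hne : K' ≠ K) (hγ : γ ⊆ K) (hγ' : γ ⊆ K')
    (hc : γ.card = d) {w : E d → ℝ} (hw : w ∈ T.U1) {x₀ x₁ : E d} {r r' ρ : ℝ} (hr : 0 < r)
    (hB : Metric.closedBall x₀ r ⊆ hull K) (hr' : 0 < r')
    (hB' : Metric.closedBall x₁ r' ⊆ hull K') (hρ : ρ ≤ r / d) (hρ' : ρ ≤ r' / d) :
    Metric.closedBall (barycentre γ) ρ ⊆ hull K ∪ hull K' ∧
    ∃ (c J : ℝ) (m ν : E d), ‖ν‖ = 1 ∧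
      (∀ x ∈ Metric.closedBall (barycentre γ) ρ,
        w x = c + ⟪m, x⟫ - J * max ⟪ν, x - barycentre γ⟫ 0) ∧
      ∀ x ∈ hull γ, T.jump w γ x = J := by
  classical
  set b := barycentre γ with hb
  obtain ⟨hν1, hν2, hν3⟩ := outerNormal_spec T hK hγ hc hd
  have hneg := Mesh.outerNormal_eq_neg hK hK' hγ hγ' hc hd hne.symm hr hB hr' hB'
  obtain ⟨c, m, hwK⟩ := T.exists_affine hw hK
  obtain ⟨c', m', hwK'⟩ := T.exists_affine hw hK'
  -- The two affine pieces agree on the side, so the difference of their gradients has no tangential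
  -- part and is the jump times the normal.
  have hm : ∀ x ∈ hull γ, ∀ z ∈ hull γ, ⟪m - m', z - x⟫ = 0 := by
    intro x hx z hz
    have h1 := (hwK x (hull_mono hγ hx)).symm.trans (hwK' x (hull_mono hγ' hx))
    have h2 := (hwK z (hull_mono hγ hz)).symm.trans (hwK' z (hull_mono hγ' hz))
    rw [inner_sub_left, inner_sub_right, inner_sub_right]
    linarith
  have hJ := Mesh.eq_inner_smul_normal hK hγ hc hd
    (fun x hx z hz => hm x (mem_hull hx) z (mem_hull hz))
  have hin : ∀ x ∈ Metric.closedBall b ρ, ⟪outerNormal K γ, x - b⟫ ≤ 0 → x ∈ hull K := by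
    intro x hx hxν
    rw [mem_closedBall_iff_norm] at hx
    exact Mesh.mem_hull_of_norm_sub_barycentre_le hK hγ hc hd hr hB (hx.trans hρ) hxν
  have hin' : ∀ x ∈ Metric.closedBall b ρ, 0 ≤ ⟪outerNormal K γ, x - b⟫ → x ∈ hull K' := by
    intro x hx hxν
    rw [mem_closedBall_iff_norm] at hx
    refine Mesh.mem_hull_of_norm_sub_barycentre_le hK' hγ' hc hd hr' hB' (hx.trans hρ') ?_
    rw [hneg, inner_neg_left]
    exact neg_nonpos.2 hxν
  refine ⟨fun x hx => ?_, c, ⟪outerNormal K γ, m - m'⟫, m, outerNormal K γ, hν1, ?_, ?_⟩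
  · rcases le_total ⟪outerNormal K γ, x - b⟫ 0 with h | h
    · exact Or.inl (hin x hx h)
    · exact Or.inr (hin' x hx h)
  · intro x hx
    rcases le_total ⟪outerNormal K γ, x - b⟫ 0 with h | h
    · rw [max_eq_right h, hwK x (hin x hx h), mul_zero, sub_zero]
    · have hbγ : b ∈ hull γ := barycentre_mem_hull hc hd
      have h1 := (hwK b (hull_mono hγ hbγ)).symm.trans (hwK' b (hull_mono hγ' hbγ))
      have h2 : ⟪m - m', x - b⟫ = ⟪outerNormal K γ, m - m'⟫ * ⟪outerNormal K γ, x - b⟫ := by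
        conv_lhs => rw [hJ]
        rw [real_inner_smul_left]
      rw [max_eq_left h, hwK' x (hin' x hx h), ← h2]
      simp only [inner_sub_left, inner_sub_right]
      linarith
  · intro x hx
    rw [jump, Mesh.filter_side_eq hT hd hK hK' hne hγ hγ' hc, Finset.sum_pair hne.symm,
      cellGrad_eq (Mesh.interior_hull_nonempty hr hB) hwK (hull_mono hγ hx),
      cellGrad_eq (Mesh.interior_hull_nonempty hr' hB') hwK' (hull_mono hγ' hx), hneg,
      inner_neg_left, inner_sub_right, ← sub_eq_add_neg]

end Sides

/-! ### The measure of a side -/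

/-- With one vertex as origin, the side lies in the image of the unit cube of dimension `d - 1`
under an affine map with Lipschitz constant `(d - 1) h` for the sup norm. In that norm the cube has
Hausdorff measure `1`; the factor `s` converts to the Euclidean normalization. -/
theorem exists_euclideanHausdorffMeasure_hull_le (d : ℕ) : ∃ C : ℝ, 0 < C ∧
    ∀ (γ : Finset (E d)), γ.card = d → 0 < d → ∀ h : ℝ, (∀ x ∈ γ, ∀ z ∈ γ, ‖z - x‖ ≤ h) →
    (μHE[d - 1] (hull γ)).toReal ≤ C * h ^ (d - 1) := by
  classical
  set s : ℝ≥0 := Measure.addHaarScalarFactor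
    (volume : Measure (EuclideanSpace ℝ (Fin (d - 1)))) μH[((d - 1 : ℕ) : ℝ)] with hs
  refine ⟨s * ((d - 1 : ℕ) : ℝ) ^ (d - 1) + 1, by positivity, fun γ hc hd h hh => ?_⟩
  obtain ⟨x₀, hx₀⟩ : γ.Nonempty := by rw [← Finset.card_pos]; omega
  have h0 : 0 ≤ h := (norm_nonneg _).trans (hh x₀ hx₀ x₀ hx₀)
  let ι := {z // z ∈ γ.erase x₀}
  have hι : Fintype.card ι = d - 1 := by
    rw [Fintype.card_coe, Finset.card_erase_of_mem hx₀, hc]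
  let A : (ι → ℝ) →ₗ[ℝ] E d :=
    ∑ i : ι, (LinearMap.proj i).smulRight ((i : E d) - x₀)
  have hA : ∀ t, A t = ∑ i : ι, t i • ((i : E d) - x₀) := fun t => by
    simp [A]
  let F : (ι → ℝ) → E d := fun t => x₀ + A t
  set L : ℝ≥0 := (((d - 1 : ℕ) : ℝ) * h).toNNReal with hL
  have hLc : (L : ℝ) = ((d - 1 : ℕ) : ℝ) * h := Real.coe_toNNReal _ (by positivity)
  have hLip : LipschitzWith L F := by
    refine LipschitzWith.of_dist_le_mul fun t t' => ?_
    rw [dist_eq_norm, dist_eq_norm, add_sub_add_left_eq_sub, ← map_sub, hA]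
    refine (norm_sum_le _ _).trans ?_
    calc ∑ i : ι, ‖(t - t') i • ((i : E d) - x₀)‖ ≤ ∑ _i : ι, ‖t - t'‖ * h := by
          refine Finset.sum_le_sum fun i _ => ?_
          rw [norm_smul]
          exact mul_le_mul (norm_le_pi_norm _ i) (hh x₀ hx₀ i (Finset.mem_of_mem_erase i.2))
            (norm_nonneg _) (norm_nonneg _)
      _ = L * ‖t - t'‖ := by
          rw [Finset.sum_const, Finset.card_univ, hι, nsmul_eq_mul, hLc]
          ring
  have hsub : hull γ ⊆ F '' Set.Icc 0 1 := by
    have hconv : Convex ℝ (F '' Set.Icc 0 1) := by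
      have h1 := ((convex_Icc (0 : ι → ℝ) 1).linear_image A).translate x₀
      rwa [Set.image_image] at h1
    refine convexHull_min (fun z hz => ?_) hconv
    by_cases hzx : z = x₀
    · exact ⟨0, by simp, by simp [F, hzx]⟩
    · refine ⟨Pi.single ⟨z, Finset.mem_erase.2 ⟨hzx, hz⟩⟩ 1, ⟨?_, ?_⟩, ?_⟩
      · intro i
        by_cases hi : i = ⟨z, Finset.mem_erase.2 ⟨hzx, hz⟩⟩
        · subst hi; simp
        · simp [hi]
      · intro i
        by_cases hi : i = ⟨z, Finset.mem_erase.2 ⟨hzx, hz⟩⟩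
        · subst hi; simp
        · simp [hi]
      · simp only [F, hA]
        rw [Finset.sum_eq_single ⟨z, Finset.mem_erase.2 ⟨hzx, hz⟩⟩]
        · simp
        · intro i _ hi
          simp [hi]
        · simp
  have hcube : (μH[((d - 1 : ℕ) : ℝ)] : Measure (ι → ℝ)) (Set.Icc 0 1) = 1 := by
    rw [← hι, hausdorffMeasure_pi_real, Real.volume_Icc_pi]
    simp
  have hμ : μH[((d - 1 : ℕ) : ℝ)] (hull γ) ≤ ((L ^ (d - 1) : ℝ≥0) : ℝ≥0∞) := by
    calc μH[((d - 1 : ℕ) : ℝ)] (hull γ) ≤ μH[((d - 1 : ℕ) : ℝ)] (F '' Set.Icc 0 1) :=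
          measure_mono hsub
      _ ≤ (L : ℝ≥0∞) ^ ((d - 1 : ℕ) : ℝ) * μH[((d - 1 : ℕ) : ℝ)] (Set.Icc (0 : ι → ℝ) 1) :=
          hLip.hausdorffMeasure_image_le (by positivity) _
      _ = _ := by
          rw [hcube, mul_one, ENNReal.rpow_natCast, ENNReal.coe_pow]
  have hE : μHE[d - 1] (hull γ) ≤ ((s * L ^ (d - 1) : ℝ≥0) : ℝ≥0∞) := by
    rw [Measure.euclideanHausdorffMeasure_def, Measure.smul_apply, ENNReal.smul_def, smul_eq_mul,
      ENNReal.coe_mul]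
    gcongr
  have h1 := ENNReal.toReal_mono ENNReal.coe_ne_top hE
  rw [ENNReal.coe_toReal, NNReal.coe_mul, NNReal.coe_pow, hLc, mul_pow] at h1
  have h2 : 0 ≤ h ^ (d - 1) := by positivity
  linarith

/-! ### The efficiency of the residual indicator -/

/-- Shape regularity compares the size of a cell with the length of each edge. -/
theorem Mesh.size_le_mul_norm_sub {T : Mesh Ω} {σ : ℝ} (hσ : 0 ≤ σ) {K : Finset (E d)}
    (hK : K ∈ T.cells) {x₀ : E d} {r : ℝ} (hr : 0 < r) (hB : Metric.closedBall x₀ r ⊆ hull K)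
    (hσr : size K ≤ σ * r) {v w : E d} (hv : v ∈ K) (hw : w ∈ K) (hvw : v ≠ w) :
    size K ≤ σ * ‖v - w‖ :=
  hσr.trans (mul_le_mul_of_nonneg_left (T.le_norm_sub hK hr hB hv hw hvw) hσ)

/-- Cells with a common side have comparable sizes. -/
theorem Mesh.size_le_mul_size {T : Mesh Ω} {σ : ℝ} (hσ : 0 ≤ σ) (hT : T.IsShapeRegular σ)
    (hd : 2 ≤ d) {K K' γ : Finset (E d)} (hK : K ∈ T.cells) (hγ : γ ⊆ K) (hγ' : γ ⊆ K')
    (hc : γ.card = d) : size K ≤ σ * size K' := by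
  obtain ⟨x₀, r, hr, hB, hσr⟩ := hT K hK
  -- Since `d ≥ 2`, the common side has an edge, and its length is comparable with the size of
  -- either cell.
  obtain ⟨v, hv, w, hw, hvw⟩ := Finset.one_lt_card.1 (show 1 < γ.card by omega)
  refine (Mesh.size_le_mul_norm_sub hσ hK hr hB hσr (hγ hv) (hγ hw) hvw).trans ?_
  exact mul_le_mul_of_nonneg_left (norm_sub_le_size (mem_hull (hγ' hv)) (mem_hull (hγ' hw))) hσ

theorem Mesh.size_pos {T : Mesh Ω} {σ : ℝ} (hT : T.IsShapeRegular σ) (hd : 0 < d)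
    {K : Finset (E d)} (hK : K ∈ T.cells) : 0 < size K := by
  obtain ⟨x₀, r, hr, hB, -⟩ := hT K hK
  exact hr.trans_le (radius_le_size hd hr hB)

theorem Mesh.jump_sq_integral_le {T : Mesh Ω} {w : E d → ℝ} {γ : Finset (E d)} {J C h : ℝ}
    (hJ : ∀ x ∈ hull γ, T.jump w γ x = J)
    (hμ : (μHE[d - 1] (hull γ)).toReal ≤ C * h ^ (d - 1)) :
    ∫ x in hull γ, T.jump w γ x ^ 2 ∂(μHE[d - 1]) ≤ C * h ^ (d - 1) * J ^ 2 := by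
  rw [setIntegral_congr_fun (g := fun _ => J ^ 2) (isCompact_hull γ).measurableSet
    fun x hx => by simp only [hJ x hx], setIntegral_const, smul_eq_mul]
  exact mul_le_mul_of_nonneg_right hμ (sq_nonneg J)

set_option maxHeartbeats 1000000 in
/-- The lower bound for the jump residual on one internal side. -/
theorem exists_side_bound (d : ℕ) (hd : 2 ≤ d) {σ : ℝ} (hσ : 1 ≤ σ) : ∃ C : ℝ, 0 < C ∧
    ∀ (Ω : Set (E d)), IsOpen Ω → interior (closure Ω) ⊆ Ω → ∀ T : Mesh Ω,
    T.IsShapeRegular σ → ∀ (g w gT wT : E d → ℝ), IsWeakSolution Ω g w → IsL2 Ω g → IsL2 Ω w →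
    IsL2 Ω gT → wT ∈ T.U1 → IsL2 (closure Ω) wT → ∀ (K K' γ : Finset (E d)), K ∈ T.cells →
    K' ∈ T.patchCells K → K' ≠ K → γ ⊆ K → γ ⊆ K' → γ.card = d →
    size K ^ 3 * ∫ x in hull γ, T.jump wT γ x ^ 2 ∂(μHE[d - 1]) ≤
      C * (normL2 (T.patch K) (fun x => w x - wT x) +
        size K ^ 2 * normL2 (T.patch K) (fun x => g x - gT x) +
        size K ^ 2 * normL2 (hull K) gT + size K' ^ 2 * normL2 (hull K') gT) ^ 2 := by
  obtain ⟨C₂, hC₂, hkink⟩ := exists_kink_bound d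
  obtain ⟨C₃, hC₃, hsurf⟩ := exists_euclideanHausdorffMeasure_hull_le d
  have hd0 : 0 < d := by omega
  have hσ0 : 0 < σ := by linarith
  have hdR : (1 : ℝ) ≤ d := by exact_mod_cast hd0
  -- With `ρ = h / τ`, the radius `2ρ` is at most `r/d` and `r'/d`, as `h ≤ σ² r` and `h ≤ σ size K'
  -- ≤ σ² r'`. The factor `2` leaves room for the closed ball of radius `ρ` to lie in the interior
  -- of the two cells.
  set τ : ℝ := 2 * d * σ ^ 2 with hτ
  have hσ2 : 1 ≤ σ ^ 2 := by nlinarith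
  have hτ1 : 1 ≤ τ := by rw [hτ]; nlinarith
  refine ⟨C₃ * τ ^ (d + 2) * (C₂ * σ ^ 2) ^ 2, by positivity, ?_⟩
  intro Ω hΩ hsub T hT g w gT wT hweak hg hw hgT hwT hwT2 K K' γ hK hKp' hne hγ hγ' hc
  have hK' := T.mem_cells_of_mem_patchCells hKp'
  obtain ⟨x₀, r, hr, hB, hσr⟩ := hT K hK
  obtain ⟨x₁, r', hr', hB', hσr'⟩ := hT K' hK'
  set h := size K with hh
  have hh0 : 0 < h := Mesh.size_pos hT hd0 hK
  have hhh' : h ≤ σ * size K' := Mesh.size_le_mul_size hσ0.le hT hd hK hγ hγ' hc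
  set ρ := h / τ with hρ
  have hρ0 : 0 < ρ := by positivity
  have hhρ : h = τ * ρ := by rw [hρ]; field_simp
  have hρh : ρ ≤ h := div_le_self hh0.le hτ1
  have h2ρ : 2 * ρ = h / σ ^ 2 / d := by rw [hρ, hτ]; field_simp
  have hρr : 2 * ρ ≤ r / d := by
    rw [h2ρ]
    gcongr
    rw [div_le_iff₀ (by positivity)]
    nlinarith [mul_nonneg (mul_nonneg hσ0.le hr.le) (sub_nonneg.2 hσ)]
  have hρr' : 2 * ρ ≤ r' / d := by
    rw [h2ρ]
    gcongr
    rw [div_le_iff₀ (by positivity)]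
    nlinarith
  obtain ⟨hsub2, c, J, m, ν, hν, hshape, hJ⟩ := Mesh.exists_kink hT hd0 hK hK' hne hγ hγ' hc hwT
    hr hB hr' hB' hρr hρr'
  set b := barycentre γ
  set B := Metric.closedBall b ρ with hBdef
  have hBB : B ⊆ Metric.closedBall b (2 * ρ) := Metric.closedBall_subset_closedBall (by linarith)
  have hBU : B ⊆ hull K ∪ hull K' := hBB.trans hsub2
  have hUc : hull K ∪ hull K' ⊆ closure Ω :=
    Set.union_subset (T.hull_subset_closure hK) (T.hull_subset_closure hK')
  have hBΩ : B ⊆ Ω := fun x hx => by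
    refine hsub (interior_mono (hsub2.trans hUc) (Metric.ball_subset_interior_closedBall ?_))
    exact Metric.closedBall_subset_ball (by linarith) hx
  have hBp : B ⊆ T.patch K := hBU.trans (Set.union_subset
    (T.hull_subset_patch (T.mem_patchCells_self hK)) (T.hull_subset_patch hKp'))
  have hpn := T.volume_patch_sdiff hsub K
  have hpc : T.patch K ⊆ closure Ω := Set.iUnion₂_subset fun L hL =>
    T.hull_subset_closure (T.mem_cells_of_mem_patchCells hL)
  have hgTK : IsL2 (hull K) gT := hgT.of_ae_subset (T.volume_hull_sdiff hsub hK)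
  have hgTK' : IsL2 (hull K') gT := hgT.of_ae_subset (T.volume_hull_sdiff hsub hK')
  set W := normL2 (T.patch K) (fun x => w x - wT x) with hW
  set G := normL2 (T.patch K) (fun x => g x - gT x) with hG
  set F := normL2 (hull K) gT with hF
  set F' := normL2 (hull K') gT with hF'
  have hW0 : 0 ≤ W := normL2_nonneg _ _
  have hG0 : 0 ≤ G := normL2_nonneg _ _
  have hF0 : 0 ≤ F := normL2_nonneg _ _
  have hF'0 : 0 ≤ F' := normL2_nonneg _ _
  have h1 := hkink Ω hΩ g w gT wT b ρ hρ0 hBΩ hweak hg hw (hgT.mono_set hBΩ) c J m ν hν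
    fun x hx => hshape x (hBB hx)
  have hWB : normL2 B (fun x => w x - wT x) ≤ W :=
    normL2_mono_set hBp ((hw.of_ae_subset hpn).fun_sub (hwT2.mono_set hpc))
  have hGB : normL2 B (fun x => g x - gT x) ≤ G :=
    normL2_mono_set hBp ((hg.of_ae_subset hpn).fun_sub (hgT.of_ae_subset hpn))
  have hFB : normL2 B gT ≤ F + F' :=
    (normL2_mono_set hBU ((hgT.of_ae_subset (by
      rw [Set.union_sdiff_distrib]
      exact measure_union_null (T.volume_hull_sdiff hsub hK) (T.volume_hull_sdiff hsub hK'))))).trans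
      (normL2_union_le hgTK hgTK')
  set X := W + h ^ 2 * G + h ^ 2 * F + size K' ^ 2 * F' with hX
  have hX0 : 0 ≤ X := by positivity
  have h2 : |J| * (√(ρ ^ d) * ρ) ≤ C₂ * σ ^ 2 * X := by
    refine h1.trans ?_
    rw [mul_assoc]
    refine mul_le_mul_of_nonneg_left ?_ hC₂.le
    have n1 := normL2_nonneg B fun x => g x - gT x
    have n2 := normL2_nonneg B gT
    have e1 : ρ ^ 2 * normL2 B (fun x => g x - gT x) ≤ h ^ 2 * G := by gcongr
    -- The neighbour's data must carry its own size, which costs a factor `σ²`.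
    have e2 : ρ ^ 2 * normL2 B gT ≤ h ^ 2 * F + σ ^ 2 * (size K' ^ 2 * F') := by
      calc ρ ^ 2 * normL2 B gT ≤ h ^ 2 * (F + F') := by gcongr
        _ = h ^ 2 * F + h ^ 2 * F' := by ring
        _ ≤ h ^ 2 * F + (σ * size K') ^ 2 * F' := by gcongr
        _ = _ := by ring
    have e3 : 0 ≤ (σ ^ 2 - 1) * (W + h ^ 2 * G + h ^ 2 * F) :=
      mul_nonneg (by linarith) (by positivity)
    rw [hX]
    linarith
  have h3 : (|J| * (√(ρ ^ d) * ρ)) ^ 2 = ρ ^ (d + 2) * J ^ 2 := by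
    rw [mul_pow, mul_pow, sq_abs, Real.sq_sqrt (by positivity)]
    ring
  have h4 := hsurf γ hc hd0 h fun x hx z hz =>
    norm_sub_le_size (mem_hull (hγ hz)) (mem_hull (hγ hx))
  -- Surface measure and the weight `h³` together give `h ^ (d + 2)`, which matches the square of
  -- the left side of the kink bound.
  have hpow : h ^ 3 * h ^ (d - 1) = h ^ (d + 2) := by
    rw [← pow_add]; congr 1; omega
  calc h ^ 3 * ∫ x in hull γ, T.jump wT γ x ^ 2 ∂(μHE[d - 1])
      ≤ h ^ 3 * (C₃ * h ^ (d - 1) * J ^ 2) := by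
        gcongr
        exact Mesh.jump_sq_integral_le hJ h4
    _ = C₃ * (h ^ 3 * h ^ (d - 1)) * J ^ 2 := by ring
    _ = C₃ * τ ^ (d + 2) * (|J| * (√(ρ ^ d) * ρ)) ^ 2 := by
        rw [hpow, h3, hhρ, mul_pow]; ring
    _ ≤ C₃ * τ ^ (d + 2) * (C₂ * σ ^ 2 * X) ^ 2 := by gcongr
    _ = _ := by ring

set_option maxHeartbeats 1000000 in
/-- Efficiency of the residual indicator, for an approximation `(gT, wT)` of a weak solution. -/
theorem exists_indicator_bound (d : ℕ) (hd : 2 ≤ d) {σ : ℝ} (hσ : 1 ≤ σ) : ∃ C : ℝ, 0 < C ∧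
    ∀ (Ω : Set (E d)), IsOpen Ω → interior (closure Ω) ⊆ Ω → ∀ T : Mesh Ω,
    T.IsShapeRegular σ → ∀ (g w gT wT : E d → ℝ), IsWeakSolution Ω g w → IsL2 Ω g → IsL2 Ω w →
    IsL2 Ω gT → wT ∈ T.U1 → IsL2 (closure Ω) wT → ∀ q : Finset (E d) → E d → ℝ,
    (∀ K ∈ T.cells, q K ∈ Poly d 1) → ∀ K ∈ T.cells,
    T.indicator gT wT K ≤ C * (normL2 (T.patch K) (fun x => w x - wT x) +
      size K ^ 2 * normL2 (T.patch K) (fun x => g x - gT x) +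
      √(∑ L ∈ T.patchCells K, size L ^ 4 * normL2 (hull L) (fun x => gT x - q L x) ^ 2)) := by
  obtain ⟨C₁, hC₁, helem⟩ := exists_element_bound d hσ
  obtain ⟨C₂, hC₂, hside⟩ := exists_side_bound d hd hσ
  have hσ0 : 0 < σ := by linarith
  have hσ2 : 1 ≤ σ ^ 2 := by nlinarith
  have hd0 : 0 < d := by omega
  -- `A` bounds the element residuals of the cell and its neighbours by `X`; `D` bounds the sum over
  -- at most `d + 1` sides, each of which sees two such residuals.
  set A := C₁ * σ ^ 2 with hA
  have hA0 : 0 < A := by positivity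
  set D := (d + 1) * (C₂ * (1 + 2 * A) ^ 2) with hD
  have hD0 : 0 < D := by positivity
  refine ⟨A + D + 1, by positivity, ?_⟩
  intro Ω hΩ hsub T hT g w gT wT hweak hg hw hgT hwT hwT2 q hq K hK
  set W := normL2 (T.patch K) (fun x => w x - wT x) with hW
  set G := normL2 (T.patch K) (fun x => g x - gT x) with hG
  obtain ⟨O, hO⟩ : ∃ O, O = √(∑ L ∈ T.patchCells K,
    size L ^ 4 * normL2 (hull L) (fun x => gT x - q L x) ^ 2) := ⟨_, rfl⟩
  rw [← hO]
  have hW0 : 0 ≤ W := normL2_nonneg _ _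
  have hG0 : 0 ≤ G := normL2_nonneg _ _
  have hO0 : 0 ≤ O := hO ▸ Real.sqrt_nonneg _
  set h := size K with hh
  have hh0 : 0 < h := Mesh.size_pos hT hd0 hK
  set X := W + h ^ 2 * G + O with hX
  have hX0 : 0 ≤ X := by positivity
  have hpn := T.volume_patch_sdiff hsub K
  have hpc : T.patch K ⊆ closure Ω := Set.iUnion₂_subset fun L hL =>
    T.hull_subset_closure (T.mem_cells_of_mem_patchCells hL)
  have hwp : IsL2 (T.patch K) (fun x => w x - wT x) :=
    (hw.of_ae_subset hpn).fun_sub (hwT2.mono_set hpc)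
  have hgp : IsL2 (T.patch K) (fun x => g x - gT x) :=
    (hg.of_ae_subset hpn).fun_sub (hgT.of_ae_subset hpn)
  have hosc : ∀ L ∈ T.patchCells K,
      size L ^ 2 * normL2 (hull L) (fun x => gT x - q L x) ≤ O := by
    intro L hL
    rw [hO]
    refine Real.le_sqrt_of_sq_le ?_
    have h1 := Finset.single_le_sum (s := T.patchCells K) (f := fun L =>
      size L ^ 4 * normL2 (hull L) (fun x => gT x - q L x) ^ 2)
      (fun L _ => mul_nonneg (pow_nonneg Metric.diam_nonneg 4) (sq_nonneg _)) hL
    calc (size L ^ 2 * normL2 (hull L) (fun x => gT x - q L x)) ^ 2 =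
        size L ^ 4 * normL2 (hull L) (fun x => gT x - q L x) ^ 2 := by ring
      _ ≤ _ := h1
  have hcell : ∀ L ∈ T.patchCells K, size L ≤ σ * h → size L ^ 2 * normL2 (hull L) gT ≤ A * X := by
    intro L hL hLh
    have hLc := T.mem_cells_of_mem_patchCells hL
    obtain ⟨x₀, r, hr, hB, hσr⟩ := hT L hLc
    obtain ⟨c, m, -, hcm⟩ := hq L hLc
    have h1 := helem Ω hΩ hsub T g w gT wT hweak hg hw hwT L hLc
      (hgT.of_ae_subset (T.volume_hull_sdiff hsub hLc)) x₀ r hr hB hσr c m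
    simp only [← hcm] at h1
    have hsub' := T.hull_subset_patch hL
    have e1 : normL2 (hull L) (fun x => w x - wT x) ≤ W := normL2_mono_set hsub' hwp
    have hsz : 0 ≤ size L := Metric.diam_nonneg
    have e2 : size L ^ 2 * normL2 (hull L) (fun x => g x - gT x) ≤ σ ^ 2 * (h ^ 2 * G) := by
      have n1 := normL2_nonneg (hull L) fun x => g x - gT x
      have n2 : normL2 (hull L) (fun x => g x - gT x) ≤ G := normL2_mono_set hsub' hgp
      calc size L ^ 2 * normL2 (hull L) (fun x => g x - gT x) ≤ (σ * h) ^ 2 * G := by gcongr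
        _ = _ := by ring
    have e3 := hosc L hL
    refine h1.trans ?_
    rw [hA, mul_assoc]
    refine mul_le_mul_of_nonneg_left ?_ hC₁.le
    have e4 : 0 ≤ (σ ^ 2 - 1) * (W + O) := mul_nonneg (by linarith) (by positivity)
    rw [hX]
    linarith
  have hhσ : h ≤ σ * h := le_mul_of_one_le_left hh0.le hσ
  have hF := hcell K (T.mem_patchCells_self hK) hhσ
  have hjump : size K ^ 3 * T.jumpNormSq wT K ≤ D * X ^ 2 := by
    rw [Mesh.jumpNormSq, Finset.mul_sum]
    have hbound : ∀ γ ∈ T.sidesOf K,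
        size K ^ 3 * ∫ x in hull γ, T.jump wT γ x ^ 2 ∂(μHE[d - 1]) ≤
          C₂ * (1 + 2 * A) ^ 2 * X ^ 2 := by
      intro γ hγ
      obtain ⟨hγK, hc, K', hK', hne, hγ'⟩ := Mesh.exists_neighbour hγ
      have hKp := Mesh.mem_patchCells_of_side hγ hK' hγ'
      have h1 := hside Ω hΩ hsub T hT g w gT wT hweak hg hw hgT hwT hwT2 K K' γ hK hKp hne hγK hγ' hc
      have h2 := hcell K' hKp (Mesh.size_le_mul_size hσ0.le hT hd hK' hγ' hγK hc)
      refine h1.trans ?_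
      rw [mul_assoc, ← mul_pow]
      have h3 : 0 ≤ normL2 (hull K) gT := normL2_nonneg _ _
      have h4 : 0 ≤ normL2 (hull K') gT := normL2_nonneg _ _
      have h5 : W + h ^ 2 * G ≤ X := by rw [hX]; linarith
      have h6 : 0 ≤ W + h ^ 2 * G + h ^ 2 * normL2 (hull K) gT +
        size K' ^ 2 * normL2 (hull K') gT := by positivity
      refine mul_le_mul_of_nonneg_left (pow_le_pow_left₀ h6 ?_ 2) hC₂.le
      linarith
    refine (Finset.sum_le_card_nsmul _ _ _ hbound).trans ?_
    rw [nsmul_eq_mul, hD, mul_assoc ((d : ℝ) + 1)]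
    refine mul_le_mul_of_nonneg_right ?_ (by positivity)
    exact_mod_cast Mesh.card_sidesOf_le hK
  have helemsq : size K ^ 4 * normL2 (hull K) gT ^ 2 ≤ (A * X) ^ 2 := by
    have h3 : 0 ≤ normL2 (hull K) gT := normL2_nonneg _ _
    calc size K ^ 4 * normL2 (hull K) gT ^ 2 = (h ^ 2 * normL2 (hull K) gT) ^ 2 := by ring
      _ ≤ _ := pow_le_pow_left₀ (by positivity) hF 2
  rw [Mesh.indicator, Real.sqrt_le_iff]
  refine ⟨by positivity, (add_le_add helemsq hjump).trans ?_⟩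
  rw [← sub_nonneg]
  have e : ((A + D + 1) * X) ^ 2 - ((A * X) ^ 2 + D * X ^ 2) =
      (2 * A * D + 2 * A + D + D ^ 2 + 1) * X ^ 2 := by ring
  rw [e]
  positivity

/-! ### The projection formulas for the control and the subgradient -/

theorem abs_proj_sub_proj_le (a b s t : ℝ) : |proj a b s - proj a b t| ≤ |s - t| := by
  rw [proj, proj]
  refine (abs_min_sub_min_le_max _ _ _ _).trans ?_
  rw [sub_self, abs_zero, max_eq_right (abs_nonneg _)]
  refine (abs_max_sub_max_le_max _ _ _ _).trans ?_
  rw [sub_self, abs_zero, max_eq_right (abs_nonneg _)]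

/-- The pointwise variational inequality characterizes the control as a projection. -/
theorem eq_proj_of_variational {α a b u s : ℝ} (hα : 0 < α) (hau : a ≤ u) (hub : u ≤ b)
    (h1 : 0 ≤ (α * (u - s)) * (a - u)) (h2 : 0 ≤ (α * (u - s)) * (b - u)) : u = proj a b s := by
  rw [proj]
  rcases lt_trichotomy u s with h | h | h
  · have h3 : α * (u - s) < 0 := mul_neg_of_pos_of_neg hα (by linarith)
    have h4 : u = b := by
      by_contra hne
      exact absurd h2 (not_le.2 (mul_neg_of_neg_of_pos h3 (sub_pos.2 (lt_of_le_of_ne hub hne))))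
    rw [max_eq_right (by linarith), min_eq_left (by linarith), h4]
  · rw [max_eq_right (by linarith), min_eq_right (by linarith), h]
  · have h3 : 0 < α * (u - s) := mul_pos hα (by linarith)
    have h4 : u = a := by
      by_contra hne
      exact absurd h1 (not_le.2 (mul_neg_of_pos_of_neg h3
        (sub_neg.2 (lt_of_le_of_ne hau (Ne.symm hne)))))
    rw [max_eq_left (by linarith), min_eq_right (by linarith), h4]

/-- The pointwise optimality conditions characterize the subgradient as a projection. -/
theorem subgradient_eq_proj {α β a b u p l : ℝ} (hα : 0 < α) (hβ : 0 < β) (ha : a < 0) (hb : 0 < b)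
    (hl1 : -1 ≤ l) (hl2 : l ≤ 1) (hlu : |u| ≤ l * u)
    (h1 : 0 ≤ (p + α * u + β * l) * (a - u)) (h2 : 0 ≤ (p + α * u + β * l) * (b - u)) :
    l = proj (-1) 1 (-(1 / β) * p) := by
  have hs : -(1 / β) * p = (-p) / β := by ring
  rw [proj, hs]
  -- If `u ≠ 0`, then `l` is the sign of `u`, and the strict slack towards `b` or `a` fixes the sign
  -- of the multiplier, so `-p/β` is cut off. If `u = 0`, both directions are free because `a < 0 <
  -- b`, hence `p + β l = 0`.
  rcases lt_trichotomy u 0 with h | h | h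
  · have hl : l = -1 := by
      rw [abs_of_neg h] at hlu
      by_contra hne
      have : -1 < l := lt_of_le_of_ne hl1 (Ne.symm hne)
      nlinarith
    have hz : 0 ≤ p + α * u + β * l := nonneg_of_mul_nonneg_left h2 (by linarith)
    have hle : (-p) / β ≤ -1 := by
      rw [div_le_iff₀ hβ]
      rw [hl] at hz
      nlinarith [mul_neg_of_pos_of_neg hα h]
    rw [max_eq_left hle, min_eq_right (by norm_num), hl]
  · subst h
    simp only [mul_zero, add_zero, sub_zero] at h1 h2
    have hz1 : 0 ≤ p + β * l := nonneg_of_mul_nonneg_left h2 hb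
    have hz2 : p + β * l ≤ 0 := by
      by_contra hcon
      exact absurd h1 (not_le.2 (mul_neg_of_pos_of_neg (not_le.1 hcon) ha))
    have hpl : (-p) / β = l := by
      rw [div_eq_iff hβ.ne']; linarith
    rw [hpl, max_eq_right hl1, min_eq_right hl2]
  · have hl : l = 1 := by
      rw [abs_of_pos h] at hlu
      by_contra hne
      have : l < 1 := lt_of_le_of_ne hl2 hne
      nlinarith
    have hz : p + α * u + β * l ≤ 0 := by
      by_contra hcon
      exact absurd h1 (not_le.2 (mul_neg_of_pos_of_neg (not_le.1 hcon) (by linarith)))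
    have hle : 1 ≤ (-p) / β := by
      rw [le_div_iff₀ hβ]
      rw [hl] at hz
      nlinarith [mul_pos hα h]
    rw [max_eq_right (by linarith), min_eq_left hle, hl]

/-! ### Localization of the optimality conditions -/

/-- A function whose integral over each measurable set is nonnegative is nonnegative. -/
theorem ae_nonneg_of_forall_integral_indicator {X : Type*} [MeasurableSpace X] {μ : Measure X}
    {F : X → ℝ} (hF : Integrable F μ)
    (h : ∀ A, MeasurableSet A → 0 ≤ ∫ x, A.indicator F x ∂μ) : ∀ᵐ x ∂μ, 0 ≤ F x :=
  ae_nonneg_of_forall_setIntegral_nonneg hF fun A hA _ => by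
    rw [← integral_indicator hA]; exact h A hA

/-- Perturbing `u` by `v` on an arbitrary measurable set only turns the integral inequality into a
pointwise one. -/
theorem IsSubgradient.ae_mul_le {u lam v : E d → ℝ}
    (hu : MemLp u 1 (volume.restrict Ω)) (h : IsSubgradient Ω u lam)
    (hv : MemLp v 1 (volume.restrict Ω)) :
    ∀ᵐ x ∂(volume.restrict Ω), lam x * v x ≤ |u x + v x| - |u x| := by
  set μ := volume.restrict Ω
  have huI : Integrable u μ := memLp_one_iff_integrable.1 hu
  have hvI : Integrable v μ := memLp_one_iff_integrable.1 hv
  have hlv : Integrable (fun x => lam x * v x) μ := MemLp.integrable_mul (p := ⊤) (q := 1) h.1 hv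
  have hF : Integrable (fun x => |u x + v x| - |u x| - lam x * v x) μ :=
    ((huI.add hvI).abs.sub huI.abs).sub hlv
  refine (ae_nonneg_of_forall_integral_indicator hF fun A hA => ?_).mono fun x hx => by linarith
  have hw : MemLp (fun x => u x + A.indicator v x) 1 μ := hu.add (hv.indicator hA)
  have h1 := h.2 _ hw
  simp only [add_sub_cancel_left] at h1
  have hli : Integrable (fun x => lam x * A.indicator v x) μ :=
    MemLp.integrable_mul (p := ⊤) (q := 1) h.1 (hv.indicator hA)
  have h2 : ∫ x, A.indicator (fun x => |u x + v x| - |u x| - lam x * v x) x ∂μ =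
      (∫ x, |u x + A.indicator v x| ∂μ) - (∫ x, |u x| ∂μ) - ∫ x, lam x * A.indicator v x ∂μ := by
    have h3 : Integrable (fun x => |u x + A.indicator v x| - |u x|) μ :=
      (memLp_one_iff_integrable.1 hw).abs.sub huI.abs
    rw [← integral_sub (memLp_one_iff_integrable.1 hw).abs huI.abs, ← integral_sub h3 hli]
    refine integral_congr_ae (Eventually.of_forall fun x => ?_)
    by_cases hx : x ∈ A <;> simp [hx]
  rw [h2]
  linarith

/-- Replacing `u` by the constant `t` on a measurable set preserves admissibility, so the inequality
localizes. -/
theorem ae_mul_sub_nonneg_of_variational {z u : E d → ℝ} {a b t : ℝ}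
    (hfin : IsFiniteMeasure (volume.restrict Ω)) (hz : IsL2 Ω z) (hu : u ∈ Uad Ω a b)
    (hat : a ≤ t) (htb : t ≤ b)
    (h : ∀ w ∈ Uad Ω a b, 0 ≤ ∫ x in Ω, z x * (w x - u x)) :
    ∀ᵐ x ∂(volume.restrict Ω), 0 ≤ z x * (t - u x) := by
  have htu : IsL2 Ω fun x => t - u x := (memLp_const t).sub hu.1
  refine ae_nonneg_of_forall_integral_indicator
    (MemLp.integrable_mul (p := 2) (q := 2) hz htu) fun A hA => ?_
  have h1 := h (fun x => u x + A.indicator (fun x => t - u x) x) ⟨?_, ?_⟩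
  · simp only [add_sub_cancel_left] at h1
    refine h1.trans (le_of_eq (integral_congr_ae (Eventually.of_forall fun x => ?_)))
    by_cases hx : x ∈ A <;> simp [hx]
  · exact MemLp.add hu.1 (MemLp.indicator hA htu)
  · filter_upwards [hu.2] with x hx
    by_cases hxA : x ∈ A
    · simp [hxA, hat, htb]
    · simpa [hxA] using hx

theorem IsWeakSolution.isL2 {g w : E d → ℝ} (h : IsWeakSolution Ω g w) : IsL2 Ω w := by
  obtain ⟨G, hG, -⟩ := h
  exact hG.1

/-- The projection formulas for the optimal subgradient and the optimal control. -/
theorem OptimalitySystem.ae_eq_proj (hΩ : Bornology.IsBounded Ω) {f yΩ y p u lam : E d → ℝ}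
    {α β a b : ℝ} (hα : 0 < α) (hβ : 0 < β) (ha : a < 0) (hb : 0 < b)
    (h : OptimalitySystem Ω f yΩ α β a b y p u lam) :
    ∀ᵐ x ∂(volume.restrict Ω), lam x = proj (-1) 1 (-(1 / β) * p x) ∧
      u x = proj a b (-(1 / α) * (p x + β * lam x)) := by
  have hfin : IsFiniteMeasure (volume.restrict Ω) := ⟨by simpa using hΩ.measure_lt_top⟩
  have hu2 : IsL2 Ω u := h.admissible.1
  have hu1 : MemLp u 1 (volume.restrict Ω) := hu2.mono_exponent (by norm_num)
  have hl2 : IsL2 Ω lam := h.subgradient.1.mono_exponent le_top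
  have hp2 : IsL2 Ω p := h.adjoint.isL2
  have hz : IsL2 Ω fun x => p x + α * u x + β * lam x :=
    (MemLp.add hp2 (MemLp.const_mul hu2 α)).add (MemLp.const_mul hl2 β)
  -- The perturbations `1` and `-1` give `|lam| ≤ 1`, and `-u` gives `|u| ≤ lam * u`. For the
  -- control only the extreme values `a` and `b` are needed.
  filter_upwards [h.subgradient.ae_mul_le hu1 (memLp_const 1),
    h.subgradient.ae_mul_le hu1 (memLp_const (-1)), h.subgradient.ae_mul_le hu1 hu1.neg,
    ae_mul_sub_nonneg_of_variational hfin hz h.admissible le_rfl (ha.trans hb).le h.variational,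
    ae_mul_sub_nonneg_of_variational hfin hz h.admissible (ha.trans hb).le le_rfl h.variational,
    h.admissible.2] with x h1 h2 h3 h4 h5 h6
  have e1 := abs_add_le (u x) 1
  have e2 := abs_add_le (u x) (-1)
  rw [abs_neg] at e2
  rw [abs_one] at e1 e2
  simp only [Pi.neg_apply, add_neg_cancel, abs_zero] at h3
  refine ⟨subgradient_eq_proj hα hβ ha hb (by linarith) (by linarith) (by linarith) h4 h5, ?_⟩
  have hs : p x + α * u x + β * lam x = α * (u x - -(1 / α) * (p x + β * lam x)) := by
    field_simp
    ring
  rw [hs] at h4 h5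
  exact eq_proj_of_variational hα h6.1 h6.2 h4 h5

theorem abs_lamTilde_sub_le {β : ℝ} (hβ : 0 < β) (pT : E d → ℝ) (x : E d) (s : ℝ) :
    |lamTilde β pT x - proj (-1) 1 (-(1 / β) * s)| ≤ β⁻¹ * |s - pT x| := by
  refine (abs_proj_sub_proj_le _ _ _ _).trans (le_of_eq ?_)
  rw [← mul_sub, abs_mul, abs_neg, one_div, abs_of_pos (inv_pos.2 hβ), abs_sub_comm]

/-- The factor `2` arises because `p` enters once directly and once through the inner projection,
where `β` cancels the Lipschitz constant `β⁻¹`. -/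
theorem abs_uTilde_sub_le {α β : ℝ} (hα : 0 < α) (hβ : 0 < β) (a b : ℝ) (pT : E d → ℝ) (x : E d)
    (s : ℝ) :
    |uTilde α β a b pT x - proj a b (-(1 / α) * (s + β * proj (-1) 1 (-(1 / β) * s)))| ≤
      2 * α⁻¹ * |s - pT x| := by
  refine (abs_proj_sub_proj_le _ _ _ _).trans ?_
  have h1 := abs_lamTilde_sub_le hβ pT x s
  rw [← mul_sub, abs_mul, abs_neg, one_div, abs_of_pos (inv_pos.2 hα), mul_comm (2 : ℝ), mul_assoc]
  refine mul_le_mul_of_nonneg_left ?_ (inv_pos.2 hα).le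
  have h2 : pT x + β * lamTilde β pT x - (s + β * proj (-1) 1 (-(1 / β) * s)) =
      (pT x - s) + β * (lamTilde β pT x - proj (-1) 1 (-(1 / β) * s)) := by ring
  rw [h2]
  refine (abs_add_le _ _).trans ?_
  rw [abs_mul, abs_of_pos hβ, abs_sub_comm (pT x)]
  have h3 := mul_le_mul_of_nonneg_left h1 hβ.le
  rw [← mul_assoc, mul_inv_cancel₀ hβ.ne', one_mul] at h3
  linarith

theorem normL2_const_mul_abs {A : Set (E d)} {c : ℝ} (hc : 0 ≤ c) (w : E d → ℝ) :
    normL2 A (fun x => c * |w x|) = c * normL2 A w := by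
  have h := eLpNorm_const_smul (p := 2) (μ := volume.restrict A) c (fun x => |w x|)
  have h1 : (c • fun x => |w x|) = fun x => c * |w x| := rfl
  have h2 : eLpNorm (fun x => |w x|) 2 (volume.restrict A) = eLpNorm w 2 (volume.restrict A) :=
    eLpNorm_norm w
  rw [h1, h2] at h
  rw [normL2, h, ENNReal.toReal_mul, normL2]
  simp [abs_of_nonneg hc]

/-- If `|v - u| ≤ c |p|` almost everywhere, then `‖v - w‖ ≤ ‖u - w‖ + c ‖p‖`. -/
theorem normL2_sub_le_of_ae_abs_sub_le {A : Set (E d)} {u v w p : E d → ℝ} {c : ℝ} (hc : 0 ≤ c)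
    (huw : IsL2 A fun x => u x - w x) (hp : IsL2 A p)
    (h : ∀ᵐ x ∂(volume.restrict A), |v x - u x| ≤ c * |p x|) :
    normL2 A (fun x => v x - w x) ≤ normL2 A (fun x => u x - w x) + c * normL2 A p := by
  have h1 : IsL2 A fun x => 1 * |u x - w x| := MemLp.const_mul (MemLp.abs huw) 1
  have h2 : IsL2 A fun x => c * |p x| := MemLp.const_mul (MemLp.abs hp) c
  have h3 := normL2_le_of_ae_abs_le (v := fun x => v x - w x) (MemLp.add h1 h2) (h.mono fun x hx => by
    simp only [Pi.add_apply]
    rw [← sub_add_sub_cancel (v x) (u x) (w x)]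
    refine (abs_add_le _ _).trans ?_
    linarith)
  refine h3.trans ((normL2_add_le h1 h2).trans (le_of_eq ?_))
  rw [normL2_const_mul_abs zero_le_one, normL2_const_mul_abs hc, one_mul]

/-! ### Oscillation and the final bounds -/

/-- Adding the discrete part of the data to the projection of the given part leaves an affine
function for either degree, so it is an admissible local approximation. -/
theorem poly_add_mem {ℓ : Fin 2} {v q : E d → ℝ} (hv : v ∈ Poly d 1) (hq : q ∈ Poly d ℓ) :
    (fun x => v x + q x) ∈ Poly d 1 := by
  obtain ⟨c, m, -, h⟩ := hv
  obtain ⟨c', m', -, h'⟩ := hq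
  refine ⟨c + c', m + m', by simp, fun x => ?_⟩
  simp only [h, h', inner_add_left]
  ring

theorem osc_one_eq {ℓ : Fin 2} {f : E d → ℝ} {S : Finset (Finset (E d))}
    {F : Finset (E d) → E d → ℝ}
    (h : ∀ K ∈ S, normL2 (hull K) (F K) = normL2 (hull K) fun x => f x - l2Proj ℓ K f x) :
    √(∑ K ∈ S, size K ^ 4 * normL2 (hull K) (F K) ^ 2) = osc 1 ℓ f S := by
  rw [osc]
  congr 1
  refine Finset.sum_congr rfl fun K hK => ?_
  rw [h K hK]

end

end SparseControl

open SparseControl in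
theorem theorem5p8 (d : ℕ) (hd : d = 2 ∨ d = 3) (σ : ℝ) :
    ∃ C : ℝ, 0 < C ∧
      ∀ (Ω : Set (SparseControl.E d)), IsOpen Ω → Bornology.IsBounded Ω →
        SparseControl.HasLipschitzBoundary Ω →
      ∀ T : SparseControl.Mesh Ω, T.IsShapeRegular σ →
      ∀ f yΩ : SparseControl.E d → ℝ, SparseControl.IsL2 Ω f → SparseControl.IsL2 Ω yΩ →
      ∀ α β a b : ℝ, 0 < α → 0 < β → a < 0 → 0 < b →
      ∀ y p u lam : SparseControl.E d → ℝ,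
        SparseControl.OptimalitySystem Ω f yΩ α β a b y p u lam →
      ∀ yT pT uT lamT : SparseControl.E d → ℝ,
        T.DiscreteOptimalitySystem f yΩ α β a b yT pT uT lamT →
      ∀ ℓ : Fin 2, ∀ K ∈ T.cells,
        T.Ey f yT uT K ≤
          C * (SparseControl.normL2 (T.patch K) (fun x => y x - yT x)
            + SparseControl.size K ^ 2 * SparseControl.normL2 (T.patch K) (fun x => u x - uT x)
            + SparseControl.osc 1 ℓ f (T.patchCells K)) ∧
        T.Ep yΩ yT pT K ≤
          C * (SparseControl.normL2 (T.patch K) (fun x => p x - pT x)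
            + SparseControl.size K ^ 2 * SparseControl.normL2 (T.patch K) (fun x => y x - yT x)
            + SparseControl.osc 1 ℓ yΩ (T.patchCells K)) ∧
        SparseControl.Eu α β a b pT uT K ≤
          SparseControl.normL2 (SparseControl.hull K) (fun x => u x - uT x)
            + 2 * α⁻¹ * SparseControl.normL2 (SparseControl.hull K) (fun x => p x - pT x) ∧
        SparseControl.Elam β pT lamT K ≤
          SparseControl.normL2 (SparseControl.hull K) (fun x => lam x - lamT x)
            + β⁻¹ * SparseControl.normL2 (SparseControl.hull K) (fun x => p x - pT x) := by
  -- Enlarging `σ` to at least `1` preserves shape regularity and meets the assumption of the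
  -- indicator bound.
  obtain ⟨C, hC, hind⟩ := exists_indicator_bound d (by omega) (le_max_right σ 1)
  refine ⟨C, hC, ?_⟩
  intro Ω hΩ hb hL T hT f yΩ hf hyΩ α β a b hα hβ ha hb0 y p u lam hopt yT pT uT lamT hdisc ℓ K hK
  have hsub := hL.interior_closure_subset hΩ
  have hT' : T.IsShapeRegular (max σ 1) := by
    intro L hLc
    obtain ⟨x, r, hr, hB, hle⟩ := hT L hLc
    exact ⟨x, r, hr, hB, hle.trans (mul_le_mul_of_nonneg_right (le_max_left _ _) hr.le)⟩
  have hfin : IsFiniteMeasure (volume.restrict Ω) := ⟨by simpa using hb.measure_lt_top⟩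
  have hu2 : IsL2 Ω u := hopt.admissible.1
  have hl2 : IsL2 Ω lam := hopt.subgradient.1.mono_exponent le_top
  have hy2 : IsL2 Ω y := hopt.state.isL2
  have hp2 : IsL2 Ω p := hopt.adjoint.isL2
  have hyTc := T.isL2_closure hb hdisc.mem_y.1
  have hpTc := T.isL2_closure hb hdisc.mem_p.1
  have huTc := T.isL2_closure hb hdisc.mem_u.1
  have hlTc := T.isL2_closure hb hdisc.subgradient.1
  have hpatch : ∀ L ∈ T.patchCells K, L ∈ T.cells := fun L hL =>
    T.mem_cells_of_mem_patchCells hL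
  have hproj : ∀ g : E d → ℝ, IsL2 Ω g → ∀ L ∈ T.cells, l2Proj ℓ L g ∈ Poly d ℓ :=
    fun g hg L hLc => (l2Proj_spec ℓ L g (hg.of_ae_subset (T.volume_hull_sdiff hsub hLc))).1
  have hnull := T.volume_hull_sdiff hsub hK
  have hKc := T.hull_subset_closure hK
  have hae : ∀ᵐ x ∂(volume.restrict (hull K)), lam x = proj (-1) 1 (-(1 / β) * p x) ∧
      u x = proj a b (-(1 / α) * (p x + β * lam x)) :=
    ae_mono (Measure.restrict_mono_ae (ae_le_set.2 hnull)) (hopt.ae_eq_proj hb hα hβ ha hb0)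
  have hpK : IsL2 (hull K) fun x => p x - pT x :=
    (hp2.of_ae_subset hnull).fun_sub (hpTc.mono_set hKc)
  refine ⟨?_, ?_, ?_, ?_⟩
  -- On each cell the approximation is `uT` plus the projection of `f`; since `uT` is affine there,
  -- the data error is exactly the oscillation of `f`.
  · choose! cu mu hcm using fun L (hLc : L ∈ T.cells) => T.exists_affine hdisc.mem_u.1 hLc
    have h := hind Ω hΩ hsub T hT' _ y (fun x => uT x + f x) yT hopt.state (MemLp.add hu2 hf) hy2
      (MemLp.add (huTc.mono_set subset_closure) hf) hdisc.mem_y.1 hyTc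
      (fun L x => (cu L + ⟪mu L, x⟫) + l2Proj ℓ L f x)
      (fun L hLc => poly_add_mem ⟨cu L, mu L, by simp, fun _ => rfl⟩ (hproj f hf L hLc)) K hK
    simp only [add_sub_add_right_eq_sub] at h
    rwa [osc_one_eq fun L hLp => normL2_congr_ae
      ((ae_restrict_mem (isCompact_hull L).measurableSet).mono fun x hx => by
        rw [hcm L (hpatch L hLp) x hx]
        exact add_sub_add_left_eq_sub _ _ _)] at h
  · choose! cy my hcm using fun L (hLc : L ∈ T.cells) => T.exists_affine hdisc.mem_y.1 hLc
    -- The data enter the adjoint equation with a minus sign, so the data error is the negative of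
    -- the one in the oscillation of `yΩ`.
    have hneg : ∀ L ∈ T.cells, (fun x => -l2Proj ℓ L yΩ x) ∈ Poly d ℓ := by
      intro L hLc
      obtain ⟨c, m, h0, h⟩ := hproj yΩ hyΩ L hLc
      refine ⟨-c, -m, fun hl => by rw [h0 hl, neg_zero], fun x => ?_⟩
      simp only [h, inner_neg_left, neg_add]
    have h := hind Ω hΩ hsub T hT' _ p (fun x => yT x - yΩ x) pT hopt.adjoint (hy2.fun_sub hyΩ) hp2
      ((hyTc.mono_set subset_closure).fun_sub hyΩ) hdisc.mem_p.1 hpTc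
      (fun L x => (cy L + ⟪my L, x⟫) + -l2Proj ℓ L yΩ x)
      (fun L hLc => poly_add_mem ⟨cy L, my L, by simp, fun _ => rfl⟩ (hneg L hLc)) K hK
    simp only [sub_sub_sub_cancel_right] at h
    rwa [osc_one_eq fun L hLp => (normL2_congr_ae
      ((ae_restrict_mem (isCompact_hull L).measurableSet).mono fun x hx => by
        rw [hcm L (hpatch L hLp) x hx]
        ring)).trans (normL2_neg _ _)] at h
  · refine normL2_sub_le_of_ae_abs_sub_le (by positivity)
      ((hu2.of_ae_subset hnull).fun_sub (huTc.mono_set hKc)) hpK (hae.mono fun x hx => ?_)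
    rw [hx.2, hx.1]
    exact abs_uTilde_sub_le hα hβ a b pT x (p x)
  · refine normL2_sub_le_of_ae_abs_sub_le (by positivity)
      ((hl2.of_ae_subset hnull).fun_sub (hlTc.mono_set hKc)) hpK (hae.mono fun x hx => ?_)
    rw [hx.1]
    exact abs_lamTilde_sub_le hβ pT x (p x)
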